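/- Let $m_1,m_2,m_3\ge 1$, $m=m_1+m_2+m_3$, and let $\gamma=\gamma_{m_1,m_2,m_3}\in S_m$ be the permutation whose three cycles are $(1,\dots,m_1)$, $(m_1+1,\dots,m_1+m_2)$, $(m_1+m_2+1,\dots,m)$. For a permutation or partition $\pi$ of $[m]$ let $\#(\pi)$ be its number of cycles or blocks, and let $|\pi|=m-\#(\pi)$; a permutation is also read as the partition into its cycles. Let $NC_2(m_1,m_2,m_3)$ be the set of $\sigma\in S_m$, all of whose cycles have two elements, with $|\sigma|+|\sigma^{-1}\gamma|=|\gamma|+4$ and $\sigma\vee\gamma=1_m$. **Quotient graphs.** For a partition $\pi$ of $[m]$, $T^\pi$ is the oriented graph whose vertices are the blocks of $\pi$ and whose edges are $e_u=([\gamma(u)]_\pi,[u]_\pi)$, $u\in[m]$ (vertices and edges are labelled, so $T^\pi$ determines $\pi$). For $J\subseteq\{1,2,3\}$, $T^\pi_J$ consists of the edges $e_u$ with $u$ in one of the cycles of $\gamma$ numbered by $J$, together with the blocks meeting these cycles. The elementarization $\overline{G}$ of an oriented graph $G$ merges all edges that connect the same pair of vertices and forgets orientations; the multiplicity of an edge of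 $\overline{G}$ is the number of edges merged into it. Let $\overline\pi$ be the partition of $[m]$ with $u\sim v$ iff $e_u,e_v$ connect the same pair of vertices of $T^\pi$, and put $q_1(\pi)=\#(\pi)-\#(\overline\pi)$, $q_2(\pi)=\#(\overline\pi)-m/2$, $q=q_1+q_2$. Call $G$ *doubled* if each edge of $\overline{G}$ has multiplicity $2$ and consists of two edges of opposite orientation (loops at the same vertex count as oppositely oriented). A *double tree* is a doubled $G$ with $\overline{G}$ a tree. A *double unicircuit graph* $T^\pi_{\{j,k\}}$ is a doubled one for which $\overline{T^\pi_{\{j,k\}}}$ is connected with a single circuit (a loop is a circuit of length one), each edge of the circuit consisting of one edge from cycle $j$ and one from cycle $k$. Two graphs are joined along an edge (or at a vertex) if their elementarizations share exactly this edge and its end points (or their vertex sets meet in exactly this vertex). Then $T^\pi$ is - of *2-6 tree type* ($\mathcal T_{2,6}$) if the three $T^\pi_{\{j\}}$ are double trees, joined along one common edge; - of *2-4-4 tree type* ($\mathcal T_{2,4,4}$) if the three $T^\pi_{\{j\}}$ are double trees, two of them joined along an edge and the third joined to their union along a different edge; - of *2-4 uniloop type* ($\mathcal{UL}_{2,4}$)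 if, for some $\{i,j,k\}=\{1,2,3\}$, $T^\pi_{\{i\}}$ has exactly two loops at some vertex $v$ and becomes a double tree when they are removed, $T^\pi_{\{j,k\}}$ is a double unicircuit graph whose circuit is a loop at $v$, and the two are joined at $v$; - of *2-4 unicircuit type* ($\mathcal{UC}_{2,4}$) if, for some $\{i,j,k\}=\{1,2,3\}$, $T^\pi_{\{i\}}$ is a double tree, $T^\pi_{\{j,k\}}$ is a double unicircuit graph, and the two are joined along an edge. **Limit graphs.** Let $X_N=N^{-1/2}(x_{a,b})$ be a complex $N\times N$ Wigner matrix: $x_{a,b}=\overline{x_{b,a}}$; the entries on and above the diagonal are independent, those above the diagonal identically distributed, those on the diagonal identically distributed; all absolute moments are finite; $E(x_{a,b})=0$, $E|x_{a,b}|^2=1$, $E(x_{a,b}^2)=0$ for $a\ne b$, and $k_3(x_{a,a},x_{a,a},x_{a,a})=0$, where $k_3$ is the third classical cumulant. Assume $N\ge m/2-1$ and the non-degeneracy conditions $$E|x_{a,b}|^4\ne 1,\quad E|x_{a,b}|^6-3E|x_{a,b}|^4+2\ne 0\ \ (a\ne b),\qquad E(x_{a,a}^4)\ne 1 .$$ For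 a partition $\pi$ of $[m]$ put $$C_\pi=\sum_{i:[m]\to[N],\ \ker i=\pi}N^{-m/2+1}\,k_3(r_1,r_2,r_3),\qquad r_j=\prod_{u\text{ in the }j\text{-th cycle of }\gamma}x_{i(u),i(\gamma(u))}.$$ Let $\mathcal{LG}$ be the set of the graphs $T^\pi$ with $q(\pi)=-1$ and $C_\pi\ne0$ (limit graphs), and $\mathcal{DB}$ the set of those with $(q_1(\pi),q_2(\pi))=(-1,0)$ and $C_\pi\neq 0$ (double bicircuit graphs). **Statement.** For each partition $\pi$ of $[m]$, $T^\pi\in\mathcal{LG}$ if and only if $\pi=\gamma\sigma$ (as partitions) for some $\sigma\in NC_2(m_1,m_2,m_3)$. Thus $\sigma\mapsto T^{\gamma\sigma}$ maps $NC_2(m_1,m_2,m_3)$ onto $\mathcal{LG}$. Every graph in $\mathcal T_{2,6}\cup\mathcal{UL}_{2,4}$ is a limit graph and has exactly two preimages, and every other limit graph has exactly one. Hence $$|NC_2(m_1,m_2,m_3)|=|\mathcal{LG}|+|\mathcal{UL}_{2,4}|+|\mathcal T_{2,6}|,$$ $$|\mathcal{DB}|=|NC_2(m_1,m_2,m_3)|-|\mathcal{UC}_{2,4}|-|\mathcal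 T_{2,4,4}|-2|\mathcal{UL}_{2,4}|-2|\mathcal T_{2,6}| .$$ -/

import Mathlib

open MeasureTheory ProbabilityTheory

noncomputable section

namespace WignerThird

/-! ### Permutations and partitions on three circles -/

/-- The `m 0 + m 1 + m 2` points, arranged on three circles carrying `m 0`, `m 1` and `m 2` points:
`⟨j, a⟩` is the `a`-th point of the circle number `j`. -/
abbrev Pt (m : Fin 3 → ℕ) : Type := Σ j : Fin 3, Fin (m j)

/-- The permutation `γ_{m₁,m₂,m₃}`, which turns every circle by one step. -/
def gam (m : Fin 3 → ℕ) : Equiv.Perm (Pt m) :=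
  Equiv.sigmaCongrRight fun j => finRotate (m j)

/-- The number of blocks of a partition. -/
def numBlocks {α : Type*} (p : Setoid α) : ℕ := Nat.card (Quotient p)

/-- The partition of `α` into the cycles of `f` (fixed points are cycles of length one). -/
def cyclePartition {α : Type*} (f : Equiv.Perm α) : Setoid α := Equiv.Perm.SameCycle.setoid f

/-- The length `|f| = n - #(f)` of a permutation of `n` points, `#(f)` being the number of its
cycles. -/
def permLength {α : Type*} (f : Equiv.Perm α) : ℕ := Nat.card α - numBlocks (cyclePartition f)

/-- The non-crossing permutations `S_NC(m₁,m₂,m₃)`. -/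
def SNC (m : Fin 3 → ℕ) : Set (Equiv.Perm (Pt m)) :=
  {f | permLength f + permLength (f⁻¹ * gam m) = permLength (gam m) + 2 * (3 - 1) ∧
    cyclePartition f ⊔ cyclePartition (gam m) = ⊤}

/-- The non-crossing pairings `NC₂(m₁,m₂,m₃)`: all cycles have exactly two elements. -/
def NC2 (m : Fin 3 → ℕ) : Set (Equiv.Perm (Pt m)) :=
  {f | f ∈ SNC m ∧ ∀ x, f x ≠ x ∧ f (f x) = x}

/-! ### Graphs -/

/-- An unoriented graph without multiple edges, in which loops are allowed. -/
structure UGraph (α : Type*) where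
  /-- the vertices -/
  verts : Set α
  /-- the edges -/
  edges : Set (Sym2 α)
  incidence : ∀ e ∈ edges, ∀ v ∈ e, v ∈ verts

namespace UGraph

variable {α : Type*}

/-- The graph on the same vertices, without the loops, as a simple graph. -/
def toSimple (G : UGraph α) : SimpleGraph G.verts where
  Adj u v := u ≠ v ∧ s((u : α), (v : α)) ∈ G.edges
  symm := ⟨fun _ _ h => ⟨h.1.symm, Sym2.eq_swap (α := α) ▸ h.2⟩⟩
  loopless := ⟨fun _ h => h.1 rfl⟩

/-- Connectedness (loops play no role in it). -/
def Connected (G : UGraph α) : Prop := G.toSimple.Connected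

/-- A tree: there are no loops, and the graph is a tree as a simple graph. -/
def IsTree (G : UGraph α) : Prop := (∀ e ∈ G.edges, ¬ e.IsDiag) ∧ G.toSimple.IsTree

/-- The degree of a vertex; a loop counts twice. -/
def degree (G : UGraph α) (v : α) : ℕ :=
  {e | e ∈ G.edges ∧ v ∈ e ∧ ¬ e.IsDiag}.ncard + 2 * {e | e ∈ G.edges ∧ v ∈ e ∧ e.IsDiag}.ncard

/-- `C` is a circuit of `G`: a connected subgraph all of whose vertices have degree two in `C`. -/
def IsCircuit (C G : UGraph α) : Prop :=
  C.verts ⊆ G.verts ∧ C.edges ⊆ G.edges ∧ C.Connected ∧ ∀ v ∈ C.verts, C.degree v = 2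

/-- A unicircuit graph: a connected graph with a single circuit, that is, a connected graph with
the same number of vertices and edges. -/
def IsUnicircuit (G : UGraph α) : Prop := G.Connected ∧ G.verts.ncard = G.edges.ncard

/-- The union of two graphs. -/
def union (G H : UGraph α) : UGraph α where
  verts := G.verts ∪ H.verts
  edges := G.edges ∪ H.edges
  incidence := by
    rintro e (he | he) v hv
    · exact Or.inl (G.incidence e he v hv)
    · exact Or.inr (H.incidence e he v hv)

/-- `G` and `H` are joined exactly along the edge `e`: they share this edge and its end points, and
nothing else. -/
def JoinedAlongEdge (G H : UGraph α) (e : Sym2 α) : Prop :=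
  G.edges ∩ H.edges = {e} ∧ G.verts ∩ H.verts = {v | v ∈ e}

end UGraph

/-- An oriented graph with labelled edges; loops and multiple edges are allowed. The labels of the
edges are taken from `ε`; source and target matter on `edges` only. -/
@[ext]
structure OGraph (α ε : Type*) where
  /-- the vertices -/
  verts : Set α
  /-- the edges -/
  edges : Set ε
  /-- the source of an edge -/
  src : ε → α
  /-- the target of an edge -/
  tgt : ε → α
  src_mem : ∀ e ∈ edges, src e ∈ verts
  tgt_mem : ∀ e ∈ edges, tgt e ∈ verts

namespace OGraph

variable {α ε : Type*}

/-- The unordered pair of end points of an edge. Two edges `e`, `f` are equivalent if they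
connect the same pair of vertices, that is, if `G.ends e = G.ends f`. -/
def ends (G : OGraph α ε) (e : ε) : Sym2 α := s(G.src e, G.tgt e)

/-- The elementarization: equivalent edges are merged and the orientation is dropped. -/
def elem (G : OGraph α ε) : UGraph α where
  verts := G.verts
  edges := G.ends '' G.edges
  incidence := by
    rintro _ ⟨e, he, rfl⟩ v hv
    rcases Sym2.mem_iff.1 hv with rfl | rfl
    · exact G.src_mem e he
    · exact G.tgt_mem e he

/-- The class of the oriented edges which are merged into the edge `a` of the elementarization. -/
def edgeClass (G : OGraph α ε) (a : Sym2 α) : Set ε := {e | e ∈ G.edges ∧ G.ends e = a}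

/-- The edges `e` and `f` have opposite orientation. -/
def Opposite (G : OGraph α ε) (e f : ε) : Prop := G.src e = G.tgt f ∧ G.tgt e = G.src f

/-- Every edge of the elementarization has multiplicity two and consists of two edges of opposite
orientation. -/
def AllDouble (G : OGraph α ε) : Prop :=
  ∀ a ∈ G.elem.edges, ∃ e f, e ≠ f ∧ G.edgeClass a = {e, f} ∧ G.Opposite e f

/-- A double tree. -/
def IsDoubleTree (G : OGraph α ε) : Prop := G.elem.IsTree ∧ G.AllDouble

/-- The loops at the vertex `v`. -/
def loopsAt (G : OGraph α ε) (v : α) : Set ε := {e | e ∈ G.edges ∧ G.src e = v ∧ G.tgt e = v}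

/-- The graph without its loops at the vertex `v`; all vertices are kept. -/
def removeLoopsAt (G : OGraph α ε) (v : α) : OGraph α ε where
  verts := G.verts
  edges := G.edges \ G.loopsAt v
  src := G.src
  tgt := G.tgt
  src_mem e he := G.src_mem e he.1
  tgt_mem e he := G.tgt_mem e he.1

/-- A graph with two loops at the vertex `v`, whose removal leaves a double tree. -/
def IsDoubleUniloopAt (G : OGraph α ε) (v : α) : Prop :=
  v ∈ G.verts ∧ (G.loopsAt v).ncard = 2 ∧ (G.removeLoopsAt v).IsDoubleTree

end OGraph

/-! ### The quotient graphs -/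

variable {m : Fin 3 → ℕ}

/-- The block of the partition `p` containing `x`. -/
def block (p : Setoid (Pt m)) (x : Pt m) : Set (Pt m) := {y | p y x}

/-- The quotient graph `T^π`: its vertices are the blocks of `π`, and for each point `x` it has an
edge `e_x` from the block of `γ x` to the block of `x`. -/
def T (p : Setoid (Pt m)) : OGraph (Set (Pt m)) (Pt m) where
  verts := p.classes
  edges := Set.univ
  src x := block p (gam m x)
  tgt x := block p x
  src_mem x _ := p.mem_classes (gam m x)
  tgt_mem x _ := p.mem_classes x

/-- The part of the quotient graph `T^π` which comes from the circles in `J`: the edges `e_x` with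
`x` on one of these circles, and the blocks of `π` that meet these circles. -/
def TOn (p : Setoid (Pt m)) (J : Set (Fin 3)) : OGraph (Set (Pt m)) (Pt m) where
  verts := {B | B ∈ p.classes ∧ ∃ x ∈ B, x.1 ∈ J}
  edges := {x | x.1 ∈ J}
  src x := block p (gam m x)
  tgt x := block p x
  src_mem x hx := ⟨p.mem_classes (gam m x), gam m x, p.refl _, hx⟩
  tgt_mem x hx := ⟨p.mem_classes x, x, p.refl _, hx⟩

/-- The partition `π̄`: `x` and `y` are in the same block if and only if the edges `e_x` and `e_y`
of `T^π` connect the same pair of vertices. -/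
def edgePartition (p : Setoid (Pt m)) : Setoid (Pt m) := Setoid.ker (T p).ends

/-- `q₁(π) = #(π) - #(π̄)`. -/
def q₁ (p : Setoid (Pt m)) : ℚ := numBlocks p - numBlocks (edgePartition p)

/-- `q₂(π) = #(π̄) - m / 2`, where `m = m₁ + m₂ + m₃`. -/
def q₂ (p : Setoid (Pt m)) : ℚ := numBlocks (edgePartition p) - ((m 0 + m 1 + m 2 : ℕ) : ℚ) / 2

/-- `q(π) = q₁(π) + q₂(π)`. -/
def q (p : Setoid (Pt m)) : ℚ := q₁ p + q₂ p

/-- The edge `a` of the elementarization of `G` is a `(j, k)`-edge: all its edges come from the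
circles `j` and `k`, and each of the two circles contributes at least one edge. -/
def IsEdgeOfType (G : OGraph (Set (Pt m)) (Pt m)) (j k : Fin 3) (a : Sym2 (Set (Pt m))) : Prop :=
  (∀ x ∈ G.edgeClass a, x.1 = j ∨ x.1 = k) ∧
    (∃ x ∈ G.edgeClass a, x.1 = j) ∧ ∃ x ∈ G.edgeClass a, x.1 = k

/-- The part of `T^π` on the circles `j` and `k` is a double unicircuit graph. -/
def IsDoubleUnicircuit (p : Setoid (Pt m)) (j k : Fin 3) : Prop :=
  (TOn p {j, k}).elem.IsUnicircuit ∧ (TOn p {j, k}).AllDouble ∧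
    ∀ C : UGraph (Set (Pt m)), C.IsCircuit (TOn p {j, k}).elem →
      ∀ a ∈ C.edges, IsEdgeOfType (TOn p {j, k}) j k a

/-- The graphs on the single circles are three double trees, and `T^π` is obtained by joining them
along one and the same edge. -/
def IsTree26 (p : Setoid (Pt m)) : Prop :=
  (∀ j, (TOn p {j}).IsDoubleTree) ∧
    ∃ a, ∀ j k, j ≠ k → (TOn p {j}).elem.JoinedAlongEdge (TOn p {k}).elem a

/-- The graphs on the single circles are three double trees, and `T^π` is obtained by joining them
along two distinct edges: two of the trees are joined along an edge `a`, and the third tree is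
joined to the result along another edge `b`. -/
def IsTree244 (p : Setoid (Pt m)) : Prop :=
  (∀ j, (TOn p {j}).IsDoubleTree) ∧
    ∃ (t : Equiv.Perm (Fin 3)) (a b : Sym2 (Set (Pt m))), a ≠ b ∧
      (TOn p {t 0}).elem.JoinedAlongEdge (TOn p {t 1}).elem a ∧
      ((TOn p {t 0}).elem.union (TOn p {t 1}).elem).JoinedAlongEdge (TOn p {t 2}).elem b

/-- With `{i, j, k}` the three circles: the graph on the circle `i` has two loops at a vertex `v`,
without which it is a double tree; the graph on the circles `j`, `k` is a double unicircuit graph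
whose circuit is a loop at `v`; and `T^π` is obtained by joining these two graphs at `v`. -/
def IsUniloop24 (p : Setoid (Pt m)) : Prop :=
  ∃ (t : Equiv.Perm (Fin 3)) (v : Set (Pt m)),
    (TOn p {t 0}).IsDoubleUniloopAt v ∧
    IsDoubleUnicircuit p (t 1) (t 2) ∧ s(v, v) ∈ (TOn p {t 1, t 2}).elem.edges ∧
    (TOn p {t 0}).verts ∩ (TOn p {t 1, t 2}).verts = {v}

/-- With `{i, j, k}` the three circles: the graph on the circle `i` is a double tree, the graph on
the circles `j`, `k` is a double unicircuit graph, and `T^π` is obtained by joining these two graphs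
along an edge. -/
def IsUnicircuit24 (p : Setoid (Pt m)) : Prop :=
  ∃ (t : Equiv.Perm (Fin 3)) (a : Sym2 (Set (Pt m))),
    (TOn p {t 0}).IsDoubleTree ∧ IsDoubleUnicircuit p (t 1) (t 2) ∧
    (TOn p {t 0}).elem.JoinedAlongEdge (TOn p {t 1, t 2}).elem a

/-- The set `𝒯_{2,6}` of graphs of 2-6 tree type. -/
def T26 (m : Fin 3 → ℕ) : Set (OGraph (Set (Pt m)) (Pt m)) := T '' {p | IsTree26 p}

/-- The set `𝒯_{2,4,4}` of graphs of 2-4-4 tree type. -/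
def T244 (m : Fin 3 → ℕ) : Set (OGraph (Set (Pt m)) (Pt m)) := T '' {p | IsTree244 p}

/-- The set `𝒰ℒ_{2,4}` of graphs of 2-4 uniloop type. -/
def UL24 (m : Fin 3 → ℕ) : Set (OGraph (Set (Pt m)) (Pt m)) := T '' {p | IsUniloop24 p}

/-- The set `𝒰𝒞_{2,4}` of graphs of 2-4 unicircuit type. -/
def UC24 (m : Fin 3 → ℕ) : Set (OGraph (Set (Pt m)) (Pt m)) := T '' {p | IsUnicircuit24 p}

/-! ### Wigner matrices and limit graphs -/

section Wigner

variable {Ω : Type*} [MeasurableSpace Ω]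

/-- The third classical cumulant of three complex random variables. -/
def k₃ (P : Measure Ω) (A B C : Ω → ℂ) : ℂ :=
  (∫ ω, A ω * B ω * C ω ∂P)
    - ((∫ ω, A ω * B ω ∂P) * (∫ ω, C ω ∂P) + (∫ ω, A ω * C ω ∂P) * (∫ ω, B ω ∂P)
      + (∫ ω, A ω ∂P) * (∫ ω, B ω * C ω ∂P))
    + 2 * (∫ ω, A ω ∂P) * (∫ ω, B ω ∂P) * (∫ ω, C ω ∂P)

/-- The `x a b` are the entries, before the normalization by `1 / √N`, of a complex `N × N` Wigner
matrix. -/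
structure IsWigner (P : Measure Ω) {N : ℕ} (x : Fin N → Fin N → Ω → ℂ) : Prop where
  measurable : ∀ a b, Measurable (x a b)
  selfAdjoint : ∀ a b ω, x a b ω = (starRingEnd ℂ) (x b a ω)
  indep : iIndepFun (fun (c : {c : Fin N × Fin N // c.1 ≤ c.2}) => x c.1.1 c.1.2) P
  identDistrib_offDiag : ∀ a b c d, a < b → c < d → IdentDistrib (x a b) (x c d) P P
  identDistrib_diag : ∀ a b, IdentDistrib (x a a) (x b b) P P
  moments : ∀ a b (n : ℕ), Integrable (fun ω => ‖x a b ω‖ ^ n) P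
  mean : ∀ a b, (∫ ω, x a b ω ∂P) = 0
  sq : ∀ a b, a ≠ b → (∫ ω, x a b ω ^ 2 ∂P) = 0
  variance : ∀ a b, (∫ ω, ‖x a b ω‖ ^ 2 ∂P) = 1
  k₃_diag : ∀ a, k₃ P (x a a) (x a a) (x a a) = 0

/-- The product of the entries of the matrix along the circle `j`, for the indices `i`. -/
def circleProd {N : ℕ} (x : Fin N → Fin N → Ω → ℂ) (i : Pt m → Fin N) (j : Fin 3) (ω : Ω) : ℂ :=
  ∏ a : Fin (m j), x (i ⟨j, a⟩) (i (gam m ⟨j, a⟩)) ω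

open Classical in
/-- The contribution `C_π = ∑_{ker i = π} N^{1 - m/2} k₃(T, i)` of the partition `π` to
`N k₃(Tr X^{m₁}, Tr X^{m₂}, Tr X^{m₃})`, for the Wigner matrix `X = x / √N`. -/
def contribution (P : Measure Ω) {N : ℕ} (x : Fin N → Fin N → Ω → ℂ) (p : Setoid (Pt m)) : ℂ :=
  ∑ i : Pt m → Fin N with Setoid.ker i = p,
    (((N : ℝ) ^ (-((m 0 + m 1 + m 2 : ℕ) : ℝ) / 2 + 1) : ℝ) : ℂ) *
      k₃ P (circleProd x i 0) (circleProd x i 1) (circleProd x i 2)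

/-- A limit partition. -/
def IsLimitPartition (P : Measure Ω) {N : ℕ} (x : Fin N → Fin N → Ω → ℂ) (p : Setoid (Pt m)) :
    Prop :=
  q p = -1 ∧ contribution P x p ≠ 0

/-- The set `ℒ𝒢` of limit graphs. -/
def LG (m : Fin 3 → ℕ) (P : Measure Ω) {N : ℕ} (x : Fin N → Fin N → Ω → ℂ) :
    Set (OGraph (Set (Pt m)) (Pt m)) :=
  T '' {p | IsLimitPartition P x p}

/-- The set `𝒟ℬ` of double bicircuit graphs. -/
def DB (m : Fin 3 → ℕ) (P : Measure Ω) {N : ℕ} (x : Fin N → Fin N → Ω → ℂ) :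
    Set (OGraph (Set (Pt m)) (Pt m)) :=
  T '' {p | (q₁ p, q₂ p) = (-1, 0) ∧ contribution P x p ≠ 0}

end Wigner

/-- The map `σ ↦ T^{γσ}`, where the permutation `γσ` is read as the partition into its cycles. -/
def pairingGraph (m : Fin 3 → ℕ) (s : Equiv.Perm (Pt m)) : OGraph (Set (Pt m)) (Pt m) :=
  T (cyclePartition (gam m * s))

end WignerThird

end

/-! Everything rests on one bound for the number V of vertices of $T^\pi$. Each circle is a closed
walk in $T^\pi$; counting its passages through every class of edges, modulo 2 or with signs, gives a
functional on the edges that vanishes on all coboundaries. In a connected graph with E classes of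
edges, r independent functionals of this kind force V + r ≤ E + 1. Suppose that all classes have
even size and that every circle shares a class with the others. The parity vectors of the three
circles add up to zero, so their rank r is 0, 1 or 2, and gluing along shared classes gives E ≤ m/2
- 2 + r. Hence V ≤ m/2 - 1 in every case (`genus_bound`). Equality leaves one configuration for each
rank: three doubled circles (r = 0), a doubled circle and a doubled pair of circles (r = 1), a
doubled whole (r = 2). Signed counts over ℚ show that the two edges of a doubled class are opposite
(`classification`).

For a pairing σ and π = γσ the edges $e_x$ and $e_{\sigma x}$ are opposite, so all classes are
balanced, and the non-crossing condition says that π has m/2 - 1 blocks, the case of equality.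
Conversely, if π has m/2 - 1 blocks, any pairing σ of opposite edges that connects the circles
satisfies γσ ≤ π, and the bound forces γσ = π. The preimages of π are therefore exactly these
pairings (`Base.preimage_eq`), and they differ only in the classes where parts are glued: four edges
which are not loops can be paired across in one way, four loops in two ways, and six edges in two
ways, given by the two cyclic permutations of the circles.

A nonzero third cumulant forces every circle to share a class with the others, every class to have
at least two edges, and a class of two edges that are not loops to consist of opposite ones. With V
= m/2 - 1 this already makes all classes balanced (`balanced_of_two_le`), so `classification`
applies to limit graphs as well. Conversely, the cumulants of the configurations are 1, E|x|⁴ - 1, a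
product of two such factors, or E|x|⁶ - 3E|x|⁴ + 2. They do not vanish and depend on π only, so
nothing cancels in the sum over the indices (`isLimitPartition_iff`). The five types of graphs are
then recognized by Euler characteristic counts. -/

noncomputable section

namespace WignerThird

open Classical Finset

variable {m : Fin 3 → ℕ}

/-! ### Circles -/

lemma gam_fst (x : Pt m) : (gam m x).1 = x.1 := rfl

/-- The rotation acts transitively on each circle, so an invariant predicate is constant there. -/
lemma circle_induct {P : Pt m → Prop} {j : Fin 3} (h : ∀ x, x.1 = j → (P (gam m x) ↔ P x))
    {x y : Pt m} (hx : x.1 = j) (hy : y.1 = j) : P x ↔ P y := by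
  obtain ⟨i, a⟩ := x
  obtain ⟨i', b⟩ := y
  obtain rfl : i = j := hx
  obtain rfl : i' = i := hy
  have hg : ∀ a : Fin (m i'), gam m ⟨i', a⟩ = ⟨i', finRotate (m i') a⟩ := fun _ => rfl
  have key : ∀ n : ℕ, ∀ hn : n < m i', P ⟨i', ⟨n, hn⟩⟩ ↔ P ⟨i', ⟨0, by omega⟩⟩ := by
    intro n
    induction n with
    | zero => intro _; rfl
    | succ n ih =>
      intro hn
      rw [← ih (by omega), ← h ⟨i', ⟨n, by omega⟩⟩ rfl, hg]
      have : finRotate (m i') ⟨n, by omega⟩ = ⟨n + 1, hn⟩ := by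
        obtain ⟨M, hM⟩ : ∃ M, m i' = M + 1 := ⟨m i' - 1, by omega⟩
        -- Generalizing `m i'` to `K` allows the substitution `K = M + 1` inside `Fin`.
        have hgen : ∀ (K : ℕ) (hK : K = M + 1) (h1 : n < K) (h2 : n + 1 < K),
            finRotate K ⟨n, h1⟩ = ⟨n + 1, h2⟩ := by
          rintro K rfl h1 h2
          rw [finRotate_of_lt (by omega)]
        exact hgen _ hM _ _
      rw [this]
  exact (key a a.2).trans (key b b.2).symm

/-! ### Edge classes -/

/-- The pair of end points of the edge `e_x` of `T^π`. -/
def en (p : Setoid (Pt m)) (x : Pt m) : Sym2 (Set (Pt m)) := s(block p (gam m x), block p x)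

/-- The points on the circles in `J`. -/
def onJ (m : Fin 3 → ℕ) (J : Set (Fin 3)) : Finset (Pt m) := {x | x.1 ∈ J}

/-- The vertices of `TOn p J`. -/
def VJ (p : Setoid (Pt m)) (J : Set (Fin 3)) : Finset (Set (Pt m)) := (onJ m J).image (block p)

/-- The edges of the elementarization of `TOn p J`. -/
def EJ (p : Setoid (Pt m)) (J : Set (Fin 3)) : Finset (Sym2 (Set (Pt m))) :=
  (onJ m J).image (en p)

/-- The edges of `TOn p J` which are merged into `a`. -/
def cell (p : Setoid (Pt m)) (J : Set (Fin 3)) (a : Sym2 (Set (Pt m))) : Finset (Pt m) :=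
  {x ∈ onJ m J | en p x = a}

@[simp] lemma mem_onJ {J : Set (Fin 3)} {x : Pt m} : x ∈ onJ m J ↔ x.1 ∈ J := by simp [onJ]

lemma mem_VJ {p : Setoid (Pt m)} {J : Set (Fin 3)} {B : Set (Pt m)} :
    B ∈ VJ p J ↔ ∃ x : Pt m, x.1 ∈ J ∧ block p x = B := by simp only [VJ, mem_image, mem_onJ]

lemma mem_EJ {p : Setoid (Pt m)} {J : Set (Fin 3)} {a : Sym2 (Set (Pt m))} :
    a ∈ EJ p J ↔ ∃ x : Pt m, x.1 ∈ J ∧ en p x = a := by simp only [EJ, mem_image, mem_onJ]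

@[simp] lemma mem_cell {p : Setoid (Pt m)} {J : Set (Fin 3)} {a : Sym2 (Set (Pt m))} {x : Pt m} :
    x ∈ cell p J a ↔ x.1 ∈ J ∧ en p x = a := by simp only [cell, mem_filter, mem_onJ]

lemma block_eq_iff {p : Setoid (Pt m)} {x y : Pt m} : block p x = block p y ↔ p x y := by
  constructor
  · intro h
    have : x ∈ block p y := h ▸ p.refl x
    exact this
  · intro h
    ext z
    exact ⟨fun hz => p.trans hz h, fun hz => p.trans hz (p.symm h)⟩

lemma EJ_mono {p : Setoid (Pt m)} {J J' : Set (Fin 3)} (h : J ⊆ J') : EJ p J ⊆ EJ p J' := by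
  intro a ha
  obtain ⟨x, hx, rfl⟩ := mem_EJ.1 ha
  exact mem_EJ.2 ⟨x, h hx, rfl⟩

lemma EJ_union {p : Setoid (Pt m)} {J J' : Set (Fin 3)} : EJ p (J ∪ J') = EJ p J ∪ EJ p J' := by
  ext a
  simp only [mem_EJ, mem_union, Set.mem_union]
  constructor
  · rintro ⟨x, h | h, e⟩
    exacts [Or.inl ⟨x, h, e⟩, Or.inr ⟨x, h, e⟩]
  · rintro (⟨x, h, e⟩ | ⟨x, h, e⟩)
    exacts [⟨x, Or.inl h, e⟩, ⟨x, Or.inr h, e⟩]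

lemma VJ_union {p : Setoid (Pt m)} {J J' : Set (Fin 3)} : VJ p (J ∪ J') = VJ p J ∪ VJ p J' := by
  ext a
  simp only [mem_VJ, mem_union, Set.mem_union]
  constructor
  · rintro ⟨x, h | h, e⟩
    exacts [Or.inl ⟨x, h, e⟩, Or.inr ⟨x, h, e⟩]
  · rintro (⟨x, h, e⟩ | ⟨x, h, e⟩)
    exacts [⟨x, Or.inl h, e⟩, ⟨x, Or.inr h, e⟩]

lemma cell_nonempty {p : Setoid (Pt m)} {J : Set (Fin 3)} {a : Sym2 (Set (Pt m))} :
    (cell p J a).Nonempty ↔ a ∈ EJ p J := by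
  simp only [Finset.Nonempty, mem_cell, mem_EJ]

lemma card_onJ_eq_sum (p : Setoid (Pt m)) (J : Set (Fin 3)) :
    #(onJ m J) = ∑ a ∈ EJ p J, #(cell p J a) :=
  card_eq_sum_card_image (en p) (onJ m J)

lemma mem_VJ_of_mem_EJ {p : Setoid (Pt m)} {J : Set (Fin 3)} {a : Sym2 (Set (Pt m))}
    (ha : a ∈ EJ p J) {B : Set (Pt m)} (hB : B ∈ a) : B ∈ VJ p J := by
  obtain ⟨x, hx, rfl⟩ := mem_EJ.1 ha
  rcases Sym2.mem_iff.1 hB with rfl | rfl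
  · exact mem_VJ.2 ⟨gam m x, hx, rfl⟩
  · exact mem_VJ.2 ⟨x, hx, rfl⟩

/-! ### Signed counts -/

section Signed

variable {β K : Type*} [Field K]

/-- The difference of `f` along an arbitrarily chosen orientation of `a`. -/
def dl (f : β → K) (a : Sym2 β) : K := f (Quot.out a).1 - f (Quot.out a).2

lemma sym2_out_eq (a : Sym2 β) : s((Quot.out a).1, (Quot.out a).2) = a := Quot.out_eq a

lemma dl_eq_zero_of_isDiag (f : β → K) {a : Sym2 β} (ha : a.IsDiag) : dl f a = 0 := by
  rw [← sym2_out_eq a, Sym2.mk_isDiag_iff] at ha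
  rw [dl, ha, sub_self]

/-- The sign of the edge `e_x` with respect to the chosen orientations. -/
def sg (p : Setoid (Pt m)) (K : Type*) [Field K] (x : Pt m) : K :=
  if Quot.out (en p x) = (block p (gam m x), block p x) then 1 else -1

/-- The sign compensates for the arbitrary orientation in `dl`, leaving the increment of `f` along
the actual edge. -/
lemma sg_mul_dl (p : Setoid (Pt m)) (f : Set (Pt m) → K) (x : Pt m) :
    sg p K x * dl f (en p x) = f (block p (gam m x)) - f (block p x) := by
  unfold sg dl
  split_ifs with h
  · rw [h]; ring
  · have h1 := sym2_out_eq (en p x)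
    conv_rhs at h1 => rw [en]
    rw [Sym2.eq_iff] at h1
    rcases h1 with h1 | h1
    · exact absurd (Prod.ext h1.1 h1.2) h
    · rw [h1.1, h1.2]; ring

/-- The signed number of edges of `TOn p J` in the class `a`. -/
def sc (p : Setoid (Pt m)) (K : Type*) [Field K] (J : Set (Fin 3)) (a : Sym2 (Set (Pt m))) : K :=
  ∑ x ∈ cell p J a, sg p K x

lemma sc_eq_zero_of_notMem (p : Setoid (Pt m)) {J : Set (Fin 3)} {a : Sym2 (Set (Pt m))}
    (h : a ∉ EJ p J) : sc p K J a = 0 := by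
  rw [← cell_nonempty, not_nonempty_iff_eq_empty] at h
  simp [sc, h]

/-- Circles are closed walks: the increments of `f` along them telescope, because `gam` permutes the
points on the circles in `J`. -/
lemma sum_sc_mul_dl (p : Setoid (Pt m)) {J J' : Set (Fin 3)} (hJ : J ⊆ J')
    (f : Set (Pt m) → K) : ∑ a ∈ EJ p J', sc p K J a * dl f a = 0 := by
  have h1 : ∑ a ∈ EJ p J', sc p K J a * dl f a
      = ∑ x ∈ onJ m J, sg p K x * dl f (en p x) := by
    rw [← sum_fiberwise_of_maps_to (t := EJ p J') (g := en p)
      (fun x hx => EJ_mono hJ (mem_EJ.2 ⟨x, mem_onJ.1 hx, rfl⟩))]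
    refine sum_congr rfl fun a _ => ?_
    rw [sc, sum_mul]
    exact sum_congr rfl fun x hx => by rw [(mem_cell.1 hx).2]
  rw [h1]
  simp only [sg_mul_dl, sum_sub_distrib, sub_eq_zero]
  exact sum_equiv (gam m) (fun x => by simp [gam_fst]) (fun x _ => rfl)

lemma sc_zmod_two (p : Setoid (Pt m)) (J : Set (Fin 3)) (a : Sym2 (Set (Pt m))) :
    sc p (ZMod 2) J a = (#(cell p J a) : ZMod 2) := by
  have : ∀ x, sg p (ZMod 2) x = 1 := by
    intro x; unfold sg; split_ifs <;> decide
  simp [sc, this]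

lemma sc_union (p : Setoid (Pt m)) {J J' : Set (Fin 3)} (h : Disjoint J J')
    (a : Sym2 (Set (Pt m))) : sc p K (J ∪ J') a = sc p K J a + sc p K J' a := by
  rw [sc, sc, sc, ← sum_union]
  · congr 1
    ext x
    simp only [mem_cell, mem_union, Set.mem_union, or_and_right]
  · rw [Finset.disjoint_left]
    intro x hx hx'
    exact Set.disjoint_left.1 h (mem_cell.1 hx).1 (mem_cell.1 hx').1

/-! ### The dimension bound -/

/-- If the coboundary of a graph has only constants in its kernel, then `n` linearly independent
functionals which vanish on all coboundaries force `#V + n ≤ #E + 1`. -/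
lemma card_add_le_of_annihilators [DecidableEq β] (Vs : Finset β) (Es : Finset (Sym2 β))
    (conn : ∀ f : β → K, (∀ a ∈ Es, dl f a = 0) → ∀ v ∈ Vs, ∀ w ∈ Vs, f v = f w)
    {n : ℕ} (φ : Fin n → Es → K) (hφ : LinearIndependent K φ)
    (hann : ∀ k, ∀ f : β → K, ∑ a : Es, φ k a * dl f a = 0) : #Vs + n ≤ #Es + 1 := by
  -- Functions on the vertices are extended by zero so that `dl` and the hypotheses, stated for
  -- functions on all of `β`, apply.
  let ext0 : (Vs → K) →ₗ[K] (β → K) :=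
    { toFun := fun f b => if h : b ∈ Vs then f ⟨b, h⟩ else 0
      map_add' := by
        intro f g; funext b; by_cases h : b ∈ Vs <;> simp [h]
      map_smul' := by
        intro c f; funext b; by_cases h : b ∈ Vs <;> simp [h] }
  let δ : (Vs → K) →ₗ[K] (Es → K) :=
    { toFun := fun f a => dl (ext0 f) a
      map_add' := by
        intro f g; funext a; simp only [map_add, dl, Pi.add_apply]; ring
      map_smul' := by
        intro c f; funext a; simp only [map_smul, dl, Pi.smul_apply, smul_eq_mul, RingHom.id_apply]
        ring }
  have hker : Module.finrank K (LinearMap.ker δ) ≤ 1 := by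
    have hle : LinearMap.ker δ ≤ Submodule.span K {(fun _ => 1 : Vs → K)} := by
      intro f hf
      rw [Submodule.mem_span_singleton]
      have hf' : ∀ a ∈ Es, dl (ext0 f) a = 0 := fun a ha => congrFun (LinearMap.mem_ker.1 hf) ⟨a, ha⟩
      have hc := conn _ hf'
      by_cases hV : Nonempty Vs
      · obtain ⟨v⟩ := hV
        refine ⟨f v, ?_⟩
        funext w
        have := hc v v.2 w w.2
        simp only [ext0, LinearMap.coe_mk, AddHom.coe_mk, v.2, w.2, dif_pos, Subtype.coe_eta] at this
        simp [this]
      · exact ⟨0, funext fun w => (hV ⟨w⟩).elim⟩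
    refine (Submodule.finrank_mono hle).trans ((finrank_span_le_card _).trans ?_)
    simp
  let A : (Es → K) →ₗ[K] (Fin n → K) := Matrix.mulVecLin (Matrix.of φ)
  have hA : Module.finrank K (LinearMap.range A) = n := by
    have : (Matrix.of φ).rank = Fintype.card (Fin n) := LinearIndependent.rank_matrix hφ
    simpa [Matrix.rank] using this
  -- The range of the coboundary has dimension at least `#Vs - 1`, and it lies in the common kernel
  -- of the functionals, of dimension `#Es - n`.
  have hrange : LinearMap.range δ ≤ LinearMap.ker A := by
    rintro _ ⟨f, rfl⟩
    rw [LinearMap.mem_ker]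
    funext k
    exact hann k (ext0 f)
  have h1 := LinearMap.finrank_range_add_finrank_ker δ
  have h2 := LinearMap.finrank_range_add_finrank_ker A
  have h3 := Submodule.finrank_mono hrange
  simp only [Module.finrank_fintype_fun_eq_card, Fintype.card_coe] at h1 h2
  omega

end Signed

/-! ### Connectedness -/

/-- `TOn p J` is connected. -/
def Conn (p : Setoid (Pt m)) (J : Set (Fin 3)) : Prop :=
  ∀ P : Set (Pt m) → Prop, (∀ x, x.1 ∈ J → (P (block p (gam m x)) ↔ P (block p x))) →
    ∀ x y : Pt m, x.1 ∈ J → y.1 ∈ J → P (block p x) → P (block p y)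

lemma conn_singleton (p : Setoid (Pt m)) (j : Fin 3) : Conn p {j} := by
  intro P hP x y hx hy h
  exact (circle_induct (P := fun x => P (block p x)) (fun x hx => hP x hx) hx hy).1 h

/-- A common edge has a common end point, through which the invariant predicate passes from one part
to the other. -/
lemma Conn.union {p : Setoid (Pt m)} {J J' : Set (Fin 3)} (h : Conn p J) (h' : Conn p J')
    (hE : ¬ Disjoint (EJ p J) (EJ p J')) : Conn p (J ∪ J') := by
  obtain ⟨a, ha, ha'⟩ := Finset.not_disjoint_iff.1 hE
  obtain ⟨B, hB⟩ : ∃ B, B ∈ a := ⟨_, Sym2.out_fst_mem a⟩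
  obtain ⟨u, hu, rfl⟩ := mem_VJ.1 (mem_VJ_of_mem_EJ ha hB)
  obtain ⟨v, hv, huv⟩ := mem_VJ.1 (mem_VJ_of_mem_EJ ha' hB)
  intro P hP x y hx hy hPx
  have h1 := h P fun x hx => hP x (Or.inl hx)
  have h2 := h' P fun x hx => hP x (Or.inr hx)
  have hu' : P (block p u) := by
    rcases hx with hx | hx
    · exact h1 x u hx hu hPx
    · rw [← huv]; exact h2 x v hx hv hPx
  rcases hy with hy | hy
  · exact h1 u y hu hy hu'
  · exact h2 v y hv hy (huv ▸ hu')

/-! ### Euler characteristic bounds from functionals on the edges -/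

section Bounds

variable {K : Type*} [Field K] {p : Setoid (Pt m)} {J : Set (Fin 3)}

lemma Conn.card_add_le (h : Conn p J) {n : ℕ} (φ : Fin n → EJ p J → K)
    (hφ : LinearIndependent K φ)
    (hann : ∀ k, ∀ f : Set (Pt m) → K, ∑ a : EJ p J, φ k a * dl f a = 0) :
    #(VJ p J) + n ≤ #(EJ p J) + 1 := by
  refine card_add_le_of_annihilators (VJ p J) (EJ p J) ?_ φ hφ hann
  intro f hf v hv w hw
  obtain ⟨x, hx, rfl⟩ := mem_VJ.1 hv
  obtain ⟨y, hy, rfl⟩ := mem_VJ.1 hw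
  have := h (fun B => f (block p x) = f B) (fun z hz => by
    have h1 := sg_mul_dl p f z
    rw [hf _ (mem_EJ.2 ⟨z, hz, rfl⟩), mul_zero, eq_comm, sub_eq_zero] at h1
    rw [h1]) x y hx hy rfl
  exact this

lemma Conn.card_le (h : Conn p J) : #(VJ p J) ≤ #(EJ p J) + 1 :=
  h.card_add_le (K := ℚ) (n := 0) (fun k => k.elim0) linearIndependent_empty_type
    (fun k => k.elim0)

/-- A functional on the edges of `TOn p J` which vanishes on the coboundaries. -/
def Ann (p : Setoid (Pt m)) (J : Set (Fin 3)) (c : Sym2 (Set (Pt m)) → K) : Prop :=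
  ∀ f : Set (Pt m) → K, ∑ a ∈ EJ p J, c a * dl f a = 0

lemma ann_sc (p : Setoid (Pt m)) {J J' : Set (Fin 3)} (h : J ⊆ J') : Ann p J' (sc p K J) :=
  sum_sc_mul_dl p h

/-- A loop is a cycle by itself, so the functional that reads it off kills every coboundary. -/
lemma ann_single_of_isDiag {a : Sym2 (Set (Pt m))} (ha : a.IsDiag) :
    Ann (K := K) p J (Pi.single a 1) := by
  intro f
  refine sum_eq_zero fun b _ => ?_
  rcases eq_or_ne b a with rfl | h
  · rw [dl_eq_zero_of_isDiag f ha, mul_zero]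
  · rw [Pi.single_eq_of_ne h, zero_mul]

lemma Conn.card_le_of_ann (h : Conn p J) {c : Sym2 (Set (Pt m)) → K} (hc : Ann p J c)
    {a : Sym2 (Set (Pt m))} (ha : a ∈ EJ p J) (hca : c a ≠ 0) : #(VJ p J) ≤ #(EJ p J) := by
  have := h.card_add_le (K := K) (n := 1) (fun _ a => c a)
    (by
      rw [linearIndependent_unique_iff]
      intro h0
      exact hca (congrFun h0 ⟨a, ha⟩))
    (fun _ f => by exact (sum_coe_sort (EJ p J) fun a => c a * dl f a).trans (hc f))
  omega

/-- The last hypothesis says that `d` is no multiple of `c` on the edges; with `c ≠ 0` this is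
independence of the two functionals. -/
lemma Conn.card_lt_of_ann (h : Conn p J) {c d : Sym2 (Set (Pt m)) → K} (hc : Ann p J c)
    (hd : Ann p J d) {a : Sym2 (Set (Pt m))} (ha : a ∈ EJ p J) (hca : c a ≠ 0)
    (hcd : ∀ r : K, ∃ b ∈ EJ p J, r * c b ≠ d b) : #(VJ p J) + 1 ≤ #(EJ p J) := by
  have := h.card_add_le (K := K) (n := 2) ![fun a => c a, fun a => d a]
    (by
      rw [LinearIndependent.pair_iff' (fun h0 => hca (congrFun h0 ⟨a, ha⟩))]
      intro r hr
      obtain ⟨b, hb, hb'⟩ := hcd r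
      exact hb' (congrFun hr ⟨b, hb⟩))
    (fun k f => by
      fin_cases k
      · exact (sum_coe_sort _ _).trans (hc f)
      · exact (sum_coe_sort _ _).trans (hd f))
  omega

/-- If `a` is the only edge at the vertex `B` which carries the functional, and `a` is not a loop,
then the functional vanishes at `a`. -/
lemma Ann.eq_zero {c : Sym2 (Set (Pt m)) → K} (hc : Ann p J c) {a : Sym2 (Set (Pt m))}
    (ha : a ∈ EJ p J) (hd : ¬ a.IsDiag) {B : Set (Pt m)} (hB : B ∈ a)
    (h : ∀ b ∈ EJ p J, b ≠ a → B ∈ b → ¬ b.IsDiag → c b = 0) : c a = 0 := by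
  -- Testing with the indicator of `B` leaves only the edges at `B` that are not loops.
  have h1 := hc (fun C => if C = B then 1 else 0)
  rw [sum_eq_single a] at h1
  · rcases mul_eq_zero.1 h1 with h2 | h2
    · exact h2
    · exfalso
      rw [← sym2_out_eq a, Sym2.mem_iff] at hB
      rw [← sym2_out_eq a, Sym2.mk_isDiag_iff] at hd
      unfold dl at h2
      rcases hB with rfl | rfl
      · simp [Ne.symm hd] at h2
      · simp [hd] at h2
  · intro b hb hba
    by_cases hBb : B ∈ b
    · by_cases hbd : b.IsDiag
      · rw [dl_eq_zero_of_isDiag _ hbd, mul_zero]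
      · rw [h b hb hba hBb hbd, zero_mul]
    · have h3 : (Quot.out b).1 ≠ B := fun e => hBb (e ▸ Sym2.out_fst_mem b)
      have h4 : (Quot.out b).2 ≠ B := fun e => hBb (e ▸ Sym2.out_snd_mem b)
      simp [dl, h3, h4]
  · exact fun h => absurd ha h

end Bounds

/-! ### The genus bound and its three equality cases -/

lemma compl_singleton_eq {i j k : Fin 3} (hij : i ≠ j) (hik : i ≠ k) (hjk : j ≠ k) :
    ({i}ᶜ : Set (Fin 3)) = {j} ∪ {k} := by
  ext l
  simp only [Set.mem_compl_iff, Set.mem_singleton_iff, Set.mem_union]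
  revert i j k l
  decide

lemma exists_others (i : Fin 3) : ∃ j k : Fin 3, i ≠ j ∧ i ≠ k ∧ j ≠ k := by
  revert i; decide

/-- Every circle shares an edge of the elementarization with the other circles. -/
def Share (p : Setoid (Pt m)) : Prop := ∀ j, ¬ Disjoint (EJ p {j}) (EJ p {j}ᶜ)

variable {p : Setoid (Pt m)}

/-- The circles can be glued one after another: circle 0 meets circle 1 or circle 2, and the
remaining circle meets the union of these two. -/
lemma Share.exists_order (h : Share p) : ∃ i j k : Fin 3, i ≠ j ∧ i ≠ k ∧ j ≠ k ∧
    ¬ Disjoint (EJ p {i}) (EJ p {j}) ∧ ¬ Disjoint (EJ p {k}) (EJ p ({i} ∪ {j})) := by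
  have h0 := h 0
  rw [compl_singleton_eq (i := 0) (j := 1) (k := 2) (by decide) (by decide) (by decide), EJ_union,
    disjoint_union_right, not_and_or] at h0
  rcases h0 with h0 | h0
  · refine ⟨0, 1, 2, by decide, by decide, by decide, h0, ?_⟩
    rw [← compl_singleton_eq (i := 2) (by decide) (by decide) (by decide)]
    exact h 2
  · refine ⟨0, 2, 1, by decide, by decide, by decide, h0, ?_⟩
    rw [← compl_singleton_eq (i := 1) (by decide) (by decide) (by decide)]
    exact h 1

lemma Share.conn (h : Share p) : Conn p Set.univ := by
  obtain ⟨i, j, k, hij, hik, hjk, h1, h2⟩ := h.exists_order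
  have := (conn_singleton p k).union (((conn_singleton p i).union (conn_singleton p j)) h1) h2
  rwa [← compl_singleton_eq hik.symm hjk.symm hij, Set.union_compl_self] at this

lemma cell_union {J J' : Set (Fin 3)} (hd : Disjoint J J') (a : Sym2 (Set (Pt m))) :
    #(cell p (J ∪ J') a) = #(cell p J a) + #(cell p J' a) := by
  rw [← card_union_of_disjoint]
  · congr 1
    ext x
    simp only [mem_cell, mem_union, Set.mem_union, or_and_right]
  · rw [Finset.disjoint_left]
    intro x hx hx'
    exact Set.disjoint_left.1 hd (mem_cell.1 hx).1 (mem_cell.1 hx').1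

lemma card_onJ_union {J J' : Set (Fin 3)} (hd : Disjoint J J') :
    #(onJ m (J ∪ J')) = #(onJ m J) + #(onJ m J') := by
  rw [← card_union_of_disjoint]
  · congr 1
    ext x
    simp only [mem_onJ, mem_union, Set.mem_union]
  · rw [Finset.disjoint_left]
    intro x hx hx'
    exact Set.disjoint_left.1 hd (mem_onJ.1 hx) (mem_onJ.1 hx')

lemma two_le_cell {J : Set (Fin 3)} (h : ∀ a, Even #(cell p J a)) {a : Sym2 (Set (Pt m))}
    (ha : a ∈ EJ p J) : 2 ≤ #(cell p J a) := by
  have h1 := card_pos.2 (cell_nonempty.2 ha)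
  obtain ⟨r, hr⟩ := h a
  omega

lemma two_mul_card_EJ_le {J : Set (Fin 3)} (h : ∀ a ∈ EJ p J, 2 ≤ #(cell p J a)) :
    2 * #(EJ p J) ≤ #(onJ m J) := by
  rw [card_onJ_eq_sum p J, mul_comm, ← smul_eq_mul, ← sum_const]
  exact sum_le_sum h

lemma cell_eq_two {J : Set (Fin 3)} (h : ∀ a ∈ EJ p J, 2 ≤ #(cell p J a))
    (hc : #(onJ m J) ≤ 2 * #(EJ p J)) : ∀ a ∈ EJ p J, #(cell p J a) = 2 := by
  have h1 := two_mul_card_EJ_le h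
  have h2 : ∑ a ∈ EJ p J, 2 = ∑ a ∈ EJ p J, #(cell p J a) := by
    rw [← card_onJ_eq_sum p J, sum_const, smul_eq_mul]; omega
  exact fun a ha => ((sum_eq_sum_iff_of_le h).1 h2 a ha).symm

lemma card_EJ_union_lt {J J' : Set (Fin 3)} (h : ¬ Disjoint (EJ p J) (EJ p J')) :
    #(EJ p (J ∪ J')) + 1 ≤ #(EJ p J) + #(EJ p J') := by
  rw [EJ_union, ← card_union_add_card_inter]
  have : 0 < #(EJ p J ∩ EJ p J') := by
    rw [card_pos, ← not_disjoint_iff_nonempty_inter]; exact h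
  omega

lemma even_of_sc_eq_zero {J : Set (Fin 3)} {a : Sym2 (Set (Pt m))}
    (h : sc p (ZMod 2) J a = 0) : Even #(cell p J a) := by
  rw [sc_zmod_two, ZMod.natCast_eq_zero_iff_even] at h
  exact h

lemma sc_eq_zero_of_even {J : Set (Fin 3)} {a : Sym2 (Set (Pt m))}
    (h : Even #(cell p J a)) : sc p (ZMod 2) J a = 0 := by
  rw [sc_zmod_two, ZMod.natCast_eq_zero_iff_even]
  exact h

/-- The equality cases of the genus bound, by the rank of the parity vectors of the circles. -/
inductive Extremal (p : Setoid (Pt m)) : Prop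
  | tree (hE : 2 * #(EJ p Set.univ) + 4 = #(onJ m Set.univ))
      (hc : ∀ j, ∀ a ∈ EJ p {j}, #(cell p {j} a) = 2)
  | unicircuit (i : Fin 3) (hE : 2 * #(EJ p Set.univ) + 2 = #(onJ m Set.univ))
      (hc : ∀ a ∈ EJ p {i}, #(cell p {i} a) = 2)
      (hc' : ∀ a ∈ EJ p {i}ᶜ, #(cell p {i}ᶜ a) = 2)
      (hs : ∀ j k, i ≠ j → i ≠ k → j ≠ k → ¬ Disjoint (EJ p {j}) (EJ p {k}))
  | bicircuit (hE : 2 * #(EJ p Set.univ) = #(onJ m Set.univ))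
      (hc : ∀ a ∈ EJ p Set.univ, #(cell p Set.univ a) = 2)

lemma disjoint_singleton_of_ne {j k : Fin 3} (h : j ≠ k) : Disjoint ({j} : Set (Fin 3)) {k} :=
  Set.disjoint_singleton.2 h

/-- The rank r of the parity vectors of the circles enters twice: it lowers the bound on the
vertices to E + 1 - r, and the parts that are even on their own bound E by m/2 - 2 + r, since each
gluing loses a class. The sum of the two bounds does not depend on r, and equality makes every class
of a part have exactly two edges. -/
lemma genus_bound (hs : Share p) (heven : ∀ a, Even #(cell p Set.univ a)) :
    2 * #(VJ p Set.univ) + 2 ≤ #(onJ m Set.univ) ∧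
      (2 * #(VJ p Set.univ) + 2 = #(onJ m Set.univ) → Extremal p) := by
  have hsum : ∀ i j k : Fin 3, i ≠ j → i ≠ k → j ≠ k → ∀ a,
      sc p (ZMod 2) {i} a + (sc p (ZMod 2) {j} a + sc p (ZMod 2) {k} a) = 0 := by
    intro i j k hij hik hjk a
    rw [← sc_union p (disjoint_singleton_of_ne hjk), ← compl_singleton_eq hij hik hjk,
      ← sc_union p disjoint_compl_right, Set.union_compl_self]
    exact sc_eq_zero_of_even (heven a)
  by_cases hz : ∃ i, ∀ a, sc p (ZMod 2) {i} a = 0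
  · obtain ⟨i, hi⟩ := hz
    obtain ⟨j, k, hij, hik, hjk⟩ := exists_others i
    -- If two parity vectors vanish, so does the third (rank 0); otherwise those of `j` and `k` are
    -- equal and nonzero (rank 1).
    by_cases hz' : ∀ a, sc p (ZMod 2) {j} a = 0
    · have hk : ∀ a, sc p (ZMod 2) {k} a = 0 := by
        intro a
        have := hsum i j k hij hik hjk a
        rwa [hi a, hz' a, zero_add, zero_add] at this
      have hall : ∀ l a, Even #(cell p {l} a) := by
        intro l a
        have : l = i ∨ l = j ∨ l = k := by
          clear * - hij hik hjk; revert i j k l; decide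
        rcases this with rfl | rfl | rfl
        exacts [even_of_sc_eq_zero (hi a), even_of_sc_eq_zero (hz' a), even_of_sc_eq_zero (hk a)]
      obtain ⟨i, j, k, hij, hik, hjk, h1, h2⟩ := hs.exists_order
      have hu : ({k} : Set (Fin 3)) ∪ ({i} ∪ {j}) = Set.univ := by
        rw [← compl_singleton_eq hik.symm hjk.symm hij, Set.union_compl_self]
      have hd : Disjoint ({k} : Set (Fin 3)) ({i} ∪ {j}) := by
        rw [← compl_singleton_eq hik.symm hjk.symm hij]; exact disjoint_compl_right
      have e1 := card_EJ_union_lt h1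
      have e2 := card_EJ_union_lt h2
      have c1 := card_onJ_union (m := m) (disjoint_singleton_of_ne hij)
      have c2 := card_onJ_union (m := m) hd
      rw [hu] at e2 c2
      have hle := fun l => two_mul_card_EJ_le fun a ha => two_le_cell (hall l) (a := a) ha
      have hi := hle i
      have hj := hle j
      have hk := hle k
      have hV := hs.conn.card_le
      refine ⟨by omega, fun heq => .tree (by omega) fun l => ?_⟩
      refine cell_eq_two (fun a ha => two_le_cell (hall l) ha) ?_
      have : l = i ∨ l = j ∨ l = k := by
        clear * - hij hik hjk; revert i j k l; decide
      rcases this with rfl | rfl | rfl <;> omega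
    · push Not at hz'
      obtain ⟨b, hb⟩ := hz'
      have hki : ∀ a, sc p (ZMod 2) {j} a + sc p (ZMod 2) {k} a = 0 := by
        intro a
        have := hsum i j k hij hik hjk a
        rwa [hi a, zero_add] at this
      have hbk : sc p (ZMod 2) {k} b ≠ 0 := by
        intro h0
        have := hki b
        rw [h0, add_zero] at this
        exact hb this
      have hbj := not_imp_comm.1 (sc_eq_zero_of_notMem p) hb
      have hbk := not_imp_comm.1 (sc_eq_zero_of_notMem p) hbk
      have hE1 : ∀ a, Even #(cell p {i} a) := fun a => even_of_sc_eq_zero (hi a)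
      have hE2 : ∀ a, Even #(cell p {i}ᶜ a) := fun a => even_of_sc_eq_zero (by
        rw [compl_singleton_eq hij hik hjk, sc_union p (disjoint_singleton_of_ne hjk)]
        exact hki a)
      have hV := hs.conn.card_le_of_ann (ann_sc (K := ZMod 2) p (Set.subset_univ {j}))
        (EJ_mono (Set.subset_univ _) hbj) hb
      have e := card_EJ_union_lt (hs i)
      have c := card_onJ_union (m := m) (disjoint_compl_right (a := ({i} : Set (Fin 3))))
      rw [Set.union_compl_self] at e c
      have h1 := two_mul_card_EJ_le fun a ha => two_le_cell hE1 (a := a) ha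
      have h2 := two_mul_card_EJ_le fun a ha => two_le_cell hE2 (a := a) ha
      refine ⟨by omega, fun heq => .unicircuit i (by omega)
        (cell_eq_two (fun a ha => two_le_cell hE1 ha) (by omega))
        (cell_eq_two (fun a ha => two_le_cell hE2 ha) (by omega)) ?_⟩
      intro j' k' hij' hik' hjk'
      have : j' = j ∧ k' = k ∨ j' = k ∧ k' = j := by
        clear * - hij hik hjk hij' hik' hjk'; revert i j k j' k'; decide
      rcases this with ⟨rfl, rfl⟩ | ⟨rfl, rfl⟩
      · exact Finset.not_disjoint_iff.2 ⟨b, hbj, hbk⟩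
      · exact Finset.not_disjoint_iff.2 ⟨b, hbk, hbj⟩
  · push Not at hz
    obtain ⟨a0, ha0⟩ := hz 0
    obtain ⟨a1, ha1⟩ := hz 1
    obtain ⟨a2, ha2⟩ := hz 2
    have hsub : ∀ j, EJ p {j} ⊆ EJ p Set.univ := fun j => EJ_mono (Set.subset_univ _)
    have hm := fun {j a} (h : sc p (ZMod 2) {j} a ≠ 0) =>
      hsub _ (not_imp_comm.1 (sc_eq_zero_of_notMem p) h)
    -- No parity vector vanishes. The only multiples over `ZMod 2` are 0 and 1, and equality of the
    -- vectors of circles 0 and 1 would kill that of circle 2; so the rank is 2.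
    have hV := hs.conn.card_lt_of_ann (ann_sc (K := ZMod 2) p (Set.subset_univ {0}))
      (ann_sc (K := ZMod 2) p (Set.subset_univ {1})) (hm ha0) ha0 (by
        intro r
        have : r = 0 ∨ r = 1 := by clear * -; revert r; decide
        rcases this with rfl | rfl
        · exact ⟨a1, hm ha1, by rw [zero_mul]; exact ha1.symm⟩
        · refine ⟨a2, hm ha2, fun h0 => ha2 ?_⟩
          have := hsum 2 0 1 (by decide) (by decide) (by decide) a2
          rw [one_mul] at h0
          rwa [h0, CharTwo.add_self_eq_zero, add_zero] at this)
    have h1 := two_mul_card_EJ_le fun a ha => two_le_cell heven (a := a) ha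
    exact ⟨by omega, fun heq => .bicircuit (by omega)
      (cell_eq_two (fun a ha => two_le_cell heven ha) (by omega))⟩

/-! ### Orientations -/

lemma coe_EJ (p : Setoid (Pt m)) (J : Set (Fin 3)) : (TOn p J).elem.edges = ↑(EJ p J) := by
  ext a
  rw [mem_coe, mem_EJ]
  rfl

lemma coe_VJ (p : Setoid (Pt m)) (J : Set (Fin 3)) : (TOn p J).verts = ↑(VJ p J) := by
  ext B
  rw [mem_coe, mem_VJ]
  constructor
  · rintro ⟨⟨y, rfl⟩, x, hx, hxJ⟩
    exact ⟨x, hxJ, block_eq_iff.2 hx⟩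
  · rintro ⟨x, hx, rfl⟩
    exact ⟨p.mem_classes x, x, p.refl x, hx⟩

lemma coe_cell (p : Setoid (Pt m)) (J : Set (Fin 3)) (a : Sym2 (Set (Pt m))) :
    (TOn p J).edgeClass a = ↑(cell p J a) := by
  ext x
  rw [mem_coe, mem_cell]
  rfl

/-- The edges `e_x` and `e_y` of `T^π` have opposite orientation. -/
def Opp (p : Setoid (Pt m)) (x y : Pt m) : Prop :=
  block p (gam m x) = block p y ∧ block p x = block p (gam m y)

lemma Opp.symm {x y : Pt m} (h : Opp p x y) : Opp p y x := ⟨h.2.symm, h.1.symm⟩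

lemma Opp.en_eq {x y : Pt m} (h : Opp p x y) : en p x = en p y := by
  rw [en, en, h.1, h.2, Sym2.eq_swap]

lemma sg_eq (K : Type*) [Field K] (x : Pt m) :
    sg p K x = 1 ∧ Quot.out (en p x) = (block p (gam m x), block p x) ∨
    sg p K x = -1 ∧ Quot.out (en p x) = (block p x, block p (gam m x)) := by
  unfold sg
  split_ifs with h
  · exact Or.inl ⟨rfl, h⟩
  · refine Or.inr ⟨rfl, ?_⟩
    have h1 := sym2_out_eq (en p x)
    conv_rhs at h1 => rw [en]
    rw [Sym2.eq_iff] at h1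
    rcases h1 with h1 | h1
    · exact absurd (Prod.ext h1.1 h1.2) h
    · exact Prod.ext h1.1 h1.2

lemma en_isDiag_iff {x : Pt m} : (en p x).IsDiag ↔ block p (gam m x) = block p x :=
  Sym2.mk_isDiag_iff

/-- All four end points coincide; this is why loops escape the sign conditions. -/
lemma opp_of_isDiag {x y : Pt m} (h : en p x = en p y) (hd : (en p x).IsDiag) : Opp p x y := by
  have hd' := hd
  rw [h] at hd'
  rw [en_isDiag_iff] at hd hd'
  rw [en, en, hd, hd', Sym2.eq_iff] at h
  have : block p x = block p y := by rcases h with h | h <;> exact h.1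
  exact ⟨hd.trans this, this.trans hd'.symm⟩

lemma Opp.sg_add {x y : Pt m} (h : Opp p x y) (hd : ¬ (en p x).IsDiag) :
    sg p ℚ x + sg p ℚ y = 0 := by
  rw [en_isDiag_iff] at hd
  rcases sg_eq (p := p) ℚ x with hx | hx <;> rcases sg_eq (p := p) ℚ y with hy | hy
  · rw [← h.en_eq, hx.2, ← h.1, ← h.2] at hy
    exact absurd (Prod.ext_iff.1 hy.2).1.symm (Ne.symm hd)
  · rw [hx.1, hy.1]; norm_num
  · rw [hx.1, hy.1]; norm_num
  · rw [← h.en_eq, hx.2, ← h.1, ← h.2] at hy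
    exact absurd (Prod.ext_iff.1 hy.2).1.symm hd

lemma opp_of_sg_add {x y : Pt m} (he : en p x = en p y) (h : sg p ℚ x + sg p ℚ y = 0) :
    Opp p x y := by
  rcases sg_eq (p := p) ℚ x with hx | hx <;> rcases sg_eq (p := p) ℚ y with hy | hy
  · rw [hx.1, hy.1] at h; norm_num at h
  · have := hx.2.symm.trans (he ▸ hy.2)
    exact ⟨(Prod.ext_iff.1 this).1, (Prod.ext_iff.1 this).2⟩
  · have := hx.2.symm.trans (he ▸ hy.2)
    exact ⟨(Prod.ext_iff.1 this).2, (Prod.ext_iff.1 this).1⟩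
  · rw [hx.1, hy.1] at h; norm_num at h

lemma allDouble_iff {J : Set (Fin 3)} : (TOn p J).AllDouble ↔
    ∀ a ∈ EJ p J, ∃ x y, x ≠ y ∧ cell p J a = {x, y} ∧ Opp p x y := by
  unfold OGraph.AllDouble
  simp only [coe_EJ, mem_coe, coe_cell]
  refine forall₂_congr fun a _ => exists₂_congr fun x y => and_congr_right fun _ =>
    and_congr ?_ Iff.rfl
  rw [← coe_inj]; simp

lemma allDouble_of_sc {J : Set (Fin 3)} (h : ∀ a ∈ EJ p J, #(cell p J a) = 2)
    (h' : ∀ a ∈ EJ p J, ¬ a.IsDiag → sc p ℚ J a = 0) : (TOn p J).AllDouble := by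
  rw [allDouble_iff]
  intro a ha
  obtain ⟨x, y, hxy, hc⟩ := card_eq_two.1 (h a ha)
  have hx : x ∈ cell p J a := by simp [hc]
  have hy : y ∈ cell p J a := by simp [hc]
  have hxe := (mem_cell.1 hx).2
  have he := hxe.trans (mem_cell.1 hy).2.symm
  refine ⟨x, y, hxy, hc, ?_⟩
  by_cases hd : a.IsDiag
  · exact opp_of_isDiag he (hxe ▸ hd)
  · have := h' a ha hd
    rw [sc, hc, sum_pair hxy] at this
    exact opp_of_sg_add he this

lemma cell_of_allDouble {J : Set (Fin 3)} (h : (TOn p J).AllDouble) {a : Sym2 (Set (Pt m))}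
    (ha : a ∈ EJ p J) : #(cell p J a) = 2 := by
  obtain ⟨x, y, hxy, hc, -⟩ := allDouble_iff.1 h a ha
  rw [hc, card_pair hxy]

lemma card_onJ_of_allDouble {J : Set (Fin 3)} (h : (TOn p J).AllDouble) :
    #(onJ m J) = 2 * #(EJ p J) := by
  rw [card_onJ_eq_sum p J, sum_congr rfl fun a ha => cell_of_allDouble h ha, sum_const,
    smul_eq_mul, mul_comm]

/-- In every class of edges the two orientations are equally frequent; the number of loops at any
vertex is even. -/
structure Balanced (p : Setoid (Pt m)) : Prop where
  even : ∀ a, Even #(cell p Set.univ a)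
  signed : ∀ a, ¬ a.IsDiag → sc p ℚ Set.univ a = 0

/-- The number of blocks is `m / 2 - 1`, and every circle shares an edge with the others. -/
structure Base (p : Setoid (Pt m)) : Prop where
  card : 2 * #(VJ p Set.univ) + 2 = #(onJ m Set.univ)
  share : Share p

/-- Three double trees. -/
structure IsTrees (p : Setoid (Pt m)) : Prop extends Base p where
  cardE : 2 * #(EJ p Set.univ) + 4 = #(onJ m Set.univ)
  dbl : ∀ j, (TOn p {j}).AllDouble

/-- The circle `i` and the two other circles give doubled graphs, the latter with a circuit. -/
structure IsUni (p : Setoid (Pt m)) (i : Fin 3) : Prop extends Base p where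
  cardE : 2 * #(EJ p Set.univ) + 2 = #(onJ m Set.univ)
  dbl : (TOn p {i}).AllDouble
  dblc : (TOn p {i}ᶜ).AllDouble
  meet : ∀ j k, i ≠ j → i ≠ k → j ≠ k → ¬ Disjoint (EJ p {j}) (EJ p {k})

/-- The whole graph is doubled. -/
structure IsBi (p : Setoid (Pt m)) : Prop extends Base p where
  cardE : 2 * #(EJ p Set.univ) = #(onJ m Set.univ)
  dbl : (TOn p Set.univ).AllDouble

/-- Inclusion and exclusion: both parts are doubled, so the total E = m/2 - 1 is exactly one below
the sum of their numbers of classes. -/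
lemma card_EJ_inter {i : Fin 3} (hE : 2 * #(EJ p Set.univ) + 2 = #(onJ m Set.univ))
    (hc : #(onJ m {i}) = 2 * #(EJ p {i})) (hc' : #(onJ m {i}ᶜ) = 2 * #(EJ p {i}ᶜ)) :
    ∃ a, EJ p {i} ∩ EJ p {i}ᶜ = {a} := by
  rw [← card_eq_one]
  have h1 := card_onJ_union (m := m) (disjoint_compl_right (a := ({i} : Set (Fin 3))))
  have h2 := EJ_union (p := p) (J := {i}) (J' := {i}ᶜ)
  have h3 := card_union_add_card_inter (EJ p {i}) (EJ p {i}ᶜ)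
  rw [Set.union_compl_self] at h1 h2
  rw [← h2] at h3
  omega

lemma card_onJ_of_cell {J : Set (Fin 3)} (h : ∀ a ∈ EJ p J, #(cell p J a) = 2) :
    #(onJ m J) = 2 * #(EJ p J) := by
  rw [card_onJ_eq_sum p J, sum_congr rfl h, sum_const, smul_eq_mul, mul_comm]

/-- `genus_bound` already gives multiplicity two in each part; what remains is the orientation, that
is, the vanishing of the signed counts of each part outside the loops. -/
theorem classification (hb : Base p) (hbal : Balanced p) :
    IsTrees p ∨ (∃ i, IsUni p i) ∨ IsBi p := by
  have hV := hb.card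
  rcases (genus_bound hb.share hbal.even).2 hb.card with ⟨hE, hc⟩ | ⟨i, hE, hc, hc', hs⟩ | ⟨hE, hc⟩
  · refine Or.inl ⟨hb, hE, fun j => allDouble_of_sc (hc j) fun a ha _ => ?_⟩
    -- Here V = E + 1, which leaves no room for a nonzero functional that kills the coboundaries.
    by_contra h
    have := hb.share.conn.card_le_of_ann (ann_sc (K := ℚ) p (Set.subset_univ {j}))
      (EJ_mono (Set.subset_univ _) ha) h
    omega
  · obtain ⟨b, hb'⟩ := card_EJ_inter (p := p) (i := i) hE (card_onJ_of_cell hc)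
      (card_onJ_of_cell hc')
    have hmem : ∀ a, a ∈ EJ p {i} → a ∈ EJ p {i}ᶜ → a = b := fun a ha ha' =>
      mem_singleton.1 (hb'.subset (mem_inter.2 ⟨ha, ha'⟩))
    have hbm : b ∈ EJ p {i} :=
      (mem_inter.1 (hb'.symm.subset (mem_singleton_self b))).1

    have hsum : ∀ a, ¬ a.IsDiag → sc p ℚ {i} a + sc p ℚ {i}ᶜ a = 0 := by
      intro a ha
      rw [← sc_union p disjoint_compl_right, Set.union_compl_self]
      exact hbal.signed a ha
    -- The signed counts of the two parts cancel, hence can be nonzero only in the single shared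
    -- class `b`; a functional carried by one edge that is not a loop vanishes.
    have h1 : ∀ a, a ≠ b → ¬ a.IsDiag → sc p ℚ {i} a = 0 := by
      intro a hab ha
      by_contra h
      have h2 := hsum a ha
      have h3 := not_imp_comm.1 (sc_eq_zero_of_notMem p) h
      have h4 : sc p ℚ {i}ᶜ a ≠ 0 := fun h0 => h (by rwa [h0, add_zero] at h2)
      exact hab (hmem a h3 (not_imp_comm.1 (sc_eq_zero_of_notMem p) h4))
    have h2 : ∀ a, ¬ a.IsDiag → sc p ℚ {i} a = 0 := by
      intro a ha
      rcases eq_or_ne a b with rfl | hab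
      · have hA : Ann p {i} (sc p ℚ {i}) := ann_sc p subset_rfl
        refine hA.eq_zero hbm ha (B := (Quot.out a).1) (Sym2.out_fst_mem a) ?_
        exact fun c _ hca _ hc => h1 c hca hc
      · exact h1 a hab ha
    refine Or.inr (Or.inl ⟨i, hb, hE, allDouble_of_sc hc fun a _ ha => h2 a ha,
      allDouble_of_sc hc' fun a _ ha => ?_, hs⟩)
    have := hsum a ha
    rwa [h2 a ha, zero_add] at this
  · exact Or.inr (Or.inr ⟨hb, hE, allDouble_of_sc hc fun a _ ha => hbal.signed a ha⟩)

/-! ### Non-crossing pairings and their partitions -/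

lemma numBlocks_eq (p : Setoid (Pt m)) : numBlocks p = #(VJ p Set.univ) := by
  have h : VJ p Set.univ = univ.image (block p) := by simp [VJ, onJ]
  rw [h, numBlocks]
  have : Nat.card (Set.range (block p)) = #(univ.image (block p)) := by
    rw [Nat.card_eq_fintype_card, ← Set.toFinset_card, Set.toFinset_range]
  rw [← this]
  refine Nat.card_congr ((Quotient.congrRight fun x y => ?_).trans
    (Setoid.quotientKerEquivRange (block p)))
  rw [Setoid.ker_def]
  exact block_eq_iff.symm

lemma card_onJ_univ : #(onJ m Set.univ) = Nat.card (Pt m) := by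
  simp [onJ]

lemma cyclePartition_le {α : Type*} {g : Equiv.Perm α} {r : Setoid α} (h : ∀ x, r x (g x)) :
    cyclePartition g ≤ r := by
  rintro x y ⟨n, rfl⟩
  have h1 : ∀ n : ℕ, ∀ x, r x ((g ^ n) x) := by
    intro n
    induction n with
    | zero => exact r.refl
    | succ n ih => intro x; rw [pow_succ]; exact r.trans (h x) (ih (g x))
  cases n with
  | ofNat n => exact h1 n x
  | negSucc n =>
    rw [zpow_negSucc]
    have := h1 (n + 1) ((g ^ (n + 1))⁻¹ x)
    rw [← Equiv.Perm.mul_apply, mul_inv_cancel, Equiv.Perm.one_apply] at this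
    exact r.symm this

lemma cyclePartition_apply {α : Type*} (g : Equiv.Perm α) (x : α) :
    cyclePartition g x (g x) := ⟨1, by simp⟩

/-- A permutation all of whose cycles have two elements. -/
def IsPairing (f : Equiv.Perm (Pt m)) : Prop := ∀ x, f x ≠ x ∧ f (f x) = x

/-- The pairing connects every circle with another one. -/
def Link (f : Equiv.Perm (Pt m)) : Prop := ∀ j, ∃ x : Pt m, x.1 = j ∧ (f x).1 ≠ j

/-- A graph on three vertices is connected as soon as none of them is isolated. -/
lemma sup_eq_top_iff (hm : ∀ j, 0 < m j) {f : Equiv.Perm (Pt m)} :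
    cyclePartition f ⊔ cyclePartition (gam m) = ⊤ ↔ Link f := by
  constructor
  · intro h j
    by_contra! hj
    have hle : cyclePartition f ⊔ cyclePartition (gam m)
        ≤ Setoid.ker (fun x : Pt m => x.1 = j) := by
      refine sup_le (cyclePartition_le fun x => ?_) (cyclePartition_le fun x => rfl)
      have h1 : ∀ x : Pt m, x.1 = j → (f x).1 = j := hj
      -- By finiteness an injection of the circle into itself is onto, so `f` preserves its
      -- complement too.
      have h2 : onJ m {j} = (onJ m {j}).map f.toEmbedding := by
        symm
        refine eq_of_subset_of_card_le ?_ (card_map _).ge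
        intro y hy
        obtain ⟨z, hz, rfl⟩ := mem_map.1 hy
        exact mem_onJ.2 (h1 z (mem_onJ.1 hz))
      refine propext ⟨h1 x, fun hx => ?_⟩
      have h3 : f x ∈ onJ m {j} := mem_onJ.2 hx
      rw [h2] at h3
      obtain ⟨z, hz, hzx⟩ := mem_map.1 h3
      exact f.injective hzx ▸ mem_onJ.1 hz
    rw [h] at hle
    obtain ⟨k, -, hk, -⟩ := exists_others j
    have := @hle ⟨j, ⟨0, hm j⟩⟩ ⟨k, ⟨0, hm k⟩⟩ trivial
    rw [Setoid.ker_def] at this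
    exact hk (by simpa using this.symm : k = j).symm
  · intro h
    set s := cyclePartition f ⊔ cyclePartition (gam m) with hs
    have hf : ∀ x, s x (f x) := fun x =>
      (le_sup_left : cyclePartition f ≤ s) (cyclePartition_apply f x)
    have hg : ∀ x, s x (gam m x) := fun x =>
      (le_sup_right : cyclePartition (gam m) ≤ s) (cyclePartition_apply (gam m) x)
    have hc : ∀ x y : Pt m, x.1 = y.1 → s x y := by
      intro x y hxy
      refine (circle_induct (P := fun z => s x z) (j := x.1) (fun z _ => ?_) rfl hxy.symm).1
        (s.refl x)
      exact ⟨fun h => s.trans h (s.symm (hg z)), fun h => s.trans h (hg z)⟩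
    have hR : ∀ j, ∃ k, k ≠ j ∧ ∀ x y : Pt m, x.1 = j → y.1 = k → s x y := by
      intro j
      obtain ⟨z, hz, hz'⟩ := h j
      exact ⟨_, hz', fun x y hx hy =>
        s.trans (hc x z (hx.trans hz.symm)) (s.trans (hf z) (hc (f z) y hy.symm))⟩
    rw [Setoid.eq_top_iff]
    intro x y
    by_cases hxy : x.1 = y.1
    · exact hc x y hxy
    · obtain ⟨k, hk, hxk⟩ := hR x.1
      obtain ⟨l, hl, hyl⟩ := hR y.1
      by_cases h1 : k = y.1
      · exact hxk x y rfl h1.symm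
      by_cases h2 : l = x.1
      · exact s.symm (hyl y x rfl h2.symm)
      -- Neither neighbour is one of the two given circles, so both are the third one.
      have h3 : k = l := by
        clear * - hxy hk hl h1 h2
        generalize x.1 = a at *
        generalize y.1 = b at *
        revert a b k l
        decide
      exact s.trans (hxk x ⟨k, ⟨0, hm k⟩⟩ rfl rfl) (s.symm (hyl y _ rfl h3))

lemma two_mul_numBlocks_of_isPairing {f : Equiv.Perm (Pt m)} (hf : IsPairing f) :
    2 * numBlocks (cyclePartition f) = Nat.card (Pt m) := by
  rw [numBlocks_eq, ← card_onJ_univ]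
  rw [VJ, card_eq_sum_card_image (block (cyclePartition f)) (onJ m Set.univ), mul_comm,
    ← smul_eq_mul, ← sum_const]
  refine sum_congr rfl fun B hB => ?_
  obtain ⟨x, -, rfl⟩ := mem_image.1 hB
  rw [eq_comm, card_eq_two]
  refine ⟨x, f x, (hf x).1.symm, ?_⟩
  ext y
  simp only [mem_filter, mem_onJ, Set.mem_univ, true_and, mem_insert, mem_singleton,
    block_eq_iff]
  constructor
  · intro h
    have hle : cyclePartition f ≤ Setoid.ker (fun z => ({z, f z} : Set (Pt m))) :=
      cyclePartition_le fun z => by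
        rw [Setoid.ker_def, (hf z).2, Set.pair_comm]
    have h1 : ({y, f y} : Set (Pt m)) = {x, f x} := hle h
    have h2 : y ∈ ({x, f x} : Set (Pt m)) := h1 ▸ Set.mem_insert _ _
    simpa using h2
  · rintro (rfl | rfl)
    · exact Setoid.refl' _ _
    · exact Setoid.symm' _ (cyclePartition_apply f x)

lemma numBlocks_gam (hm : ∀ j, 0 < m j) : numBlocks (cyclePartition (gam m)) = 3 := by
  have e : cyclePartition (gam m) = Setoid.ker (fun x : Pt m => x.1) := by
    refine le_antisymm (cyclePartition_le fun x => rfl) ?_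
    intro x y hxy
    refine (circle_induct (P := fun z => cyclePartition (gam m) x z) (j := x.1) (fun z _ => ?_)
      rfl (Eq.symm hxy)).1 (Setoid.refl' _ x)
    exact ⟨fun h => Setoid.trans' _ h (Setoid.symm' _ (cyclePartition_apply _ z)),
      fun h => Setoid.trans' _ h (cyclePartition_apply _ z)⟩
  rw [e, numBlocks, Nat.card_congr (Setoid.quotientKerEquivOfSurjective _
    (fun j => ⟨⟨j, ⟨0, hm j⟩⟩, rfl⟩))]
  simp

/-- The two products are conjugate by `g`. -/
lemma numBlocks_mul_comm {α : Type*} (f g : Equiv.Perm α) :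
    numBlocks (cyclePartition (f * g)) = numBlocks (cyclePartition (g * f)) := by
  refine Nat.card_congr (Quotient.congr g fun x y => ?_)
  change (f * g).SameCycle x y ↔ (g * f).SameCycle (g x) (g y)
  have : g * f = g * (f * g) * g⁻¹ := by group
  rw [this, Equiv.Perm.sameCycle_conj]
  simp

/-- An involution without fixed points has m/2 cycles and equals its inverse, and γ has three
cycles. The genus condition thus says m/2 + (m - #(γf)) = (m - 3) + 4, which is equality in
`genus_bound`. -/
lemma mem_NC2_iff (hm : ∀ j, 0 < m j) {f : Equiv.Perm (Pt m)} : f ∈ NC2 m ↔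
    IsPairing f ∧ Link f ∧
      2 * numBlocks (cyclePartition (gam m * f)) + 2 = Nat.card (Pt m) := by
  unfold NC2 SNC
  simp only [Set.mem_ofPred_eq, sup_eq_top_iff hm]
  constructor
  · rintro ⟨⟨h1, h2⟩, h3⟩
    refine ⟨h3, h2, ?_⟩
    have hi : f⁻¹ = f := by
      rw [inv_eq_iff_mul_eq_one]; ext1 x; exact (h3 x).2
    rw [hi, permLength, permLength, permLength, numBlocks_gam hm, numBlocks_mul_comm f] at h1
    have h4 := two_mul_numBlocks_of_isPairing h3
    -- `permLength` subtracts in ℕ; this bound and the next one exclude truncation.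
    have h5 : 3 ≤ Nat.card (Pt m) := by
      rw [← numBlocks_gam hm]
      exact Nat.card_le_card_of_surjective _ Quotient.mk_surjective
    have h6 : numBlocks (cyclePartition (gam m * f)) ≤ Nat.card (Pt m) :=
      Nat.card_le_card_of_surjective _ Quotient.mk_surjective
    omega
  · rintro ⟨h3, h2, h1⟩
    refine ⟨⟨?_, h2⟩, h3⟩
    have hi : f⁻¹ = f := by
      rw [inv_eq_iff_mul_eq_one]; ext1 x; exact (h3 x).2
    rw [hi, permLength, permLength, permLength, numBlocks_gam hm, numBlocks_mul_comm f]
    have h4 := two_mul_numBlocks_of_isPairing h3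
    have h5 : 3 ≤ Nat.card (Pt m) := by
      rw [← numBlocks_gam hm]
      exact Nat.card_le_card_of_surjective _ Quotient.mk_surjective
    omega

/-- The pairing acts on every class as an involution without fixed points, and it reverses the sign
of edges that are not loops. -/
lemma balanced_of_pairing {f : Equiv.Perm (Pt m)} (hf : IsPairing f) (ho : ∀ x, Opp p x (f x)) :
    Balanced p := by
  have hmem : ∀ a, ∀ x ∈ cell p Set.univ a, f x ∈ cell p Set.univ a := by
    intro a x hx
    rw [mem_cell] at hx ⊢
    exact ⟨trivial, (ho x).en_eq.symm.trans hx.2⟩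
  constructor
  · intro a
    refine even_of_sc_eq_zero ?_
    rw [sc_zmod_two, card_eq_sum_ones, Nat.cast_sum]
    refine sum_involution (fun x _ => f x) ?_ ?_ ?_ ?_
    · intro _ _; decide
    · intro x _ _; exact (hf x).1
    · exact hmem a
    · intro x _; exact (hf x).2
  · intro a ha
    refine sum_involution (fun x _ => f x) ?_ ?_ ?_ ?_
    · intro x hx
      exact (ho x).sg_add ((mem_cell.1 hx).2 ▸ ha)
    · intro x _ _; exact (hf x).1
    · exact hmem a
    · intro x _; exact (hf x).2

lemma share_of_link {f : Equiv.Perm (Pt m)} (hl : Link f) (ho : ∀ x, Opp p x (f x)) :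
    Share p := by
  intro j
  obtain ⟨x, hx, hx'⟩ := hl j
  exact Finset.not_disjoint_iff.2 ⟨en p x, mem_EJ.2 ⟨x, hx, rfl⟩,
    mem_EJ.2 ⟨f x, hx', (ho x).en_eq.symm⟩⟩

lemma opp_cyclePartition {f : Equiv.Perm (Pt m)} (hf : IsPairing f) (x : Pt m) :
    Opp (cyclePartition (gam m * f)) x (f x) := by
  constructor
  · rw [block_eq_iff]
    have := cyclePartition_apply (gam m * f) (f x)
    rw [Equiv.Perm.mul_apply, (hf x).2] at this
    exact Setoid.symm' _ this
  · rw [block_eq_iff]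
    exact cyclePartition_apply (gam m * f) x

/-- The pairings of opposite edges which connect the circles. -/
def Fib (p : Setoid (Pt m)) : Set (Equiv.Perm (Pt m)) :=
  {f | IsPairing f ∧ Link f ∧ ∀ x, Opp p x (f x)}

lemma eq_of_le_of_numBlocks {α : Type*} [Finite α] {r s : Setoid α} (h : r ≤ s)
    (hn : numBlocks r ≤ numBlocks s) : r = s := by
  refine le_antisymm h ?_
  let F : Quotient r → Quotient s := Quotient.map' id h
  have hF : Function.Surjective F := by
    rintro ⟨x⟩
    exact ⟨Quotient.mk r x, rfl⟩
  have hinj : Function.Injective F :=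
    ((Nat.bijective_iff_surjective_and_card F).2
      ⟨hF, le_antisymm hn (Nat.card_le_card_of_surjective F hF)⟩).1
  intro x y hxy
  have : F (Quotient.mk r x) = F (Quotient.mk r y) := Quotient.sound hxy
  exact Quotient.exact (hinj this)

/-- Pairing opposite edges of `p` makes `x` equivalent to γ(f x), so the cycles of γf refine `p`. By
`genus_bound` they number at most m/2 - 1, the number of blocks of `p`, hence the refinement is not
proper. -/
lemma Base.preimage_eq (hm : ∀ j, 0 < m j) (hb : Base p) :
    {f | f ∈ NC2 m ∧ cyclePartition (gam m * f) = p} = Fib p := by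
  have hcard := hb.card
  rw [← numBlocks_eq, card_onJ_univ] at hcard
  ext f
  simp only [Set.mem_ofPred_eq, Fib, mem_NC2_iff hm]
  constructor
  · rintro ⟨⟨h1, h2, h3⟩, rfl⟩
    exact ⟨h1, h2, opp_cyclePartition h1⟩
  · rintro ⟨h1, h2, h3⟩
    have hle : cyclePartition (gam m * f) ≤ p := cyclePartition_le fun x =>
      block_eq_iff.1 (h3 x).2
    have hg := (genus_bound (share_of_link h2 (opp_cyclePartition h1))
      (balanced_of_pairing h1 (opp_cyclePartition h1)).even).1
    rw [← numBlocks_eq, card_onJ_univ] at hg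
    have he := eq_of_le_of_numBlocks hle (by omega)
    exact ⟨⟨h1, h2, by rw [he]; exact hcard⟩, he⟩

lemma base_balanced_of_mem_NC2 (hm : ∀ j, 0 < m j) {f : Equiv.Perm (Pt m)} (hf : f ∈ NC2 m) :
    Base (cyclePartition (gam m * f)) ∧ Balanced (cyclePartition (gam m * f)) := by
  obtain ⟨h1, h2, h3⟩ := (mem_NC2_iff hm).1 hf
  refine ⟨⟨?_, share_of_link h2 (opp_cyclePartition h1)⟩,
    balanced_of_pairing h1 (opp_cyclePartition h1)⟩
  rw [← numBlocks_eq, card_onJ_univ]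
  exact h3

/-! ### Counting the preimages -/

/-- Here `lab j` is the part to which the circle `j` belongs in a partition of the circles into
doubled parts; each edge is paired with its only partner in its own part. -/
lemma exists_pairing {lab : Fin 3 → Set (Fin 3)} (h1 : ∀ j, j ∈ lab j)
    (h2 : ∀ j, ∀ k ∈ lab j, lab k = lab j) (hd : ∀ j, (TOn p (lab j)).AllDouble) :
    ∃ f : Equiv.Perm (Pt m), IsPairing f ∧ (∀ x, Opp p x (f x)) ∧
      (∀ x y : Pt m, en p y = en p x → y.1 ∈ lab x.1 → y = x ∨ y = f x) ∧
      ∀ x, (f x).1 ∈ lab x.1 := by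
  have hex : ∀ x : Pt m, ∃ y, y ≠ x ∧ cell p (lab x.1) (en p x) = {x, y} ∧ Opp p x y := by
    intro x
    obtain ⟨u, v, huv, hc, ho⟩ := allDouble_iff.1 (hd x.1) (en p x) (mem_EJ.2 ⟨x, h1 _, rfl⟩)
    have hx : x ∈ cell p (lab x.1) (en p x) := mem_cell.2 ⟨h1 _, rfl⟩
    rw [hc, mem_insert, mem_singleton] at hx
    rcases hx with rfl | rfl
    · exact ⟨v, huv.symm, hc, ho⟩
    · exact ⟨u, huv, by rw [hc, pair_comm], ho.symm⟩
  choose g hg1 hg2 hg3 using hex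
  have hmem : ∀ x, (g x).1 ∈ lab x.1 := by
    intro x
    have : g x ∈ cell p (lab x.1) (en p x) := by rw [hg2]; simp
    exact (mem_cell.1 this).1
  have hinv : Function.Involutive g := by
    intro x
    have h3 := hg2 (g x)
    rw [h2 _ _ (hmem x), ← (hg3 x).en_eq, hg2 x] at h3
    have h4 : g (g x) ∈ ({x, g x} : Finset (Pt m)) := by rw [h3]; simp
    rw [mem_insert, mem_singleton] at h4
    exact h4.resolve_right (hg1 (g x))
  refine ⟨hinv.toPerm, fun x => ⟨hg1 x, hinv x⟩, hg3, ?_, hmem⟩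
  intro x y hy hy'
  have : y ∈ cell p (lab x.1) (en p x) := mem_cell.2 ⟨hy', hy⟩
  rw [hg2] at this
  simpa using this

/-- The edges `e_x` and `e_y` of `T^π` have the same orientation. -/
def Par (p : Setoid (Pt m)) (x y : Pt m) : Prop :=
  block p (gam m x) = block p (gam m y) ∧ block p x = block p y

lemma Par.symm {x y : Pt m} (h : Par p x y) : Par p y x := ⟨h.1.symm, h.2.symm⟩

lemma Par.trans {x y z : Pt m} (h : Par p x y) (h' : Par p y z) : Par p x z :=
  ⟨h.1.trans h'.1, h.2.trans h'.2⟩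

lemma Par.en_eq {x y : Pt m} (h : Par p x y) : en p x = en p y := by
  rw [en, en, h.1, h.2]

lemma Opp.par {x y z : Pt m} (h : Opp p x y) (h' : Opp p y z) : Par p x z :=
  ⟨h.1.trans h'.2, h.2.trans h'.1⟩

lemma Par.opp {x y z : Pt m} (h : Par p x y) (h' : Opp p y z) : Opp p x z :=
  ⟨h.1.trans h'.1, h.2.trans h'.2⟩

lemma Opp.trans_par {x y z : Pt m} (h : Opp p x y) (h' : Par p y z) : Opp p x z :=
  ⟨h.1.trans h'.2, h.2.trans h'.1⟩

lemma par_or_opp {x y : Pt m} (h : en p x = en p y) : Par p x y ∨ Opp p x y := by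
  rw [en, en, Sym2.eq_iff] at h
  exact h

lemma Par.not_opp {x y : Pt m} (h : Par p x y) (hd : ¬ (en p x).IsDiag) : ¬ Opp p x y := by
  intro ho
  exact hd (en_isDiag_iff.2 (ho.1.trans h.2.symm))

/-- The pairing which pairs `x` with `f y` and `y` with `f x`, and agrees with `f` otherwise. -/
def switch (f : Equiv.Perm (Pt m)) (x y : Pt m) : Equiv.Perm (Pt m) :=
  Equiv.swap x y * f * Equiv.swap x y

lemma switch_apply (f : Equiv.Perm (Pt m)) (x y z : Pt m) :
    switch f x y z = Equiv.swap x y (f (Equiv.swap x y z)) := rfl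

/-! ### Switching two pairs of a pairing -/

section Switch

variable {f : Equiv.Perm (Pt m)} {x y : Pt m}

lemma IsPairing.switch (hf : IsPairing f) (x y : Pt m) : IsPairing (switch f x y) := by
  intro z
  rw [switch_apply, switch_apply, Equiv.swap_apply_self, (hf _).2, Equiv.swap_apply_self]
  refine ⟨fun h => (hf (Equiv.swap x y z)).1 ?_, rfl⟩
  rw [Equiv.swap_apply_eq_iff] at h
  exact h

lemma IsPairing.eq_apply_comm (hf : IsPairing f) {u v : Pt m} (h : f u = v) : f v = u := by
  rw [← h, (hf u).2]

lemma switch_left (hf : IsPairing f) (h : y ≠ f x) : switch f x y x = f y := by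
  rw [switch_apply, Equiv.swap_apply_left, Equiv.swap_apply_of_ne_of_ne]
  · exact fun h' => h (hf.eq_apply_comm h').symm
  · exact (hf y).1

lemma switch_right (hf : IsPairing f) (h : y ≠ f x) : switch f x y y = f x := by
  rw [switch_apply, Equiv.swap_apply_right, Equiv.swap_apply_of_ne_of_ne]
  · exact (hf x).1
  · exact h.symm

lemma switch_of_ne {z : Pt m} (hx : z ≠ x) (hy : z ≠ y) (hx' : f z ≠ x) (hy' : f z ≠ y) :
    switch f x y z = f z := by
  rw [switch_apply, Equiv.swap_apply_of_ne_of_ne hx hy, Equiv.swap_apply_of_ne_of_ne hx' hy']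

/-- The switch is conjugation by the transposition of `x` and `y`, which moves each edge to a
parallel one. -/
lemma opp_switch (ho : ∀ x, Opp p x (f x)) (h : Par p x y) (z : Pt m) :
    Opp p z (switch f x y z) := by
  have hs : ∀ z, Par p z (Equiv.swap x y z) := by
    intro z
    by_cases hx : z = x
    · rw [hx, Equiv.swap_apply_left]; exact h
    by_cases hy : z = y
    · rw [hy, Equiv.swap_apply_right]; exact h.symm
    rw [Equiv.swap_apply_of_ne_of_ne hx hy]; exact ⟨rfl, rfl⟩
  exact ((hs z).opp (ho _)).trans_par (hs _)

/-- If the class of `x` consists of two pairs, a pairing `h` which pairs `x` with `f y` agrees with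
the switched pairing there. -/
lemma eq_of_four {h : Equiv.Perm (Pt m)} (hf : IsPairing f) (hh : IsPairing h)
    (ho : ∀ z, Opp p z (h z)) (hxy : y ≠ x) (hen : en p y = en p x)
    (hfour : ∀ z, en p z = en p x → z = x ∨ z = f x ∨ z = y ∨ z = f y) (hx : h x = f y) :
    h y = f x ∧ h (f x) = y ∧ h (f y) = x := by
  have hy' := hh.eq_apply_comm hx
  have hy : h y = f x := by
    rcases hfour (h y) ((ho y).en_eq.symm.trans hen) with e | e | e | e
    · rw [hh.eq_apply_comm e] at hx
      exact absurd hx.symm (hf y).1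
    · exact e
    · exact absurd e (hh y).1
    · exact absurd (h.injective (e.trans hx.symm)) hxy
  exact ⟨hy, hh.eq_apply_comm hy, hy'⟩

lemma eq_switch {h : Equiv.Perm (Pt m)} (hf : IsPairing f) (hh : IsPairing h)
    (hof : ∀ z, Opp p z (f z)) (ho : ∀ z, Opp p z (h z)) (hxy : y ≠ x) (hyx : y ≠ f x)
    (hen : en p y = en p x)
    (hfour : ∀ z, en p z = en p x → z = x ∨ z = f x ∨ z = y ∨ z = f y) (hx : h x = f y)
    (hout : ∀ z, en p z ≠ en p x → h z = f z) : h = switch f x y := by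
  obtain ⟨h1, h2, h3⟩ := eq_of_four hf hh ho hxy hen hfour hx
  have s1 := switch_left hf hyx
  have s2 := switch_right hf hyx
  have hs := hf.switch x y
  ext1 z
  by_cases hz : en p z = en p x
  · rcases hfour z hz with rfl | rfl | rfl | rfl
    · rw [hx, s1]
    · rw [h2, hs.eq_apply_comm s2]
    · rw [h1, s2]
    · rw [h3, hs.eq_apply_comm s1]
  · rw [hout z hz, switch_of_ne]
    · rintro rfl; exact hz rfl
    · rintro rfl; exact hz hen
    · intro e; exact hz (by rw [← e]; exact (hof z).en_eq)
    · intro e; exact hz (by rw [← hen, ← e]; exact (hof z).en_eq)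

end Switch

/-! ### Preimages in the bicircuit and unicircuit cases -/

lemma IsBi.ncard (h : IsBi p) : (Fib p).ncard = 1 := by
  obtain ⟨f, hf, ho, hu, -⟩ := exists_pairing (p := p) (lab := fun _ => Set.univ)
    (fun _ => trivial) (fun _ _ _ => rfl) (fun _ => h.dbl)
  rw [Set.ncard_eq_one]
  refine ⟨f, Set.eq_singleton_iff_unique_mem.2 ⟨⟨hf, ?_, ho⟩, ?_⟩⟩
  · intro j
    obtain ⟨a, ha, ha'⟩ := Finset.not_disjoint_iff.1 (h.share j)
    obtain ⟨x, hx, rfl⟩ := mem_EJ.1 ha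
    obtain ⟨y, hy, hxy⟩ := mem_EJ.1 ha'
    refine ⟨x, hx, fun e => ?_⟩
    rcases hu x y hxy trivial with rfl | rfl
    · exact hy hx
    · exact hy e
  · rintro g ⟨hg, -, hog⟩
    ext1 x
    exact (hu x (g x) (hog x).en_eq.symm trivial).resolve_left (hg x).1

/-- The circle `i` is joined with the others in the class of `x`, where `x` is on the circle `i`
and `y` is not, and `f` pairs the edges of the two parts. -/
structure UniData (p : Setoid (Pt m)) (i : Fin 3) (f : Equiv.Perm (Pt m)) (x y : Pt m) : Prop where
  pairing : IsPairing f
  opp : ∀ z, Opp p z (f z)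
  hx : x.1 = i
  hy : y.1 ≠ i
  par : Par p x y
  mem : ∀ z, z.1 = i → (f z).1 = i
  mem' : ∀ z, z.1 ≠ i → (f z).1 ≠ i
  four : ∀ z, en p z = en p x → z = x ∨ z = f x ∨ z = y ∨ z = f y
  two : ∀ z w, en p w = en p z → en p z ≠ en p x → w = z ∨ w = f z
  inter : EJ p {i} ∩ EJ p {i}ᶜ = {en p x}
  link : ∀ j k, i ≠ j → i ≠ k → j ≠ k → ∃ z : Pt m, z.1 = j ∧ (f z).1 = k

lemma IsUni.exists_data {i : Fin 3} (h : IsUni p i) : ∃ f x y, UniData p i f x y := by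
  obtain ⟨a, ha⟩ := card_EJ_inter h.cardE (card_onJ_of_allDouble h.dbl)
    (card_onJ_of_allDouble h.dblc)
  obtain ⟨f, hf, ho, hu, hmem⟩ := exists_pairing (p := p)
    (lab := fun j => if j = i then {i} else {i}ᶜ)
    (by intro j; split_ifs with e <;> simp [e])
    (by
      intro j k hk
      by_cases e : j = i
      · rw [if_pos e] at hk ⊢; rw [if_pos (by simpa using hk)]
      · rw [if_neg e] at hk ⊢; rw [if_neg (by simpa using hk)])
    (by intro j; by_cases e : j = i <;> simp only [e, if_true, if_false]; exacts [h.dbl, h.dblc])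
  have hm1 : ∀ z, z.1 = i → (f z).1 = i := by
    intro z hz; simpa [hz] using hmem z
  have hm2 : ∀ z, z.1 ≠ i → (f z).1 ≠ i := by
    intro z hz; simpa [hz] using hmem z
  have hu1 : ∀ z w : Pt m, en p w = en p z → z.1 = i → w.1 = i → w = z ∨ w = f z := by
    intro z w h1 h2 h3; exact hu z w h1 (by simp [h2, h3])
  have hu2 : ∀ z w : Pt m, en p w = en p z → z.1 ≠ i → w.1 ≠ i → w = z ∨ w = f z := by
    intro z w h1 h2 h3; exact hu z w h1 (by simp [h2, h3])
  have hmema : ∀ b, b ∈ EJ p {i} → b ∈ EJ p {i}ᶜ → b = a := fun b hb hb' =>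
    mem_singleton.1 (ha.subset (mem_inter.2 ⟨hb, hb'⟩))
  have hai := mem_inter.1 (ha.symm.subset (mem_singleton_self a))
  obtain ⟨x, hx, rfl⟩ := mem_EJ.1 hai.1
  -- The shared class contains a pair of opposite edges of the other part; one of the two is
  -- parallel to `x`.
  obtain ⟨y, hy, hxy, hpar⟩ : ∃ y : Pt m, y.1 ≠ i ∧ en p y = en p x ∧ Par p x y := by
    obtain ⟨y, hy, hxy⟩ := mem_EJ.1 hai.2
    rcases par_or_opp hxy.symm with h1 | h1
    · exact ⟨y, hy, hxy, h1⟩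
    · exact ⟨f y, hm2 y hy, (ho y).en_eq.symm.trans hxy, h1.par (ho y)⟩
  refine ⟨f, x, y, hf, ho, hx, hy, hpar, hm1, hm2, ?_, ?_, ha, ?_⟩
  · intro z hz
    by_cases hzi : z.1 = i
    · rcases hu1 x z hz hx hzi with e | e <;> simp [e]
    · rcases hu2 y z (hz.trans hxy.symm) hy hzi with e | e <;> simp [e]
  · intro z w h1 h2
    by_cases hz : z.1 = i <;> by_cases hw : w.1 = i
    · exact hu1 z w h1 hz hw
    · exact absurd (hmema _ (mem_EJ.2 ⟨z, hz, rfl⟩) (mem_EJ.2 ⟨w, hw, h1⟩)) h2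
    · exact absurd (hmema _ (mem_EJ.2 ⟨w, hw, h1⟩) (mem_EJ.2 ⟨z, hz, rfl⟩)) h2
    · exact hu2 z w h1 hz hw
  · intro j k hij hik hjk
    obtain ⟨b, hb, hb'⟩ := Finset.not_disjoint_iff.1 (h.meet j k hij hik hjk)
    obtain ⟨z, hz, hzb⟩ := mem_EJ.1 hb
    obtain ⟨w, hw, hwb⟩ := mem_EJ.1 hb'
    replace hz : z.1 = j := hz
    replace hw : w.1 = k := hw
    refine ⟨z, hz, ?_⟩
    rcases hu2 z w (hwb.trans hzb.symm) (by rw [hz]; exact hij.symm) (by rw [hw]; exact hik.symm)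
      with rfl | rfl
    · exact absurd (hz.symm.trans hw) hjk
    · exact hw

namespace UniData

variable {i : Fin 3} {f : Equiv.Perm (Pt m)} {x y : Pt m}

lemma ne (d : UniData p i f x y) : y ≠ x := fun h => d.hy (h ▸ d.hx)

lemma ne' (d : UniData p i f x y) : y ≠ f x := fun h => d.hy (h ▸ d.mem x d.hx)

/-- Loops at one vertex are parallel as well as opposite, so `y` and `f y` are interchangeable. -/
lemma symm (d : UniData p i f x y) (hd : (en p x).IsDiag) : UniData p i f x (f y) where
  pairing := d.pairing
  opp := d.opp
  hx := d.hx
  hy := d.mem' y d.hy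
  par := by
    refine d.par.trans ?_
    have := opp_of_isDiag (x := y) (y := y) rfl (d.par.en_eq ▸ hd)
    exact this.par (d.opp y)
  mem := d.mem
  mem' := d.mem'
  four := by
    intro z hz
    rw [(d.pairing y).2]
    rcases d.four z hz with e | e | e | e <;> simp [e]
  two := d.two
  inter := d.inter
  link := d.link

/-- Circle `i` is connected through `x`. Any other circle `j` has a pair of `f` leading to the third
circle; if the switch breaks this pair, the point on `j` is sent to circle `i` instead. -/
lemma link_switch (d : UniData p i f x y) : Link (switch f x y) := by
  have hl := switch_left d.pairing d.ne'
  have hr := switch_right d.pairing d.ne'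
  have hs := d.pairing.switch x y
  intro j
  by_cases hj : j = i
  · exact ⟨x, d.hx.trans hj.symm, by rw [hl, hj]; exact d.mem' y d.hy⟩
  · obtain ⟨k, hk⟩ : ∃ k, i ≠ k ∧ j ≠ k := by
      clear * - hj; revert i j; decide
    obtain ⟨z, hz, hz'⟩ := d.link j k (Ne.symm hj) hk.1 hk.2
    refine ⟨z, hz, ?_⟩
    by_cases h1 : z = y
    · rw [h1, hr, d.mem x d.hx]; exact Ne.symm hj
    by_cases h2 : f z = y
    · rw [← d.pairing.eq_apply_comm h2, hs.eq_apply_comm hl, d.hx] at *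
      exact Ne.symm hj
    rw [switch_of_ne _ h1 _ h2, hz']
    · exact hk.2.symm
    · rintro rfl; exact hj (hz.symm.trans d.hx)
    · intro e; rw [e, d.hx] at hz'; exact hk.1 hz'

lemma switch_mem_Fib (d : UniData p i f x y) : switch f x y ∈ Fib p :=
  ⟨d.pairing.switch x y, d.link_switch, opp_switch d.opp d.par⟩

/-- A connecting pairing must leave circle `i` somewhere. This is possible in the class of `x` only,
where `g x = f x` would use up both points on circle `i`. -/
lemma apply_eq (d : UniData p i f x y) {g : Equiv.Perm (Pt m)} (hg : g ∈ Fib p) :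
    g x = y ∨ g x = f y := by
  obtain ⟨h1, h2, h3⟩ := hg
  rcases d.four (g x) (h3 x).en_eq.symm with e | e | e
  · exact absurd e (h1 x).1
  · exfalso
    obtain ⟨z, hz, hz'⟩ := h2 i
    by_cases hzx : en p z = en p x
    · rcases d.four z hzx with rfl | rfl | rfl | rfl
      · rw [e] at hz'; exact hz' (d.mem _ hz)
      · rw [h1.eq_apply_comm e] at hz'; exact hz' d.hx
      · exact d.hy hz
      · exact d.mem' _ d.hy hz
    · rw [(d.two z (g z) (h3 z).en_eq.symm hzx).resolve_left (h1 z).1] at hz'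
      exact hz' (d.mem z hz)
  · exact e

lemma eq_switch (d : UniData p i f x y) {g : Equiv.Perm (Pt m)} (hg : g ∈ Fib p)
    (hx : g x = f y) : g = switch f x y :=
  WignerThird.eq_switch d.pairing hg.1 d.opp hg.2.2 d.ne d.ne' d.par.en_eq.symm d.four hx
    fun z hz => (d.two z (g z) (hg.2.2 z).en_eq.symm hz).resolve_left (hg.1 z).1

lemma ncard_of_not_isDiag (d : UniData p i f x y) (hd : ¬ (en p x).IsDiag) :
    (Fib p).ncard = 1 := by
  rw [Set.ncard_eq_one]
  refine ⟨switch f x y, Set.eq_singleton_iff_unique_mem.2 ⟨d.switch_mem_Fib, fun g hg => ?_⟩⟩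
  refine d.eq_switch hg ((d.apply_eq hg).resolve_left fun e => ?_)
  -- Outside the loops `x` is parallel to `y`, so it can only be paired with `f y`.
  exact d.par.not_opp hd (e ▸ hg.2.2 x)

lemma ncard_of_isDiag (d : UniData p i f x y) (hd : (en p x).IsDiag) : (Fib p).ncard = 2 := by
  have d' := d.symm hd
  rw [Set.ncard_eq_two]
  refine ⟨switch f x y, switch f x (f y), fun e => ?_, Set.ext fun g => ⟨fun hg => ?_, ?_⟩⟩
  · have h1 := switch_left d.pairing d.ne'
    rw [e, switch_left d.pairing d'.ne', (d.pairing y).2] at h1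
    exact (d.pairing y).1 h1.symm
  · rcases d.apply_eq hg with e | e
    · exact Or.inr (d'.eq_switch hg (by rw [e, (d.pairing y).2]))
    · exact Or.inl (d.eq_switch hg e)
  · rintro (rfl | rfl)
    exacts [d.switch_mem_Fib, d'.switch_mem_Fib]

end UniData

/-! ### Preimages in the tree cases -/

lemma IsTrees.not_isDiag (h : IsTrees p) {a : Sym2 (Set (Pt m))} (ha : a ∈ EJ p Set.univ) :
    ¬ a.IsDiag := by
  intro hd
  -- A loop would give V ≤ E, while V = E + 1.
  have h1 := h.share.conn.card_le_of_ann (ann_single_of_isDiag (K := ℚ) hd) ha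
    (by rw [Pi.single_eq_same]; exact one_ne_zero)
  have h2 := h.card
  have h3 := h.cardE
  omega

lemma mem_EJ_univ {J : Set (Fin 3)} {a : Sym2 (Set (Pt m))} (h : a ∈ EJ p J) :
    a ∈ EJ p Set.univ := EJ_mono (Set.subset_univ _) h

lemma singleton_union_union {i j k : Fin 3} (hij : i ≠ j) (hik : i ≠ k) (hjk : j ≠ k) :
    ({k} : Set (Fin 3)) ∪ ({i} ∪ {j}) = Set.univ := by
  rw [← compl_singleton_eq hik.symm hjk.symm hij, Set.union_compl_self]

/-- The total E is two below the sum over the circles, and both gluings lose at least one class, so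
each loses exactly one. -/
lemma IsTrees.exists_inter (h : IsTrees p) : ∃ (i j k : Fin 3) (a b : Sym2 (Set (Pt m))),
    i ≠ j ∧ i ≠ k ∧ j ≠ k ∧ EJ p {i} ∩ EJ p {j} = {a} ∧
      EJ p {k} ∩ (EJ p {i} ∪ EJ p {j}) = {b} := by
  obtain ⟨i, j, k, hij, hik, hjk, h1, h2⟩ := h.share.exists_order
  have hu := singleton_union_union hij hik hjk
  have hd : Disjoint ({k} : Set (Fin 3)) ({i} ∪ {j}) := by
    rw [← compl_singleton_eq hik.symm hjk.symm hij]; exact disjoint_compl_right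
  have c1 := card_onJ_union (m := m) (disjoint_singleton_of_ne hij)
  have c2 := card_onJ_union (m := m) hd
  have e1 := card_union_add_card_inter (EJ p {i}) (EJ p {j})
  have e2 := card_union_add_card_inter (EJ p {k}) (EJ p {i} ∪ EJ p {j})
  have di := card_onJ_of_allDouble (h.dbl i)
  have dj := card_onJ_of_allDouble (h.dbl j)
  have dk := card_onJ_of_allDouble (h.dbl k)
  rw [EJ_union, Finset.not_disjoint_iff_nonempty_inter, ← card_pos] at h2
  rw [Finset.not_disjoint_iff_nonempty_inter, ← card_pos] at h1
  rw [← EJ_union, ← EJ_union, hu, EJ_union] at e2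
  rw [hu] at c2
  have hE := h.cardE
  obtain ⟨a, ha⟩ := card_eq_one.1 (by omega : #(EJ p {i} ∩ EJ p {j}) = 1)
  obtain ⟨b, hb⟩ := card_eq_one.1 (by omega : #(EJ p {k} ∩ (EJ p {i} ∪ EJ p {j})) = 1)
  exact ⟨i, j, k, a, b, hij, hik, hjk, ha, hb⟩

lemma fin_three_cases {i j k : Fin 3} (hij : i ≠ j) (hik : i ≠ k) (hjk : j ≠ k) (l : Fin 3) :
    l = i ∨ l = j ∨ l = k := by
  revert i j k l; decide

lemma IsTrees.common_unique (h : IsTrees p) {a : Sym2 (Set (Pt m))} (ha : ∀ l, a ∈ EJ p {l})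
    {j k : Fin 3} (hjk : j ≠ k) {c : Sym2 (Set (Pt m))} (hj : c ∈ EJ p {j}) (hk : c ∈ EJ p {k}) :
    c = a := by
  obtain ⟨i1, i2, i3, a', b, h12, h13, h23, h1, h2⟩ := h.exists_inter
  have e1 : ∀ c, c ∈ EJ p {i1} → c ∈ EJ p {i2} → c = a' := fun c hc hc' =>
    mem_singleton.1 (h1.subset (mem_inter.2 ⟨hc, hc'⟩))
  have e2 : ∀ c, c ∈ EJ p {i3} → (c ∈ EJ p {i1} ∨ c ∈ EJ p {i2}) → c = b := fun c hc hc' =>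
    mem_singleton.1 (h2.subset (mem_inter.2 ⟨hc, mem_union.2 hc'⟩))
  have ea := e1 a (ha _) (ha _)
  have eb := e2 a (ha _) (Or.inl (ha _))
  rcases fin_three_cases h12 h13 h23 j with rfl | rfl | rfl <;>
    rcases fin_three_cases h12 h13 h23 k with rfl | rfl | rfl
  · exact absurd rfl hjk
  · rw [ea]; exact e1 c hj hk
  · rw [eb]; exact e2 c hk (Or.inl hj)
  · rw [ea]; exact e1 c hk hj
  · exact absurd rfl hjk
  · rw [eb]; exact e2 c hk (Or.inr hj)
  · rw [eb]; exact e2 c hj (Or.inl hk)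
  · rw [eb]; exact e2 c hj (Or.inr hk)
  · exact absurd rfl hjk

lemma IsTrees.exists_path (h : IsTrees p) (hn : ¬ ∃ a, ∀ l, a ∈ EJ p {l}) :
    ∃ (i j k : Fin 3) (a b : Sym2 (Set (Pt m))), i ≠ j ∧ i ≠ k ∧ j ≠ k ∧ a ≠ b ∧
      EJ p {i} ∩ EJ p {j} = {a} ∧ EJ p {j} ∩ EJ p {k} = {b} ∧ EJ p {i} ∩ EJ p {k} = ∅ := by
  obtain ⟨i, j, k, a, b, hij, hik, hjk, h1, h2⟩ := h.exists_inter
  have hall : ∀ c, c ∈ EJ p {i} → c ∈ EJ p {j} → c ∈ EJ p {k} → False := by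
    intro c hi hj hk
    refine hn ⟨c, fun l => ?_⟩
    rcases fin_three_cases hij hik hjk l with rfl | rfl | rfl <;> assumption
  have ha := mem_inter.1 (h1.symm.subset (mem_singleton_self a))
  have hb := mem_inter.1 (h2.symm.subset (mem_singleton_self b))
  have hab : a ≠ b := by
    rintro rfl
    exact hall a ha.1 ha.2 hb.1
  have key : ∀ {i j : Fin 3} {a : Sym2 (Set (Pt m))}, b ∈ EJ p {j} → b ∉ EJ p {i} →
      EJ p {k} ∩ (EJ p {i} ∪ EJ p {j}) = {b} →
      EJ p {j} ∩ EJ p {k} = {b} ∧ EJ p {i} ∩ EJ p {k} = ∅ := by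
    intro i j a h1 h2 h3
    have h4 : ∀ c, c ∈ EJ p {k} → (c ∈ EJ p {i} ∨ c ∈ EJ p {j}) → c = b := fun c hc hc' =>
      mem_singleton.1 (h3.subset (mem_inter.2 ⟨hc, mem_union.2 hc'⟩))
    constructor
    · refine eq_singleton_iff_unique_mem.2 ⟨mem_inter.2 ⟨h1, hb.1⟩, fun c hc => ?_⟩
      exact h4 c (mem_inter.1 hc).2 (Or.inr (mem_inter.1 hc).1)
    · refine eq_empty_of_forall_notMem fun c hc => h2 ?_
      rw [← h4 c (mem_inter.1 hc).2 (Or.inl (mem_inter.1 hc).1)]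
      exact (mem_inter.1 hc).1
  rcases mem_union.1 hb.2 with hbi | hbj
  · have hbj : b ∉ EJ p {j} := fun hbj => hall b hbi hbj hb.1
    obtain ⟨k1, k2⟩ := key (a := a) hbi hbj (by rw [union_comm]; exact h2)
    exact ⟨j, i, k, a, b, hij.symm, hjk, hik, hab, by rw [inter_comm]; exact h1, k1, k2⟩
  · have hbi : b ∉ EJ p {i} := fun hbi => hall b hbi hbj hb.1
    obtain ⟨k1, k2⟩ := key (a := a) hbj hbi h2
    exact ⟨i, j, k, a, b, hij, hik, hjk, hab, h1, k1, k2⟩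

/-- A pairing of opposite edges on the same circle. -/
structure CirclePairing (p : Setoid (Pt m)) (f : Equiv.Perm (Pt m)) : Prop where
  pairing : IsPairing f
  opp : ∀ z, Opp p z (f z)
  fst : ∀ z, (f z).1 = z.1
  two : ∀ z w : Pt m, en p w = en p z → w.1 = z.1 → w = z ∨ w = f z

lemma IsTrees.exists_circlePairing (h : IsTrees p) : ∃ f, CirclePairing p f := by
  obtain ⟨f, hf, ho, hu, hmem⟩ := exists_pairing (p := p) (lab := fun j => {j})
    (fun _ => rfl) (fun j k hk => by rw [Set.mem_singleton_iff.1 hk]) h.dbl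
  exact ⟨f, hf, ho, hmem, hu⟩

lemma exists_par {f : Equiv.Perm (Pt m)} (hf : CirclePairing p f) {x : Pt m} {j : Fin 3}
    (h : en p x ∈ EJ p {j}) : ∃ y : Pt m, y.1 = j ∧ Par p x y := by
  obtain ⟨y, hy, hxy⟩ := mem_EJ.1 h
  rcases par_or_opp hxy.symm with h1 | h1
  · exact ⟨y, hy, h1⟩
  · exact ⟨f y, (hf.fst y).trans hy, h1.par (hf.opp y)⟩

/-- A connecting pairing moves `x` off its circle, if the class of `x` is the only one where this
circle meets the others. -/
lemma CirclePairing.apply_fst_ne {f g : Equiv.Perm (Pt m)} (hf : CirclePairing p f)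
    (hg : g ∈ Fib p) {x : Pt m}
    (hx : ∀ z w : Pt m, en p w = en p z → z.1 = x.1 → w.1 ≠ x.1 → en p z = en p x) :
    (g x).1 ≠ x.1 := by
  obtain ⟨h1, h2, h3⟩ := hg
  intro e
  have hgx := (hf.two x (g x) (h3 x).en_eq.symm e).resolve_left (h1 x).1
  obtain ⟨z, hz, hz'⟩ := h2 x.1
  have h4 := hx z (g z) (h3 z).en_eq.symm hz hz'
  rcases hf.two x z h4 hz with rfl | rfl
  · exact hz' e
  · rw [h1.eq_apply_comm hgx] at hz'
    exact hz' rfl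

/-- The circles `i` and `k` at the ends meet the rest in one class each. A connecting pairing must
leave them there, and orientation then fixes the pairing on the whole class of four edges. The two
forced switches do not interfere. -/
lemma IsTrees.ncard_of_path (h : IsTrees p) (hn : ¬ ∃ a, ∀ l, a ∈ EJ p {l}) :
    (Fib p).ncard = 1 := by
  obtain ⟨i, j, k, a, b, hij, hik, hjk, hab, ha, hb, hc⟩ := h.exists_path hn
  obtain ⟨f, hf⟩ := h.exists_circlePairing
  have hij' : ∀ z w : Pt m, z.1 = i → w.1 = j → en p z = en p w → en p z = a := fun z w hz hw e =>
    mem_singleton.1 (ha.subset (mem_inter.2 ⟨mem_EJ.2 ⟨z, hz, rfl⟩, mem_EJ.2 ⟨w, hw, e.symm⟩⟩))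
  have hjk' : ∀ z w : Pt m, z.1 = j → w.1 = k → en p z = en p w → en p z = b := fun z w hz hw e =>
    mem_singleton.1 (hb.subset (mem_inter.2 ⟨mem_EJ.2 ⟨z, hz, rfl⟩, mem_EJ.2 ⟨w, hw, e.symm⟩⟩))
  have hik' : ∀ z w : Pt m, z.1 = i → w.1 = k → en p z ≠ en p w := fun z w hz hw e =>
    notMem_empty _
      (hc.subset (mem_inter.2 ⟨mem_EJ.2 ⟨z, hz, rfl⟩, mem_EJ.2 ⟨w, hw, e.symm⟩⟩))
  obtain ⟨ha1, ha2⟩ := mem_inter.1 (ha.symm.subset (mem_singleton_self a))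
  obtain ⟨hb1, hb2⟩ := mem_inter.1 (hb.symm.subset (mem_singleton_self b))
  obtain ⟨x, hx, rfl⟩ := mem_EJ.1 ha1
  obtain ⟨y, hy, hxy⟩ := exists_par hf ha2
  obtain ⟨w, hw, rfl⟩ := mem_EJ.1 hb2
  obtain ⟨z, hz, hwz⟩ := exists_par hf hb1
  replace hx : x.1 = i := hx
  replace hw : w.1 = k := hw
  have hfour1 : ∀ u, en p u = en p x → u = x ∨ u = f x ∨ u = y ∨ u = f y := by
    intro u hu
    rcases fin_three_cases hij hik hjk u.1 with e | e | e
    · rcases hf.two x u hu (e.trans hx.symm) with e | e <;> simp [e]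
    · rcases hf.two y u (hu.trans hxy.en_eq) (e.trans hy.symm) with e | e <;> simp [e]
    · exact absurd hu.symm (hik' x u hx e)
  have hfour2 : ∀ u, en p u = en p w → u = w ∨ u = f w ∨ u = z ∨ u = f z := by
    intro u hu
    rcases fin_three_cases hij hik hjk u.1 with e | e | e
    · exact absurd hu (hik' u w e hw)
    · rcases hf.two z u (hu.trans hwz.en_eq) (e.trans hz.symm) with e | e <;> simp [e]
    · rcases hf.two w u hu (e.trans hw.symm) with e | e <;> simp [e]
  have hout : ∀ u v, en p v = en p u → en p u ≠ en p x → en p u ≠ en p w → v = u ∨ v = f u := by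
    intro u v huv h1 h2
    by_cases e : v.1 = u.1
    · exact hf.two u v huv e
    exfalso
    rcases fin_three_cases hij hik hjk u.1 with eu | eu | eu <;>
      rcases fin_three_cases hij hik hjk v.1 with ev | ev | ev
    · exact e (ev.trans eu.symm)
    · exact h1 (hij' u v eu ev huv.symm)
    · exact hik' u v eu ev huv.symm
    · exact h1 (huv.symm.trans (hij' v u ev eu huv))
    · exact e (ev.trans eu.symm)
    · exact h2 (hjk' u v eu ev huv.symm)
    · exact hik' v u ev eu huv
    · exact h2 (huv.symm.trans (hjk' v u ev eu huv))
    · exact e (ev.trans eu.symm)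
  have hyx : y ≠ x := by rintro rfl; exact hij (hx.symm.trans hy)
  have hyfx : y ≠ f x := by
    rintro rfl; rw [hf.fst] at hy; exact hij (hx.symm.trans hy)
  have hzw : z ≠ w := by rintro rfl; exact hjk (hz.symm.trans hw)
  have hzfw : z ≠ f w := by
    rintro rfl; rw [hf.fst] at hz; exact hjk (hz.symm.trans hw)
  have hgx : ∀ g ∈ Fib p, g x = f y := by
    intro g hg
    have hne := hf.apply_fst_ne hg (x := x) (by
      intro u v huv hu hv
      rw [hx] at hu hv
      rcases fin_three_cases hij hik hjk v.1 with ev | ev | ev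
      · exact absurd ev hv
      · exact hij' u v hu ev huv.symm
      · exact absurd huv.symm (hik' u v hu ev))
    rcases hfour1 (g x) (hg.2.2 x).en_eq.symm with e | e | e | e
    · exact absurd e (hg.1 x).1
    · rw [e] at hne; exact absurd (hf.fst x) hne
    · exact absurd (e ▸ hg.2.2 x) (hxy.not_opp (h.not_isDiag (mem_EJ_univ ha1)))
    · exact e
  have hgw : ∀ g ∈ Fib p, g w = f z := by
    intro g hg
    have hne := hf.apply_fst_ne hg (x := w) (by
      intro u v huv hu hv
      rw [hw] at hu hv
      rcases fin_three_cases hij hik hjk v.1 with ev | ev | ev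
      · exact absurd huv (hik' v u ev hu)
      · exact huv.symm.trans (hjk' v u ev hu huv)
      · exact absurd ev hv)
    rcases hfour2 (g w) (hg.2.2 w).en_eq.symm with e | e | e | e
    · exact absurd e (hg.1 w).1
    · rw [e] at hne; exact absurd (hf.fst w) hne
    · exact absurd (e ▸ hg.2.2 w) (hwz.not_opp (h.not_isDiag (mem_EJ_univ hb2)))
    · exact e
  rw [Set.ncard_eq_one, Set.exists_eq_singleton_iff_nonempty_subsingleton]
  constructor
  -- Existence: switch in the class of `x`, then in the class of `w`; the classes are disjoint, so
  -- the second switch leaves the first intact.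
  · have hf1 := hf.pairing.switch x y
    have ho1 := opp_switch hf.opp hxy
    have hne : ∀ {u v : Pt m}, en p u = en p x → en p v = en p w → u ≠ v := by
      rintro u v h1 h2 rfl
      exact hab (h1.symm.trans h2)
    have hfx := (hf.opp x).en_eq.symm
    have hfy := (hf.opp y).en_eq.symm.trans hxy.en_eq.symm
    have hfw := (hf.opp w).en_eq.symm
    have hfz := (hf.opp z).en_eq.symm.trans hwz.en_eq.symm
    have g1w : switch f x y w = f w := switch_of_ne (hne rfl rfl).symm
      (hne hxy.en_eq.symm rfl).symm (hne rfl hfw).symm (hne hxy.en_eq.symm hfw).symm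
    have g1z : switch f x y z = f z := switch_of_ne (hne rfl hwz.en_eq.symm).symm
      (hne hxy.en_eq.symm hwz.en_eq.symm).symm (hne rfl hfz).symm (hne hxy.en_eq.symm hfz).symm
    have hzg : z ≠ switch f x y w := by rw [g1w]; exact hzfw
    have g2w : switch (switch f x y) w z w = f z := by rw [switch_left hf1 hzg, g1z]
    have g1x : switch f x y x = f y := switch_left hf.pairing hyfx
    have g1y : switch f x y y = f x := switch_right hf.pairing hyfx
    have g2x : switch (switch f x y) w z x = f y := by
      rw [switch_of_ne, g1x]
      · exact hne rfl rfl
      · exact hne rfl hwz.en_eq.symm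
      · rw [g1x]; exact hne hfy rfl
      · rw [g1x]; exact hne hfy hwz.en_eq.symm
    have g2y : switch (switch f x y) w z y = f x := by
      rw [switch_of_ne, g1y]
      · exact hne hxy.en_eq.symm rfl
      · exact hne hxy.en_eq.symm hwz.en_eq.symm
      · rw [g1y]; exact hne hfx rfl
      · rw [g1y]; exact hne hfx hwz.en_eq.symm
    refine ⟨switch (switch f x y) w z, hf1.switch w z, fun l => ?_, opp_switch ho1 hwz⟩
    rcases fin_three_cases hij hik hjk l with rfl | rfl | rfl
    · exact ⟨x, hx, by rw [g2x, hf.fst, hy]; exact hij.symm⟩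
    · exact ⟨y, hy, by rw [g2y, hf.fst, hx]; exact hij⟩
    · exact ⟨w, hw, by rw [g2w, hf.fst, hz]; exact hjk⟩
  · intro g hg g' hg'
    obtain ⟨a1, a2, a3⟩ := eq_of_four hf.pairing hg.1 hg.2.2 hyx hxy.en_eq.symm hfour1 (hgx g hg)
    obtain ⟨b1, b2, b3⟩ := eq_of_four hf.pairing hg'.1 hg'.2.2 hyx hxy.en_eq.symm hfour1
      (hgx g' hg')
    obtain ⟨c1, c2, c3⟩ := eq_of_four hf.pairing hg.1 hg.2.2 hzw hwz.en_eq.symm hfour2 (hgw g hg)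
    obtain ⟨d1, d2, d3⟩ := eq_of_four hf.pairing hg'.1 hg'.2.2 hzw hwz.en_eq.symm hfour2
      (hgw g' hg')
    ext1 u
    by_cases h1 : en p u = en p x
    · rcases hfour1 u h1 with rfl | rfl | rfl | rfl
      · rw [hgx g hg, hgx g' hg']
      · rw [a2, b2]
      · rw [a1, b1]
      · rw [a3, b3]
    by_cases h2 : en p u = en p w
    · rcases hfour2 u h2 with rfl | rfl | rfl | rfl
      · rw [hgw g hg, hgw g' hg']
      · rw [c2, d2]
      · rw [c1, d1]
      · rw [c3, d3]
    rw [(hout u (g u) (hg.2.2 u).en_eq.symm h1 h2).resolve_left (hg.1 u).1,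
      (hout u (g' u) (hg'.2.2 u).en_eq.symm h1 h2).resolve_left (hg'.1 u).1]

/-- The common class consists of parallel edges `x l`, one on each circle, and their partners `f (x
l)`. A pairing of opposite edges sends `x l` to `f (x (τ l))`, and connecting all circles makes τ a
permutation without fixed points. On three letters these are the two rotations. -/
lemma IsTrees.ncard_of_common (h : IsTrees p) {a : Sym2 (Set (Pt m))} (ha : ∀ l, a ∈ EJ p {l}) :
    (Fib p).ncard = 2 := by
  obtain ⟨f, hf⟩ := h.exists_circlePairing
  obtain ⟨x0, hx0, rfl⟩ := mem_EJ.1 (ha 0)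
  choose x hx hpar0 using fun l => exists_par hf (ha l)
  have hpar : ∀ l l', Par p (x l) (x l') := fun l l' => (hpar0 l).symm.trans (hpar0 l')
  have hd : ∀ l, ¬ (en p (x l)).IsDiag := fun l => by
    rw [← (hpar0 l).en_eq]; exact h.not_isDiag (mem_EJ_univ (ha 0))
  have hinj : ∀ {l l'}, x l = x l' → l = l' := fun {l l'} e => by rw [← hx l, e, hx l']
  have hxf : ∀ l l', x l ≠ f (x l') := fun l l' e => by
    have := hf.opp (x l')
    rw [← e] at this
    exact (hpar l' l).not_opp (hd l') this
  have hcls : ∀ u, en p u = en p x0 → ∃ l, u = x l ∨ u = f (x l) := fun u hu =>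
    ⟨u.1, hf.two (x u.1) u (hu.trans (hpar0 _).en_eq) (hx u.1).symm⟩
  have hout : ∀ u v, en p v = en p u → en p u ≠ en p x0 → v = u ∨ v = f u := by
    intro u v huv h1
    refine hf.two u v huv ?_
    by_contra e
    exact h1 (h.common_unique ha e (mem_EJ.2 ⟨v, rfl, huv⟩) (mem_EJ.2 ⟨u, rfl, rfl⟩))
  have hg : ∀ g ∈ Fib p, ∃ τ : Fin 3 → Fin 3, (∀ l, g (x l) = f (x (τ l))) ∧
      (∀ l, τ l ≠ l) ∧ Function.Injective τ := by
    intro g hg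
    have h1 : ∀ l, ∃ l', g (x l) = f (x l') := by
      intro l
      obtain ⟨l', e | e⟩ := hcls (g (x l)) ((hg.2.2 _).en_eq.symm.trans (hpar0 l).en_eq.symm)
      · have := hg.2.2 (x l)
        rw [e] at this
        exact absurd this ((hpar l l').not_opp (hd l))
      · exact ⟨l', e⟩
    choose τ hτ using h1
    refine ⟨τ, hτ, fun l e => ?_, fun l l' e => ?_⟩
    · refine hf.apply_fst_ne hg (x := x l) ?_ (by rw [hτ, e, hf.fst])
      intro u v huv hu hv
      rw [← (hpar0 l).en_eq]
      exact h.common_unique ha (Ne.symm (hu ▸ hv)) (mem_EJ.2 ⟨u, rfl, rfl⟩)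
        (mem_EJ.2 ⟨v, rfl, huv⟩)
    · refine hinj (g.injective ?_)
      rw [hτ, hτ, e]
  have hext : ∀ g ∈ Fib p, ∀ g' ∈ Fib p, (∀ l, g (x l) = g' (x l)) → g = g' := by
    intro g h1 g' h2 e
    obtain ⟨τ, hτ, -, hτi⟩ := hg g h1
    ext1 u
    by_cases hu : en p u = en p x0
    · obtain ⟨l, rfl | rfl⟩ := hcls u hu
      · exact e l
      · obtain ⟨l', rfl⟩ := (Finite.injective_iff_surjective.1 hτi) l
        rw [h1.1.eq_apply_comm (hτ l'), h2.1.eq_apply_comm ((e l').symm.trans (hτ l'))]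
    · rw [(hout u (g u) (h1.2.2 u).en_eq.symm hu).resolve_left (h1.1 u).1,
        (hout u (g' u) (h2.2.2 u).en_eq.symm hu).resolve_left (h2.1 u).1]
  have hder : ∀ τ : Fin 3 → Fin 3, (∀ l, τ l ≠ l) → Function.Injective τ →
      (∀ l, τ l = l + 1) ∨ ∀ l, τ l = l + 2 := by decide
  have hex : ∃ g ∈ Fib p, ∀ l, g (x l) = f (x (l + 1)) := by
    have hf1 := hf.pairing.switch (x 0) (x 1)
    have n : ∀ {l l'}, l ≠ l' → x l ≠ x l' := fun h e => h (hinj e)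
    have s0 : switch f (x 0) (x 1) (x 0) = f (x 1) := switch_left hf.pairing (hxf 1 0)
    have s1 : switch f (x 0) (x 1) (x 1) = f (x 0) := switch_right hf.pairing (hxf 1 0)
    have s2 : switch f (x 0) (x 1) (x 2) = f (x 2) :=
      switch_of_ne (n (by decide)) (n (by decide)) (hxf _ _).symm (hxf _ _).symm
    have h21 : x 2 ≠ switch f (x 0) (x 1) (x 1) := by rw [s1]; exact hxf _ _
    have t1 : switch (switch f (x 0) (x 1)) (x 1) (x 2) (x 1) = f (x 2) := by
      rw [switch_left hf1 h21, s2]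
    have t2 : switch (switch f (x 0) (x 1)) (x 1) (x 2) (x 2) = f (x 0) := by
      rw [switch_right hf1 h21, s1]
    have t0 : switch (switch f (x 0) (x 1)) (x 1) (x 2) (x 0) = f (x 1) := by
      rw [switch_of_ne (n (by decide)) (n (by decide)), s0] <;> rw [s0] <;> exact (hxf _ _).symm
    have ht : ∀ l, switch (switch f (x 0) (x 1)) (x 1) (x 2) (x l) = f (x (l + 1)) := by
      intro l
      fin_cases l
      exacts [t0, t1, t2]
    refine ⟨switch (switch f (x 0) (x 1)) (x 1) (x 2), ⟨hf1.switch _ _, fun l => ⟨x l, hx l, ?_⟩,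
      opp_switch (opp_switch hf.opp (hpar 0 1)) (hpar 1 2)⟩, ht⟩
    rw [ht, hf.fst, hx]
    revert l; decide
  obtain ⟨g, hgF, hgx⟩ := hex
  -- Conjugating by `f` exchanges each `x l` with its partner and thereby inverts the rotation.
  have hgx' : ∀ l, (f * g * f) (x (l + 1)) = f (x l) := by
    intro l
    rw [Equiv.Perm.mul_apply, Equiv.Perm.mul_apply, hgF.1.eq_apply_comm (hgx l)]
  have hfgf : f * g * f ∈ Fib p := by
    have hop : ∀ z, Opp p z ((f * g * f) z) := fun z =>
      ((hf.opp z).par (hgF.2.2 (f z))).opp (hf.opp (g (f z)))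
    have hpr : IsPairing (f * g * f) := by
      intro z
      simp only [Equiv.Perm.mul_apply]
      rw [(hf.pairing _).2, (hgF.1 _).2, (hf.pairing _).2]
      exact ⟨fun e => (hgF.1 (f z)).1 (hf.pairing.eq_apply_comm e).symm, rfl⟩
    refine ⟨hpr, fun l => ⟨x l, hx l, ?_⟩, hop⟩
    have := hgx' (l + 2)
    rw [add_assoc, show (2 + 1 : Fin 3) = 0 from rfl, add_zero] at this
    rw [this, hf.fst, hx]
    clear this
    revert l; decide
  have hfx2 : ∀ l, (f * g * f) (x l) = f (x (l + 2)) := by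
    intro l
    have := hgx' (l + 2)
    rwa [add_assoc, show (2 + 1 : Fin 3) = 0 from rfl, add_zero] at this
  rw [Set.ncard_eq_two]
  refine ⟨g, f * g * f, fun e => ?_, Set.ext fun g' => ⟨fun hg' => ?_, ?_⟩⟩
  · have h1 := hgx 0
    rw [e, hfx2] at h1
    exact absurd (hinj (f.injective h1)) (by decide)
  · obtain ⟨τ, hτ, h1, h2⟩ := hg g' hg'
    rcases hder τ h1 h2 with h3 | h3
    · exact Or.inl (hext g' hg' g hgF fun l => by rw [hτ, h3, hgx])
    · exact Or.inr (hext g' hg' _ hfgf fun l => by rw [hτ, h3, hfx2])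
  · rintro (rfl | rfl)
    exacts [hgF, hfgf]

/-! ### Graphs and their numbers of vertices and edges -/

namespace UGraph

variable {α : Type*} {G : UGraph α}

lemma map_mem_edges {e : Sym2 G.verts} (he : e ∈ G.toSimple.edgeSet) :
    Sym2.map Subtype.val e ∈ G.edges ∧ ¬ (Sym2.map Subtype.val e).IsDiag := by
  induction e with
  | h u v =>
    rw [SimpleGraph.mem_edgeSet] at he
    exact ⟨he.2, fun h => he.1 (Subtype.ext (Sym2.mk_isDiag_iff.1 h))⟩

lemma card_edgeSet_toSimple :
    Nat.card G.toSimple.edgeSet = {e | e ∈ G.edges ∧ ¬ e.IsDiag}.ncard := by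
  rw [Nat.card_coe_set_eq,
    ← Set.ncard_image_of_injective _ (Sym2.map.injective (Subtype.val_injective (p := (· ∈ G.verts))))]
  congr 1
  ext e
  constructor
  · rintro ⟨e, he, rfl⟩
    exact map_mem_edges he
  · rintro ⟨he, hd⟩
    induction e with
    | h u v =>
      refine ⟨s(⟨u, G.incidence _ he u (Sym2.mem_mk_left u v)⟩,
        ⟨v, G.incidence _ he v (Sym2.mem_mk_right u v)⟩), ?_, rfl⟩
      rw [SimpleGraph.mem_edgeSet]
      exact ⟨fun h => hd (Sym2.mk_isDiag_iff.2 (congrArg Subtype.val h)), he⟩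

lemma isTree_iff (hf : G.verts.Finite) : G.IsTree ↔
    (∀ e ∈ G.edges, ¬ e.IsDiag) ∧ G.Connected ∧ G.edges.ncard + 1 = G.verts.ncard := by
  have := hf.to_subtype
  refine and_congr_right fun h => ?_
  rw [SimpleGraph.isTree_iff_connected_and_card, card_edgeSet_toSimple, Nat.card_coe_set_eq]
  have : {e | e ∈ G.edges ∧ ¬ e.IsDiag} = G.edges := by
    ext e; exact ⟨fun he => he.1, fun he => ⟨he, h e he⟩⟩
  rw [this]
  rfl

/-- The loop at `v` as a graph. -/
def loop (v : α) : UGraph α where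
  verts := {v}
  edges := {s(v, v)}
  incidence := by
    rintro e rfl w hw
    simpa using hw

lemma isCircuit_loop {v : α} (h : s(v, v) ∈ G.edges) : (loop v).IsCircuit G := by
  refine ⟨?_, ?_, ?_, ?_⟩
  · rintro w rfl; exact G.incidence _ h _ (Sym2.mem_mk_left _ _)
  · rintro e rfl; exact h
  · have hs : Subsingleton (loop v).verts := by
      unfold loop; infer_instance
    have hn : Nonempty (loop v).verts := ⟨⟨v, rfl⟩⟩
    exact SimpleGraph.Connected.mk (SimpleGraph.Preconnected.of_subsingleton)
  · rintro w rfl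
    have h1 : {e | e ∈ (loop w).edges ∧ w ∈ e ∧ ¬ e.IsDiag} = ∅ := by
      ext e
      simp only [loop, Set.mem_singleton_iff, Set.mem_ofPred_eq, Set.mem_empty_iff_false, iff_false]
      rintro ⟨rfl, -, h⟩
      exact h rfl
    have h2 : {e | e ∈ (loop w).edges ∧ w ∈ e ∧ e.IsDiag} = {s(w, w)} := by
      ext e
      simp only [loop, Set.mem_singleton_iff, Set.mem_ofPred_eq]
      constructor
      · rintro ⟨h, -⟩; exact h
      · rintro rfl; exact ⟨rfl, Sym2.mem_mk_left _ _, rfl⟩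
    rw [degree, h1, h2]
    simp

/-- A subgraph of the simple graph of `G` as a graph. -/
def ofSubgraph (H : G.toSimple.Subgraph) : UGraph α where
  verts := Subtype.val '' H.verts
  edges := Sym2.map Subtype.val '' H.edgeSet
  incidence := by
    rintro _ ⟨e, he, rfl⟩ v hv
    obtain ⟨w, hw, rfl⟩ := Sym2.mem_map.1 hv
    exact ⟨w, H.mem_verts_of_mem_edge he hw, rfl⟩

lemma isCircuit_ofSubgraph {H : G.toSimple.Subgraph} (hc : H.Connected)
    (hd : ∀ v ∈ H.verts, (H.neighborSet v).ncard = 2) : (ofSubgraph H).IsCircuit G := by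
  have hedge : ∀ e ∈ (ofSubgraph H).edges, e ∈ G.edges ∧ ¬ e.IsDiag := by
    rintro _ ⟨e, he, rfl⟩
    exact map_mem_edges (H.edgeSet_subset he)
  refine ⟨?_, fun e he => (hedge e he).1, ?_, ?_⟩
  · rintro _ ⟨v, -, rfl⟩; exact v.2
  · let φ : H.coe →g (ofSubgraph H).toSimple :=
      { toFun := fun v => ⟨v.1.1, v.1, v.2, rfl⟩
        map_rel' := by
          rintro v w h
          rw [SimpleGraph.Subgraph.coe_adj] at h
          refine ⟨fun e => ?_, s(v.1, w.1), h, rfl⟩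
          have e' : (v.1.1 : α) = w.1.1 :=
            congrArg (fun z : (ofSubgraph H).verts => (z : α)) e
          exact h.ne (Subtype.ext e') }
    have hφ : Function.Surjective φ := by
      rintro ⟨_, v, hv, rfl⟩
      exact ⟨⟨v, hv⟩, rfl⟩
    exact hc.coe.map φ hφ
  · rintro _ ⟨v, hv, rfl⟩
    have h1 : {e | e ∈ (ofSubgraph H).edges ∧ (v : α) ∈ e ∧ e.IsDiag} = ∅ := by
      ext e
      simp only [Set.mem_ofPred_eq, Set.mem_empty_iff_false, iff_false]
      rintro ⟨h, -, h'⟩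
      exact (hedge e h).2 h'
    have h2 : {e | e ∈ (ofSubgraph H).edges ∧ (v : α) ∈ e ∧ ¬ e.IsDiag}
        = (fun w : G.verts => s((v : α), (w : α))) '' H.neighborSet v := by
      ext e
      constructor
      · rintro ⟨⟨e, he, rfl⟩, hv', -⟩
        obtain ⟨w, hw, hwv⟩ := Sym2.mem_map.1 hv'
        obtain rfl : w = v := Subtype.ext hwv
        obtain ⟨u, rfl⟩ := hw
        exact ⟨u, he, rfl⟩
      · rintro ⟨w, hw, rfl⟩
        have hm : s((v : α), (w : α)) ∈ (ofSubgraph H).edges := ⟨s(v, w), hw, rfl⟩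
        exact ⟨hm, Sym2.mem_mk_left _ _, (hedge _ hm).2⟩
    rw [degree, h1, h2, Set.ncard_empty, mul_zero, add_zero, Set.ncard_image_of_injective, hd v hv]
    intro w w' h
    exact Subtype.ext (Sym2.congr_right.1 h)

/-- Either some loop is a circuit, or the graph is simple and has too many edges for a tree, so it
contains a cycle. -/
lemma IsUnicircuit.exists_circuit (hf : G.verts.Finite) (h : G.IsUnicircuit) :
    ∃ C : UGraph α, C.IsCircuit G ∧ C.edges.Nonempty := by
  by_cases hl : ∃ e ∈ G.edges, e.IsDiag
  · obtain ⟨e, he, hd⟩ := hl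
    induction e with
    | h u v =>
      obtain rfl : u = v := Sym2.mk_isDiag_iff.1 hd
      exact ⟨loop u, isCircuit_loop he, ⟨_, rfl⟩⟩
  · push Not at hl
    have hac : ¬ G.toSimple.IsAcyclic := by
      intro hac
      have := ((isTree_iff hf).1 ⟨hl, ⟨h.1, hac⟩⟩).2.2
      have := h.2
      omega
    unfold SimpleGraph.IsAcyclic at hac
    push Not at hac
    obtain ⟨v, c, hc⟩ := hac
    refine ⟨ofSubgraph c.toSubgraph, isCircuit_ofSubgraph c.toSubgraph_connected ?_, ?_⟩
    · intro w hw
      exact hc.ncard_neighborSet_toSubgraph_eq_two (by simpa using hw)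
    · refine Set.Nonempty.image _ ?_
      rw [SimpleGraph.Walk.edgeSet_toSubgraph]
      obtain ⟨e, he⟩ := List.exists_mem_of_ne_nil c.edges (by
        intro h0
        have := hc.three_le_length
        rw [← SimpleGraph.Walk.length_edges, h0] at this
        simp at this)
      exact ⟨e, he⟩

/-- The edge space of a circuit is orthogonal to the coboundaries modulo two. -/
lemma IsCircuit.sum_eq_zero {C : UGraph α} [DecidableEq α] (h : C.IsCircuit G)
    {Vs : Finset α} {Es : Finset (Sym2 α)} (hV : G.verts = ↑Vs) (hE : G.edges = ↑Es)
    (f : α → ZMod 2) : ∑ a ∈ Es, (if a ∈ C.edges then 1 else 0) * dl f a = 0 := by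
  have hinc : ∀ a ∈ Es, ∀ v ∈ a, v ∈ Vs := by
    intro a ha v hv
    have : v ∈ G.verts := G.incidence a (by rw [hE]; exact ha) v hv
    rwa [hV] at this
  -- Modulo 2 the difference along an edge is the sum over its ends, so the total can be collected
  -- vertex by vertex.
  have h1 : ∀ a ∈ Es, dl f a = ∑ v ∈ Vs, if v ∈ a ∧ ¬ a.IsDiag then f v else 0 := by
    intro a ha
    by_cases hd : a.IsDiag
    · rw [dl_eq_zero_of_isDiag f hd]
      simp [hd]
    · rw [← sum_filter]
      have hne : (Quot.out a).1 ≠ (Quot.out a).2 := by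
        rwa [← sym2_out_eq a, Sym2.mk_isDiag_iff] at hd
      have : ({v ∈ Vs | v ∈ a ∧ ¬ a.IsDiag} : Finset α) = {(Quot.out a).1, (Quot.out a).2} := by
        ext v
        simp only [mem_filter, mem_insert, mem_singleton, hd, not_false_eq_true, and_true]
        rw [← Sym2.mem_iff, sym2_out_eq]
        exact ⟨fun hv => hv.2, fun hv => ⟨hinc a ha v hv, hv⟩⟩
      rw [this, sum_pair hne, dl, CharTwo.sub_eq_add]
  rw [sum_congr rfl fun a ha => by rw [h1 a ha, mul_sum]]
  rw [sum_comm]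
  refine Finset.sum_eq_zero fun v _ => ?_
  have h2 : ∀ a ∈ Es, (if a ∈ C.edges then (1 : ZMod 2) else 0)
      * (if v ∈ a ∧ ¬ a.IsDiag then f v else 0)
      = if a ∈ C.edges ∧ v ∈ a ∧ ¬ a.IsDiag then f v else 0 := by
    intro a _
    by_cases k1 : a ∈ C.edges <;> simp [k1]
  rw [sum_congr rfl h2, ← sum_filter, sum_const, nsmul_eq_mul]
  have h3 : {e | e ∈ C.edges ∧ v ∈ e ∧ ¬ e.IsDiag}
      = ↑({a ∈ Es | a ∈ C.edges ∧ v ∈ a ∧ ¬ a.IsDiag} : Finset (Sym2 α)) := by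
    ext e
    simp only [Set.mem_ofPred_eq, coe_filter]
    refine ⟨fun k => ⟨?_, k⟩, fun k => k.2⟩
    have : e ∈ G.edges := h.2.1 k.1
    rwa [hE] at this
  -- The degree is two and loops contribute two each, so the number of other edges at `v` is even.
  have h4 : Even #({a ∈ Es | a ∈ C.edges ∧ v ∈ a ∧ ¬ a.IsDiag} : Finset (Sym2 α)) := by
    rw [← Set.ncard_coe_finset, ← h3]
    by_cases hv : v ∈ C.verts
    · have := h.2.2.2 v hv
      unfold degree at this
      rw [Nat.even_iff]
      omega
    · have : {e | e ∈ C.edges ∧ v ∈ e ∧ ¬ e.IsDiag} = ∅ := by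
        ext e
        simp only [Set.mem_ofPred_eq, Set.mem_empty_iff_false, iff_false]
        rintro ⟨k1, k2, -⟩
        exact hv (C.incidence e k1 v k2)
      rw [this]; simp
  rw [(ZMod.natCast_eq_zero_iff_even).2 h4, zero_mul]

end UGraph

/-! ### The types of graphs -/

/-- Only the edges that are not loops are required in `G`, so that the lemma also covers graphs
whose loops have been removed. -/
lemma connected_of_conn {J : Set (Fin 3)} (h : Conn p J) (hne : ∃ x : Pt m, x.1 ∈ J)
    {G : UGraph (Set (Pt m))} (hV : G.verts = ↑(VJ p J))
    (hE : ∀ a ∈ EJ p J, ¬ a.IsDiag → a ∈ G.edges) : G.Connected := by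
  obtain ⟨x, hx⟩ := hne
  have hmem : ∀ y : Pt m, y.1 ∈ J → block p y ∈ G.verts := fun y hy => by
    rw [hV]; exact mem_VJ.2 ⟨y, hy, rfl⟩
  have key : ∀ y : Pt m, ∀ hy : y.1 ∈ J,
      G.toSimple.Reachable ⟨block p x, hmem x hx⟩ ⟨block p y, hmem y hy⟩ := by
    intro y hy
    obtain ⟨h1, h2⟩ := h (fun B => ∃ hB : B ∈ G.verts,
      G.toSimple.Reachable ⟨block p x, hmem x hx⟩ ⟨B, hB⟩) (by
        intro z hz
        by_cases hd : block p (gam m z) = block p z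
        · simp only [hd]
        · have hadj : G.toSimple.Adj ⟨block p (gam m z), hmem _ hz⟩ ⟨block p z, hmem z hz⟩ :=
            ⟨fun e => hd (congrArg Subtype.val e),
              hE (en p z) (mem_EJ.2 ⟨z, hz, rfl⟩) (fun h => hd (en_isDiag_iff.1 h))⟩
          exact ⟨fun ⟨_, k⟩ => ⟨hmem z hz, k.trans hadj.reachable⟩,
            fun ⟨_, k⟩ => ⟨hmem _ hz, k.trans hadj.symm.reachable⟩⟩)
      x y hx hy ⟨hmem x hx, SimpleGraph.Reachable.refl _⟩
    exact h2
  have : Nonempty G.verts := ⟨⟨block p x, hmem x hx⟩⟩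
  refine SimpleGraph.Connected.mk fun B B' => ?_
  obtain ⟨B, hB⟩ := B
  obtain ⟨B', hB'⟩ := B'
  have k := hB
  have k' := hB'
  rw [hV] at k k'
  obtain ⟨y, hy, rfl⟩ := mem_VJ.1 k
  obtain ⟨y', hy', rfl⟩ := mem_VJ.1 k'
  exact (key y hy).symm.trans (key y' hy')

lemma elem_verts (p : Setoid (Pt m)) (J : Set (Fin 3)) : (TOn p J).elem.verts = ↑(VJ p J) :=
  coe_VJ p J

lemma finite_verts (p : Setoid (Pt m)) (J : Set (Fin 3)) : (TOn p J).elem.verts.Finite := by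
  rw [elem_verts]; exact finite_toSet _

lemma isDoubleTree_iff (hm : ∀ j, 0 < m j) {j : Fin 3} : (TOn p {j}).IsDoubleTree ↔
    (∀ a ∈ EJ p {j}, ¬ a.IsDiag) ∧ #(EJ p {j}) + 1 = #(VJ p {j}) ∧ (TOn p {j}).AllDouble := by
  unfold OGraph.IsDoubleTree
  rw [UGraph.isTree_iff (finite_verts p _), elem_verts, coe_EJ, Set.ncard_coe_finset,
    Set.ncard_coe_finset]
  have hc : (TOn p {j}).elem.Connected :=
    connected_of_conn (conn_singleton p j) ⟨⟨j, ⟨0, hm j⟩⟩, rfl⟩ (elem_verts p _)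
      (fun a ha _ => by rw [coe_EJ]; exact ha)
  constructor
  · rintro ⟨⟨h1, -, h2⟩, h3⟩; exact ⟨h1, h2, h3⟩
  · rintro ⟨h1, h2, h3⟩; exact ⟨⟨h1, hc, h2⟩, h3⟩

lemma coe_ends_eq {β : Type*} [DecidableEq β] (a : Sym2 β) :
    {v | v ∈ a} = ↑({(Quot.out a).1, (Quot.out a).2} : Finset β) := by
  ext v
  rw [coe_insert, coe_singleton]
  conv_lhs => rw [← sym2_out_eq a]
  exact Sym2.mem_iff

lemma card_ends {β : Type*} [DecidableEq β] {a : Sym2 β} (hd : ¬ a.IsDiag) :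
    #({(Quot.out a).1, (Quot.out a).2} : Finset β) = 2 :=
  card_pair (by rwa [← sym2_out_eq a, Sym2.mk_isDiag_iff] at hd)

lemma ends_subset {J J' : Set (Fin 3)} {a : Sym2 (Set (Pt m))} (ha : a ∈ EJ p J)
    (ha' : a ∈ EJ p J') :
    ({(Quot.out a).1, (Quot.out a).2} : Finset (Set (Pt m))) ⊆ VJ p J ∩ VJ p J' := by
  intro v hv
  have : v ∈ a := by
    rw [← sym2_out_eq a]
    rw [mem_insert, mem_singleton] at hv
    exact Sym2.mem_iff.2 hv
  exact mem_inter.2 ⟨mem_VJ_of_mem_EJ ha this, mem_VJ_of_mem_EJ ha' this⟩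

lemma two_le_card_inter {J J' : Set (Fin 3)} {a : Sym2 (Set (Pt m))} (hd : ¬ a.IsDiag)
    (ha : a ∈ EJ p J) (ha' : a ∈ EJ p J') : 2 ≤ #(VJ p J ∩ VJ p J') := by
  rw [← card_ends hd]
  exact card_le_card (ends_subset ha ha')

lemma inter_eq_ends {J J' : Set (Fin 3)} {a : Sym2 (Set (Pt m))} (hd : ¬ a.IsDiag)
    (ha : a ∈ EJ p J) (ha' : a ∈ EJ p J') (h : #(VJ p J ∩ VJ p J') ≤ 2) :
    (↑(VJ p J) ∩ ↑(VJ p J') : Set (Set (Pt m))) = {v | v ∈ a} := by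
  rw [← coe_inter, coe_ends_eq, coe_inj]
  exact (eq_of_subset_of_card_le (ends_subset ha ha') (by rw [card_ends hd]; exact h)).symm

lemma card_inter_of_eq_ends {J J' : Set (Fin 3)} {a : Sym2 (Set (Pt m))} (hd : ¬ a.IsDiag)
    (h : (↑(VJ p J) ∩ ↑(VJ p J') : Set (Set (Pt m))) = {v | v ∈ a}) :
    #(VJ p J ∩ VJ p J') = 2 := by
  rw [← coe_inter, coe_ends_eq, coe_inj] at h
  rw [h, card_ends hd]

lemma joined_iff {J J' : Set (Fin 3)} {a : Sym2 (Set (Pt m))} :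
    (TOn p J).elem.JoinedAlongEdge (TOn p J').elem a ↔ EJ p J ∩ EJ p J' = {a} ∧
      (↑(VJ p J) ∩ ↑(VJ p J') : Set (Set (Pt m))) = {v | v ∈ a} := by
  unfold UGraph.JoinedAlongEdge
  rw [coe_EJ, coe_EJ, elem_verts, elem_verts, ← coe_inter, ← coe_singleton, coe_inj]

lemma union_joined_iff {J J' J'' : Set (Fin 3)} {a : Sym2 (Set (Pt m))} :
    ((TOn p J).elem.union (TOn p J').elem).JoinedAlongEdge (TOn p J'').elem a ↔
      EJ p (J ∪ J') ∩ EJ p J'' = {a} ∧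
      (↑(VJ p (J ∪ J')) ∩ ↑(VJ p J'') : Set (Set (Pt m))) = {v | v ∈ a} := by
  unfold UGraph.JoinedAlongEdge UGraph.union
  simp only
  rw [coe_EJ, coe_EJ, coe_EJ, elem_verts, elem_verts, elem_verts, EJ_union, VJ_union, ← coe_union,
    ← coe_union, ← coe_inter, ← coe_singleton, coe_inj]

lemma exists_perm {i j k : Fin 3} (hij : i ≠ j) (hik : i ≠ k) (hjk : j ≠ k) :
    ∃ t : Equiv.Perm (Fin 3), t 0 = i ∧ t 1 = j ∧ t 2 = k := by
  revert i j k; decide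

/-! ### Euler characteristic of three circles glued in a chain -/

section Chain

variable {i j k : Fin 3} {a b : Sym2 (Set (Pt m))}

lemma card_union_identities (hij : i ≠ j) (hik : i ≠ k) (hjk : j ≠ k) :
    #(VJ p ({i} ∪ {j})) + #(VJ p {i} ∩ VJ p {j}) = #(VJ p {i}) + #(VJ p {j}) ∧
    #(VJ p Set.univ) + #(VJ p {k} ∩ VJ p ({i} ∪ {j})) = #(VJ p {k}) + #(VJ p ({i} ∪ {j})) ∧
    #(EJ p ({i} ∪ {j})) + #(EJ p {i} ∩ EJ p {j}) = #(EJ p {i}) + #(EJ p {j}) ∧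
    #(EJ p Set.univ) + #(EJ p {k} ∩ EJ p ({i} ∪ {j})) = #(EJ p {k}) + #(EJ p ({i} ∪ {j})) ∧
    #(onJ m Set.univ) = #(onJ m {i}) + #(onJ m {j}) + #(onJ m {k}) := by
  have hu := singleton_union_union hij hik hjk
  have hd : Disjoint ({k} : Set (Fin 3)) ({i} ∪ {j}) := by
    rw [← compl_singleton_eq hik.symm hjk.symm hij]; exact disjoint_compl_right
  have c1 := card_onJ_union (m := m) (disjoint_singleton_of_ne hij)
  have c2 := card_onJ_union (m := m) hd
  refine ⟨?_, ?_, ?_, ?_, ?_⟩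
  · rw [VJ_union]; exact card_union_add_card_inter _ _
  · rw [← hu, VJ_union (J := {k})]; exact card_union_add_card_inter _ _
  · rw [EJ_union]; exact card_union_add_card_inter _ _
  · rw [← hu, EJ_union (J := {k})]; exact card_union_add_card_inter _ _
  · rw [← hu]; omega

/-- Each circle has at most E_l + 1 vertices and each gluing identifies at least the two ends of the
shared edge. The total V = m/2 - 1 is attained only with equality everywhere. -/
lemma IsTrees.chain (h : IsTrees p) (hij : i ≠ j) (hik : i ≠ k) (hjk : j ≠ k)
    (hi : a ∈ EJ p {i}) (hj : a ∈ EJ p {j}) (hk : b ∈ EJ p {k}) (hb : b ∈ EJ p ({i} ∪ {j})) :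
    (∀ l, #(EJ p {l}) + 1 = #(VJ p {l})) ∧
      (↑(VJ p {i}) ∩ ↑(VJ p {j}) : Set (Set (Pt m))) = {v | v ∈ a} ∧
      (↑(VJ p {k}) ∩ ↑(VJ p ({i} ∪ {j})) : Set (Set (Pt m))) = {v | v ∈ b} := by
  obtain ⟨h1, h2, -, -, h5⟩ := card_union_identities (p := p) hij hik hjk
  have da := h.not_isDiag (mem_EJ_univ hi)
  have db := h.not_isDiag (mem_EJ_univ hk)
  have i1 := two_le_card_inter da hi hj
  have i2 := two_le_card_inter db hk hb
  have ci := (conn_singleton p i).card_le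
  have cj := (conn_singleton p j).card_le
  have ck := (conn_singleton p k).card_le
  have di := card_onJ_of_allDouble (h.dbl i)
  have dj := card_onJ_of_allDouble (h.dbl j)
  have dk := card_onJ_of_allDouble (h.dbl k)
  have hE := h.cardE
  have hV := h.card
  refine ⟨fun l => ?_, inter_eq_ends da hi hj (by omega), inter_eq_ends db hk hb (by omega)⟩
  rcases fin_three_cases hij hik hjk l with rfl | rfl | rfl <;> omega

lemma isTrees_of_chain (hij : i ≠ j) (hik : i ≠ k) (hjk : j ≠ k)
    (hl : ∀ l, ∀ a ∈ EJ p {l}, ¬ a.IsDiag) (hE : ∀ l, #(EJ p {l}) + 1 = #(VJ p {l}))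
    (hd : ∀ l, (TOn p {l}).AllDouble)
    (ha : EJ p {i} ∩ EJ p {j} = {a})
    (ha' : (↑(VJ p {i}) ∩ ↑(VJ p {j}) : Set (Set (Pt m))) = {v | v ∈ a})
    (hb : EJ p {k} ∩ EJ p ({i} ∪ {j}) = {b})
    (hb' : (↑(VJ p {k}) ∩ ↑(VJ p ({i} ∪ {j})) : Set (Set (Pt m))) = {v | v ∈ b}) :
    IsTrees p := by
  obtain ⟨h1, h2, h3, h4, h5⟩ := card_union_identities (p := p) hij hik hjk
  have ma := mem_inter.1 (ha.symm.subset (mem_singleton_self a))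
  have mb := mem_inter.1 (hb.symm.subset (mem_singleton_self b))
  have v1 := card_inter_of_eq_ends (hl i a ma.1) ha'
  have v2 := card_inter_of_eq_ends (hl k b mb.1) hb'
  rw [ha, card_singleton] at h3
  rw [hb, card_singleton] at h4
  have di := card_onJ_of_allDouble (hd i)
  have dj := card_onJ_of_allDouble (hd j)
  have dk := card_onJ_of_allDouble (hd k)
  have ei := hE i
  have ej := hE j
  have ek := hE k
  refine ⟨⟨by omega, fun l => ?_⟩, by omega, hd⟩
  rcases fin_three_cases hij hik hjk l with rfl | rfl | rfl
  · refine Finset.not_disjoint_iff.2 ⟨a, ma.1, EJ_mono ?_ ma.2⟩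
    simpa using hij
  · refine Finset.not_disjoint_iff.2 ⟨a, ma.2, EJ_mono ?_ ma.1⟩
    simpa using hij.symm
  · rw [compl_singleton_eq hik.symm hjk.symm hij]
    exact Finset.not_disjoint_iff.2 ⟨b, mb.1, mb.2⟩

end Chain

lemma isTree26_iff (hm : ∀ j, 0 < m j) :
    IsTree26 p ↔ IsTrees p ∧ ∃ a, ∀ l, a ∈ EJ p {l} := by
  simp only [IsTree26, isDoubleTree_iff hm, joined_iff]
  constructor
  · rintro ⟨h, a, ha⟩
    have hall : ∀ l, a ∈ EJ p {l} := by
      intro l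
      obtain ⟨j, -, hj, -, -⟩ := exists_others l
      exact (mem_inter.1 ((ha l j hj).1.symm.subset (mem_singleton_self a))).1
    refine ⟨isTrees_of_chain (i := 0) (j := 1) (k := 2) (a := a) (b := a) (by decide) (by decide)
      (by decide) (fun l => (h l).1) (fun l => (h l).2.1) (fun l => (h l).2.2)
      (ha 0 1 (by decide)).1 (ha 0 1 (by decide)).2 ?_ ?_, a, hall⟩
    · rw [EJ_union, inter_union_distrib_left, (ha 2 0 (by decide)).1, (ha 2 1 (by decide)).1,
        union_self]
    · rw [VJ_union, coe_union, Set.inter_union_distrib_left, (ha 2 0 (by decide)).2,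
        (ha 2 1 (by decide)).2, Set.union_self]
  · rintro ⟨h, a, ha⟩
    have hc : ∀ {i j k}, i ≠ j → i ≠ k → j ≠ k → _ := fun {i j k} hij hik hjk =>
      h.chain (i := i) (j := j) (k := k) hij hik hjk (ha i) (ha j) (ha k)
        (EJ_mono Set.subset_union_left (ha i))
    refine ⟨fun j => ⟨fun b hb => h.not_isDiag (mem_EJ_univ hb), ?_, h.dbl j⟩, a, ?_⟩
    · exact (hc (i := 0) (j := 1) (k := 2) (by decide) (by decide) (by decide)).1 j
    · intro j k hjk
      obtain ⟨l, hl, hl'⟩ : ∃ l, j ≠ l ∧ k ≠ l := by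
        clear * - hjk; revert j k; decide
      refine ⟨?_, (hc hjk hl hl').2.1⟩
      exact eq_singleton_iff_unique_mem.2 ⟨mem_inter.2 ⟨ha j, ha k⟩, fun c hc =>
        h.common_unique ha hjk (mem_inter.1 hc).1 (mem_inter.1 hc).2⟩

lemma isTree244_iff (hm : ∀ j, 0 < m j) :
    IsTree244 p ↔ IsTrees p ∧ ¬ ∃ a, ∀ l, a ∈ EJ p {l} := by
  simp only [IsTree244, isDoubleTree_iff hm, joined_iff, union_joined_iff]
  constructor
  · rintro ⟨h, t, a, b, hab, ⟨h1, h2⟩, h3, h4⟩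
    have n01 : t 0 ≠ t 1 := t.injective.ne (by decide)
    have n02 : t 0 ≠ t 2 := t.injective.ne (by decide)
    have n12 : t 1 ≠ t 2 := t.injective.ne (by decide)
    refine ⟨isTrees_of_chain n01 n02 n12 (fun l => (h l).1) (fun l => (h l).2.1)
      (fun l => (h l).2.2) h1 h2 (by rw [inter_comm]; exact h3)
      (by rw [Set.inter_comm]; exact h4), ?_⟩
    rintro ⟨c, hc⟩
    have e1 := mem_singleton.1 (h1.subset (mem_inter.2 ⟨hc _, hc _⟩))
    have e2 := mem_singleton.1 (h3.subset (mem_inter.2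
      ⟨EJ_mono Set.subset_union_left (hc (t 0)), hc _⟩))
    exact hab (e1.symm.trans e2)
  · rintro ⟨h, hn⟩
    obtain ⟨i, j, k, a, b, hij, hik, hjk, hab, ha, hb, hc⟩ := h.exists_path hn
    have ma := mem_inter.1 (ha.symm.subset (mem_singleton_self a))
    have mb := mem_inter.1 (hb.symm.subset (mem_singleton_self b))
    obtain ⟨k1, k2, k3⟩ := h.chain hij hik hjk ma.1 ma.2 mb.2 (EJ_mono Set.subset_union_right mb.1)
    obtain ⟨t, rfl, rfl, rfl⟩ := exists_perm hij hik hjk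
    refine ⟨fun l => ⟨fun b hb => h.not_isDiag (mem_EJ_univ hb), k1 l, h.dbl l⟩, t, a, b, hab,
      ⟨ha, k2⟩, ?_, by rw [Set.inter_comm]; exact k3⟩
    rw [EJ_union, union_inter_distrib_right, hc, hb, empty_union]

lemma pair_eq_compl {i j k : Fin 3} (hij : i ≠ j) (hik : i ≠ k) (hjk : j ≠ k) :
    ({j, k} : Set (Fin 3)) = {i}ᶜ := (compl_singleton_eq hij hik hjk).symm

/-- In a doubled part on two circles with as many vertices as edges, every circuit consists of
edges which come from both circles. -/
lemma isEdgeOfType_of_isCircuit {j k : Fin 3} (hjk : j ≠ k) (hconn : Conn p {j, k})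
    (hV : #(VJ p {j, k}) = #(EJ p {j, k})) (hd : (TOn p {j, k}).AllDouble)
    (hmeet : ¬ Disjoint (EJ p {j}) (EJ p {k})) {C : UGraph (Set (Pt m))}
    (hC : C.IsCircuit (TOn p {j, k}).elem) {a : Sym2 (Set (Pt m))} (ha : a ∈ C.edges) :
    IsEdgeOfType (TOn p {j, k}) j k a := by
  have hsum : ∀ a, #(cell p {j, k} a) = #(cell p {j} a) + #(cell p {k} a) := fun a =>
    cell_union (disjoint_singleton_of_ne hjk) a
  obtain ⟨b, hb, hb'⟩ := Finset.not_disjoint_iff.1 hmeet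
  have hsub : EJ p {j} ⊆ EJ p {j, k} := EJ_mono (Set.singleton_subset_iff.2 (Or.inl rfl))
  have hcb : sc p (ZMod 2) {j} b ≠ 0 := by
    intro h0
    obtain ⟨r, hr⟩ := even_of_sc_eq_zero h0
    have h1 := cell_of_allDouble hd (hsub hb)
    have h2 := card_pos.2 (cell_nonempty.2 hb)
    have h3 := card_pos.2 (cell_nonempty.2 hb')
    have h4 := hsum b
    omega
  have haE : a ∈ EJ p {j, k} := by
    have : a ∈ (TOn p {j, k}).elem.edges := hC.2.1 ha
    rwa [coe_EJ] at this
  have hann : Ann p {j, k} (fun a => if a ∈ C.edges then (1 : ZMod 2) else 0) := fun f =>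
    hC.sum_eq_zero (elem_verts p _) (coe_EJ p _) f
  -- With V = E there cannot be two independent functionals. The parity vector of `j` and the
  -- circuit are therefore proportional, so circle `j` passes an odd number of times through each
  -- edge of the circuit.
  have hca : sc p (ZMod 2) {j} a ≠ 0 := by
    intro h0
    have := hconn.card_lt_of_ann
      (ann_sc (K := ZMod 2) p (Set.singleton_subset_iff.2 (Or.inl rfl) : ({j} : Set (Fin 3)) ⊆ {j, k}))
      hann (hsub hb) hcb (fun r => ⟨a, haE, by rw [h0, mul_zero, if_pos ha]; exact zero_ne_one⟩)
    omega
  have h1 := cell_of_allDouble hd haE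
  have h2 := hsum a
  have h3 : 0 < #(cell p {j} a) := card_pos.2 (cell_nonempty.2
    (not_imp_comm.1 (sc_eq_zero_of_notMem p) hca))
  have h4 : #(cell p {k} a) ≠ 0 := by
    intro h0
    exact hca (sc_eq_zero_of_even (by rw [← add_zero #(cell p {j} a), ← h0, ← h2, h1]; decide))
  obtain ⟨x, hx⟩ := card_pos.1 h3
  obtain ⟨y, hy⟩ := card_pos.1 (Nat.pos_of_ne_zero h4)
  rw [mem_cell] at hx hy
  exact ⟨fun z hz => hz.1, ⟨x, ⟨Or.inl hx.1, hx.2⟩, hx.1⟩, ⟨y, ⟨Or.inr hy.1, hy.2⟩, hy.1⟩⟩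

/-- A shared class supplies connectedness and, by the rank argument, the type of all circuit edges;
conversely any edge of a circuit is shared. -/
lemma isDoubleUnicircuit_iff (hm : ∀ j, 0 < m j) {j k : Fin 3} (hjk : j ≠ k) :
    IsDoubleUnicircuit p j k ↔ #(VJ p {j, k}) = #(EJ p {j, k}) ∧ (TOn p {j, k}).AllDouble ∧
      ¬ Disjoint (EJ p {j}) (EJ p {k}) := by
  have hu : (TOn p {j, k}).elem.verts.ncard = (TOn p {j, k}).elem.edges.ncard ↔
      #(VJ p {j, k}) = #(EJ p {j, k}) := by
    rw [elem_verts, coe_EJ, Set.ncard_coe_finset, Set.ncard_coe_finset]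
  constructor
  · rintro ⟨h1, h2, h3⟩
    refine ⟨hu.1 h1.2, h2, ?_⟩
    obtain ⟨C, hC, a, ha⟩ := h1.exists_circuit (finite_verts p _)
    obtain ⟨-, ⟨x, hx, hxj⟩, y, hy, hyk⟩ := h3 C hC a ha
    exact Finset.not_disjoint_iff.2 ⟨a, mem_EJ.2 ⟨x, hxj, hx.2⟩, mem_EJ.2 ⟨y, hyk, hy.2⟩⟩
  · rintro ⟨h1, h2, h3⟩
    have hc : Conn p {j, k} := (conn_singleton p j).union (conn_singleton p k) h3
    refine ⟨⟨?_, hu.2 h1⟩, h2, fun C hC a ha => isEdgeOfType_of_isCircuit hjk hc h1 h2 h3 hC ha⟩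
    exact connected_of_conn hc ⟨⟨j, ⟨0, hm j⟩⟩, Or.inl rfl⟩ (elem_verts p _)
      (fun a ha _ => by rw [coe_EJ]; exact ha)

/-! ### Euler characteristic of a circle glued to two others -/

section Uni

variable {i : Fin 3}

lemma card_compl_identities (p : Setoid (Pt m)) (i : Fin 3) :
    #(VJ p Set.univ) + #(VJ p {i} ∩ VJ p {i}ᶜ) = #(VJ p {i}) + #(VJ p {i}ᶜ) ∧
    #(EJ p Set.univ) + #(EJ p {i} ∩ EJ p {i}ᶜ) = #(EJ p {i}) + #(EJ p {i}ᶜ) ∧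
    #(onJ m Set.univ) = #(onJ m {i}) + #(onJ m {i}ᶜ) := by
  rw [← card_onJ_union disjoint_compl_right, Set.union_compl_self]
  refine ⟨?_, ?_, rfl⟩
  · rw [← Set.union_compl_self {i}, VJ_union]; exact card_union_add_card_inter _ _
  · rw [← Set.union_compl_self {i}, EJ_union]; exact card_union_add_card_inter _ _

/-- The class in which the circle `i` is joined with the others is unique. -/
lemma IsUni.inter_eq (h : IsUni p i) {a : Sym2 (Set (Pt m))} (ha : a ∈ EJ p {i})
    (ha' : a ∈ EJ p {i}ᶜ) : EJ p {i} ∩ EJ p {i}ᶜ = {a} := by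
  obtain ⟨b, hb⟩ := card_EJ_inter h.cardE (card_onJ_of_allDouble h.dbl)
    (card_onJ_of_allDouble h.dblc)
  rw [hb, mem_singleton.1 (hb.subset (mem_inter.2 ⟨ha, ha'⟩))]

/-- A doubled class shared by the two circles has one edge from each, so the parity vector of `j` is
a nonzero functional. -/
lemma IsUni.card_compl_le (h : IsUni p i) : #(VJ p {i}ᶜ) ≤ #(EJ p {i}ᶜ) := by
  obtain ⟨j, k, hij, hik, hjk⟩ := exists_others i
  have hmeet := h.meet j k hij hik hjk
  have hd := h.dblc
  rw [compl_singleton_eq hij hik hjk] at hd ⊢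
  have hc := (conn_singleton p j).union (conn_singleton p k) hmeet
  obtain ⟨b, hb, hb'⟩ := Finset.not_disjoint_iff.1 hmeet
  have hsub : EJ p {j} ⊆ EJ p ({j} ∪ {k}) := EJ_mono Set.subset_union_left
  refine hc.card_le_of_ann (ann_sc (K := ZMod 2) p Set.subset_union_left) (hsub hb) fun h0 => ?_
  obtain ⟨r, hr⟩ := even_of_sc_eq_zero h0
  have h1 := cell_of_allDouble hd (hsub hb)
  have h2 := card_pos.2 (cell_nonempty.2 hb)
  have h3 := card_pos.2 (cell_nonempty.2 hb')
  have h4 := cell_union (p := p) (disjoint_singleton_of_ne hjk) b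
  omega

lemma isUni_of_joined (h1 : #(VJ p {i}ᶜ) = #(EJ p {i}ᶜ)) {a : Sym2 (Set (Pt m))}
    (h2 : EJ p {i} ∩ EJ p {i}ᶜ = {a})
    (h3 : #(VJ p {i}) + 1 = #(EJ p {i}) + #(VJ p {i} ∩ VJ p {i}ᶜ))
    (hd : (TOn p {i}).AllDouble) (hd' : (TOn p {i}ᶜ).AllDouble) {j k : Fin 3} (hij : i ≠ j)
    (hik : i ≠ k) (hjk : j ≠ k) (hmeet : ¬ Disjoint (EJ p {j}) (EJ p {k})) : IsUni p i := by
  obtain ⟨e1, e2, e3⟩ := card_compl_identities p i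
  have ma := mem_inter.1 (h2.symm.subset (mem_singleton_self a))
  rw [h2, card_singleton] at e2
  have d1 := card_onJ_of_allDouble hd
  have d2 := card_onJ_of_allDouble hd'
  refine ⟨⟨by omega, fun l => ?_⟩, by omega, hd, hd', ?_⟩
  · obtain ⟨b, hb, hb'⟩ := Finset.not_disjoint_iff.1 hmeet
    rcases fin_three_cases hij hik hjk l with rfl | rfl | rfl
    · exact Finset.not_disjoint_iff.2 ⟨a, ma⟩
    · exact Finset.not_disjoint_iff.2 ⟨b, hb, EJ_mono (by simpa using hjk) hb'⟩
    · exact Finset.not_disjoint_iff.2 ⟨b, hb', EJ_mono (by simpa using hjk.symm) hb⟩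
  · intro j' k' hij' hik' hjk'
    have : j' = j ∧ k' = k ∨ j' = k ∧ k' = j := by
      clear * - hij hik hjk hij' hik' hjk'; revert i j k j' k'; decide
    rcases this with ⟨rfl, rfl⟩ | ⟨rfl, rfl⟩
    · exact hmeet
    · rwa [disjoint_comm]

/-- If the shared class is not a loop, at least two vertices are shared. The vertex count then
forces exactly two, and makes circle `i` a tree and the other part unicircuit. -/
lemma isUnicircuit24_iff (hm : ∀ j, 0 < m j) : IsUnicircuit24 p ↔
    ∃ i, IsUni p i ∧ ∃ a, a ∈ EJ p {i} ∧ a ∈ EJ p {i}ᶜ ∧ ¬ a.IsDiag := by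
  unfold IsUnicircuit24
  simp only [isDoubleTree_iff hm, joined_iff]
  constructor
  · rintro ⟨t, a, ⟨h1, h2, h3⟩, h4, h5, h6⟩
    have n01 : t 0 ≠ t 1 := t.injective.ne (by decide)
    have n02 : t 0 ≠ t 2 := t.injective.ne (by decide)
    have n12 : t 1 ≠ t 2 := t.injective.ne (by decide)
    rw [isDoubleUnicircuit_iff hm n12] at h4
    rw [pair_eq_compl n01 n02 n12] at h4 h5 h6
    have ma := mem_inter.1 (h5.symm.subset (mem_singleton_self a))
    have hv := card_inter_of_eq_ends (h1 a ma.1) h6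
    exact ⟨t 0, isUni_of_joined h4.1 h5 (by omega) h3 h4.2.1 n01 n02 n12 h4.2.2, a, ma.1, ma.2,
      h1 a ma.1⟩
  · rintro ⟨i, h, a, ha, ha', hd⟩
    obtain ⟨j, k, hij, hik, hjk⟩ := exists_others i
    have h0 := h.inter_eq ha ha'
    have hc := h.card_compl_le
    obtain ⟨e1, e2, e3⟩ := card_compl_identities p i
    have hi := (conn_singleton p i).card_le
    have h2 := two_le_card_inter hd ha ha'
    have hV := h.card
    have hE := h.cardE
    rw [h0, card_singleton] at e2
    obtain ⟨t, rfl, rfl, rfl⟩ := exists_perm hij hik hjk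
    refine ⟨t, a, ⟨fun b hb hbd => ?_, by omega, h.dbl⟩, ?_, ?_⟩
    · have := (conn_singleton p (t 0)).card_le_of_ann (ann_single_of_isDiag (K := ℚ) hbd) hb
        (by rw [Pi.single_eq_same]; exact one_ne_zero)
      omega
    · rw [isDoubleUnicircuit_iff hm hjk, pair_eq_compl hij hik hjk]
      exact ⟨by omega, h.dblc, h.meet _ _ hij hik hjk⟩
    · rw [pair_eq_compl hij hik hjk]
      exact ⟨h0, inter_eq_ends hd ha ha' (by omega)⟩

lemma coe_loops (p : Setoid (Pt m)) (J : Set (Fin 3)) (v : Set (Pt m)) :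
    (TOn p J).loopsAt v = ↑(cell p J s(v, v)) := by
  ext x
  rw [mem_coe, mem_cell]
  refine and_congr_right fun _ => ?_
  rw [en, Sym2.eq_iff, or_self]
  rfl

lemma coe_removeLoops_edges (p : Setoid (Pt m)) (J : Set (Fin 3)) (v : Set (Pt m)) :
    ((TOn p J).removeLoopsAt v).elem.edges = ↑((EJ p J).erase s(v, v)) := by
  ext a
  rw [mem_coe, mem_erase, mem_EJ]
  constructor
  · rintro ⟨x, ⟨hx, hx'⟩, rfl⟩
    refine ⟨fun h => hx' ?_, x, hx, rfl⟩
    rw [coe_loops]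
    exact mem_cell.2 ⟨hx, h⟩
  · rintro ⟨h, x, hx, rfl⟩
    refine ⟨x, ⟨hx, fun h' => h ?_⟩, rfl⟩
    rw [coe_loops] at h'
    exact (mem_cell.1 h').2

lemma removeLoops_edgeClass (p : Setoid (Pt m)) (J : Set (Fin 3)) {v : Set (Pt m)}
    {a : Sym2 (Set (Pt m))} (ha : a ≠ s(v, v)) :
    ((TOn p J).removeLoopsAt v).edgeClass a = (TOn p J).edgeClass a := by
  ext x
  constructor
  · rintro ⟨⟨hx, -⟩, hxa⟩; exact ⟨hx, hxa⟩
  · rintro ⟨hx, hxa⟩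
    refine ⟨⟨hx, fun h' => ha ?_⟩, hxa⟩
    rw [coe_loops] at h'
    exact hxa.symm.trans (mem_cell.1 h').2

lemma isDoubleUniloopAt_iff (hm : ∀ j, 0 < m j) {v : Set (Pt m)} :
    (TOn p {i}).IsDoubleUniloopAt v ↔ s(v, v) ∈ EJ p {i} ∧ (TOn p {i}).AllDouble ∧
      (∀ a ∈ EJ p {i}, a ≠ s(v, v) → ¬ a.IsDiag) ∧ #(EJ p {i}) = #(VJ p {i}) := by
  have hv : ((TOn p {i}).removeLoopsAt v).elem.verts = ↑(VJ p {i}) := elem_verts p _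
  have hconn : ((TOn p {i}).removeLoopsAt v).elem.Connected :=
    connected_of_conn (conn_singleton p i) ⟨⟨i, ⟨0, hm i⟩⟩, rfl⟩ hv (fun a ha hd => by
      rw [coe_removeLoops_edges]
      refine mem_erase.2 ⟨?_, ha⟩
      rintro rfl
      exact hd rfl)
  have htree : ((TOn p {i}).removeLoopsAt v).elem.IsTree ↔
      (∀ a ∈ EJ p {i}, a ≠ s(v, v) → ¬ a.IsDiag) ∧
        #((EJ p {i}).erase s(v, v)) + 1 = #(VJ p {i}) := by
    rw [UGraph.isTree_iff (by rw [hv]; exact finite_toSet _), hv, coe_removeLoops_edges, Set.ncard_coe_finset,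
      Set.ncard_coe_finset, and_iff_right hconn]
    refine and_congr_left fun _ => ⟨fun h a ha hav => h a (mem_erase.2 ⟨hav, ha⟩),
      fun h a ha => h a (mem_erase.1 ha).2 (mem_erase.1 ha).1⟩
  unfold OGraph.IsDoubleUniloopAt OGraph.IsDoubleTree
  rw [htree, coe_loops, Set.ncard_coe_finset]
  constructor
  · rintro ⟨-, h1, ⟨h2, h3⟩, h4⟩
    have hm : s(v, v) ∈ EJ p {i} := cell_nonempty.1 (card_pos.1 (by omega))
    rw [card_erase_of_mem hm] at h3
    have := card_pos.2 ⟨_, hm⟩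
    refine ⟨hm, ?_, h2, by omega⟩
    rw [allDouble_iff]
    intro a ha
    rcases eq_or_ne a s(v, v) with rfl | hav
    · obtain ⟨x, y, hxy, hc⟩ := card_eq_two.1 h1
      have hx := (mem_cell.1 (hc.symm.subset (mem_insert_self x {y}))).2
      have hy := (mem_cell.1 (hc.symm.subset (mem_insert_of_mem (mem_singleton_self y)))).2
      exact ⟨x, y, hxy, hc, opp_of_isDiag (hx.trans hy.symm) (hx ▸ rfl)⟩
    · obtain ⟨x, y, hxy, hc, ho⟩ := h4 a (by
        rw [coe_removeLoops_edges]; exact mem_erase.2 ⟨hav, ha⟩)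
      rw [removeLoops_edgeClass p _ hav, coe_cell] at hc
      refine ⟨x, y, hxy, ?_, ho⟩
      rw [← coe_inj, hc]; simp
  · rintro ⟨h1, h2, h3, h4⟩
    refine ⟨?_, cell_of_allDouble h2 h1, ⟨h3, ?_⟩, ?_⟩
    · rw [coe_VJ]; exact mem_VJ_of_mem_EJ h1 (Sym2.mem_mk_left v v)
    · rw [card_erase_of_mem h1]
      have := card_pos.2 ⟨_, h1⟩
      omega
    · intro a ha
      rw [coe_removeLoops_edges] at ha
      obtain ⟨hav, ha⟩ := mem_erase.1 ha
      obtain ⟨x, y, hxy, hc, ho⟩ := h2 a (by rw [coe_EJ]; exact ha)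
      exact ⟨x, y, hxy, by rw [removeLoops_edgeClass p _ hav]; exact hc, ho⟩

lemma isUniloop24_iff (hm : ∀ j, 0 < m j) : IsUniloop24 p ↔
    ∃ i, IsUni p i ∧ ∃ a, a ∈ EJ p {i} ∧ a ∈ EJ p {i}ᶜ ∧ a.IsDiag := by
  unfold IsUniloop24
  simp only [isDoubleUniloopAt_iff hm, coe_VJ, coe_EJ, mem_coe]
  constructor
  · rintro ⟨t, v, ⟨h1, h2, h3, h4⟩, h5, h6, h7⟩
    have n01 : t 0 ≠ t 1 := t.injective.ne (by decide)
    have n02 : t 0 ≠ t 2 := t.injective.ne (by decide)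
    have n12 : t 1 ≠ t 2 := t.injective.ne (by decide)
    rw [isDoubleUnicircuit_iff hm n12] at h5
    rw [pair_eq_compl n01 n02 n12] at h5 h6 h7
    -- The ends of a shared edge are shared vertices, and `v` is the only one.
    have hinter : EJ p {t 0} ∩ EJ p {t 0}ᶜ = {s(v, v)} := by
      refine eq_singleton_iff_unique_mem.2 ⟨mem_inter.2 ⟨h1, h6⟩, fun c hc => ?_⟩
      obtain ⟨hc1, hc2⟩ := mem_inter.1 hc
      have key : ∀ w ∈ c, w = v := fun w hw =>
        h7.subset ⟨mem_VJ_of_mem_EJ hc1 hw, mem_VJ_of_mem_EJ hc2 hw⟩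
      rw [← sym2_out_eq c, key _ (Sym2.out_fst_mem c), key _ (Sym2.out_snd_mem c)]
    have hv : #(VJ p {t 0} ∩ VJ p {t 0}ᶜ) = 1 := by
      rw [← Set.ncard_coe_finset, coe_inter, h7, Set.ncard_singleton]
    exact ⟨t 0, isUni_of_joined h5.1 hinter (by omega) h2 h5.2.1 n01 n02 n12 h5.2.2, s(v, v), h1,
      h6, rfl⟩
  · rintro ⟨i, h, a, ha, ha', hd⟩
    obtain ⟨j, k, hij, hik, hjk⟩ := exists_others i
    induction a with
    | h v w =>
      obtain rfl : v = w := Sym2.mk_isDiag_iff.1 hd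
      have h0 := h.inter_eq ha ha'
      have hc := h.card_compl_le
      obtain ⟨e1, e2, e3⟩ := card_compl_identities p i
      have hi := (conn_singleton p i).card_le_of_ann (ann_single_of_isDiag (K := ℚ) hd) ha
        (by rw [Pi.single_eq_same]; exact one_ne_zero)
      have hmv : v ∈ VJ p {i} ∩ VJ p {i}ᶜ := mem_inter.2
        ⟨mem_VJ_of_mem_EJ ha (Sym2.mem_mk_left v v), mem_VJ_of_mem_EJ ha' (Sym2.mem_mk_left v v)⟩
      have h2 := card_pos.2 ⟨v, hmv⟩
      have hV := h.card
      have hE := h.cardE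
      rw [h0, card_singleton] at e2
      obtain ⟨t, rfl, rfl, rfl⟩ := exists_perm hij hik hjk
      refine ⟨t, v, ⟨ha, h.dbl, fun b hb hbv hbd => ?_, by omega⟩, ?_, ?_, ?_⟩
      -- A second loop would add an independent functional, whereas the count gives V = E on this
      -- circle.
      · have := (conn_singleton p (t 0)).card_lt_of_ann (ann_single_of_isDiag (K := ℚ) hd)
          (ann_single_of_isDiag (K := ℚ) hbd) ha (by rw [Pi.single_eq_same]; exact one_ne_zero)
          (fun r => ⟨b, hb, by
            rw [Pi.single_eq_same, Pi.single_eq_of_ne hbv, mul_zero]; exact zero_ne_one⟩)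
        omega
      · rw [isDoubleUnicircuit_iff hm hjk, pair_eq_compl hij hik hjk]
        exact ⟨by omega, h.dblc, h.meet _ _ hij hik hjk⟩
      · rw [pair_eq_compl hij hik hjk]; exact ha'
      · rw [pair_eq_compl hij hik hjk, ← coe_inter]
        obtain ⟨w, hw⟩ := card_eq_one.1 (by omega : #(VJ p {t 0} ∩ VJ p {t 0}ᶜ) = 1)
        rw [hw] at hmv ⊢
        rw [mem_singleton.1 hmv, coe_singleton]

end Uni

/-! ### Mixed moments of the entries -/

section Moments

variable {Ω : Type*} {N : ℕ} {x : Fin N → Fin N → Ω → ℂ} {i : Pt m → Fin N}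

/-- The matrix entry which belongs to the edge `e_u`. -/
def entry (x : Fin N → Fin N → Ω → ℂ) (i : Pt m → Fin N) (u : Pt m) (ω : Ω) : ℂ :=
  x (i u) (i (gam m u)) ω

/-- The position on or above the diagonal of the entry which belongs to `e_u`. -/
def key (i : Pt m → Fin N) (u : Pt m) : {c : Fin N × Fin N // c.1 ≤ c.2} :=
  ⟨(min (i u) (i (gam m u)), max (i u) (i (gam m u))), min_le_max⟩

lemma key_eq_iff (hi : Setoid.ker i = p) {u v : Pt m} : key i u = key i v ↔ en p u = en p v := by
  have hb : ∀ y z : Pt m, block p y = block p z ↔ i y = i z := by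
    intro y z
    rw [block_eq_iff, ← hi, Setoid.ker_def]
  rw [en, en, Sym2.eq_iff, hb, hb, hb, hb, key, key, Subtype.mk.injEq, Prod.mk.injEq]
  rcases le_total (i u) (i (gam m u)) with h | h <;>
    rcases le_total (i v) (i (gam m v)) with h' | h' <;>
    simp only [min_eq_left, min_eq_right, max_eq_left, max_eq_right, h, h'] <;>
    constructor
  all_goals first
    | (rintro ⟨e1, e2⟩; simp only [e1, e2, and_true, true_or, or_true]; done)
    | (rintro (⟨e1, e2⟩ | ⟨e1, e2⟩) <;> constructor <;> order)

lemma entry_eq_of_par (hi : Setoid.ker i = p) {u v : Pt m} (h : Par p u v) :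
    entry x i u = entry x i v := by
  have hb : ∀ {y z : Pt m}, block p y = block p z → i y = i z := by
    intro y z h
    rw [block_eq_iff, ← hi] at h
    exact h
  funext ω
  rw [entry, entry, hb h.1, hb h.2]

variable [MeasurableSpace Ω] {P : Measure Ω}

/-- The expectation of the product of the entries in `S`. -/
def mom (P : Measure Ω) (x : Fin N → Fin N → Ω → ℂ) (i : Pt m → Fin N) (S : Finset (Pt m)) : ℂ :=
  ∫ ω, ∏ u ∈ S, entry x i u ω ∂P

lemma entry_eq_conj_of_opp (hx : IsWigner P x) (hi : Setoid.ker i = p) {u v : Pt m}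
    (h : Opp p u v) (ω : Ω) : entry x i v ω = (starRingEnd ℂ) (entry x i u ω) := by
  have hb : ∀ {y z : Pt m}, block p y = block p z → i y = i z := by
    intro y z h
    rw [block_eq_iff, ← hi] at h
    exact h
  rw [entry, entry, ← hx.selfAdjoint, hb h.1, hb h.2]

lemma norm_entry_eq (hx : IsWigner P x) (hi : Setoid.ker i = p) {u v : Pt m}
    (h : en p u = en p v) (ω : Ω) : ‖entry x i u ω‖ = ‖entry x i v ω‖ := by
  rcases par_or_opp h with h | h
  · rw [entry_eq_of_par hi h]
  · rw [entry_eq_conj_of_opp hx hi h, Complex.norm_conj]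

lemma measurable_entry (hx : IsWigner P x) (u : Pt m) : Measurable (entry x i u) :=
  hx.measurable _ _

/-- Independence is given on and above the diagonal only. Entries below it are conjugates, so both
products are measurable functions of disjoint families of independent entries. -/
lemma mom_union_of_key (hx : IsWigner P x) {S S' : Finset (Pt m)}
    (h : ∀ u ∈ S, ∀ v ∈ S', key i u ≠ key i v) : mom P x i (S ∪ S') = mom P x i S * mom P x i S' := by
  have hd : Disjoint S S' := by
    rw [Finset.disjoint_left]
    intro u hu hu'
    exact h u hu u hu' rfl
  have hdk : Disjoint (S.image (key i)) (S'.image (key i)) := by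
    rw [Finset.disjoint_left]
    intro c hc hc'
    obtain ⟨u, hu, rfl⟩ := mem_image.1 hc
    obtain ⟨v, hv, e⟩ := mem_image.1 hc'
    exact h u hu v hv e.symm
  have hind := hx.indep.indepFun_finset _ _ hdk (fun c => hx.measurable _ _)
  let θ : Pt m → ℂ → ℂ := fun u z => if i u ≤ i (gam m u) then z else (starRingEnd ℂ) z
  have hθm : ∀ u, Measurable (θ u) := by
    intro u
    by_cases hu : i u ≤ i (gam m u)
    · simp only [θ, hu, if_true]; exact measurable_id
    · simp only [θ, hu, if_false]; exact Complex.continuous_conj.measurable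
  have hθ : ∀ u ω, θ u (x (key i u).1.1 (key i u).1.2 ω) = entry x i u ω := by
    intro u ω
    by_cases hu : i u ≤ i (gam m u)
    · simp only [θ, hu, if_true, key, min_eq_left, max_eq_right, entry]
    · have hu' := le_of_not_ge hu
      simp only [θ, hu, if_false, key, min_eq_right hu', max_eq_left hu', entry]
      exact (hx.selfAdjoint _ _ _).symm
  let Φ : ∀ S : Finset (Pt m), ((S.image (key i) : Finset _) → ℂ) → ℂ := fun S y =>
    ∏ u ∈ S.attach, θ u (y ⟨key i u, mem_image_of_mem _ u.2⟩)
  have hΦm : ∀ S, Measurable (Φ S) := fun S =>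
    Finset.measurable_fun_prod _ fun u _ => (hθm u).comp (measurable_pi_apply _)
  have hΦ : ∀ S ω, Φ S (fun c => x c.1.1.1 c.1.1.2 ω) = ∏ u ∈ S, entry x i u ω := by
    intro S ω
    rw [← prod_attach]
    exact prod_congr rfl fun u _ => hθ u ω
  have hind' := hind.comp (hΦm S) (hΦm S')
  have h1 : (Φ S ∘ fun ω (c : (S.image (key i) : Finset _)) => x c.1.1.1 c.1.1.2 ω)
      = fun ω => ∏ u ∈ S, entry x i u ω := funext fun ω => hΦ S ω
  have h2 : (Φ S' ∘ fun ω (c : (S'.image (key i) : Finset _)) => x c.1.1.1 c.1.1.2 ω)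
      = fun ω => ∏ u ∈ S', entry x i u ω := funext fun ω => hΦ S' ω
  have hm : ∀ S : Finset (Pt m), AEStronglyMeasurable (fun ω => ∏ u ∈ S, entry x i u ω) P :=
    fun S => (Finset.measurable_fun_prod _ fun u _ => measurable_entry hx u).aestronglyMeasurable
  unfold mom
  simp only [prod_union hd]
  exact IndepFun.integral_fun_mul_eq_mul_integral (h1 ▸ h2 ▸ hind') (hm S) (hm S')

lemma mom_union (hx : IsWigner P x) (hi : Setoid.ker i = p) {S S' : Finset (Pt m)}
    (h : ∀ u ∈ S, ∀ v ∈ S', en p u ≠ en p v) : mom P x i (S ∪ S') = mom P x i S * mom P x i S' :=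
  mom_union_of_key hx fun u hu v hv e => h u hu v hv ((key_eq_iff hi).1 e)

lemma mom_singleton (hx : IsWigner P x) (u : Pt m) : mom P x i {u} = 0 := by
  simp only [mom, prod_singleton]
  exact hx.mean _ _

lemma mom_pair_of_par (hx : IsWigner P x) (hi : Setoid.ker i = p) {u v : Pt m} (huv : u ≠ v)
    (h : Par p u v) (hd : ¬ (en p u).IsDiag) : mom P x i {u, v} = 0 := by
  simp only [mom, prod_pair huv, ← entry_eq_of_par (x := x) hi h, ← sq]
  refine hx.sq _ _ fun e => hd (en_isDiag_iff.2 ?_)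
  rw [block_eq_iff, ← hi]
  exact e.symm

/-- The expectation of the product of the entries on the circles in `J`. -/
def momJ (P : Measure Ω) (x : Fin N → Fin N → Ω → ℂ) (i : Pt m → Fin N) (J : Set (Fin 3)) : ℂ :=
  mom P x i (onJ m J)

lemma momJ_union (hx : IsWigner P x) (hi : Setoid.ker i = p) {J J' : Set (Fin 3)}
    (h : Disjoint (EJ p J) (EJ p J')) : momJ P x i (J ∪ J') = momJ P x i J * momJ P x i J' := by
  have : onJ m (J ∪ J') = onJ m J ∪ onJ m J' := by
    ext u; simp only [mem_onJ, mem_union, Set.mem_union]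
  rw [momJ, this, mom_union hx hi]
  · rfl
  · intro u hu v hv e
    exact Finset.disjoint_left.1 h (mem_EJ.2 ⟨u, mem_onJ.1 hu, rfl⟩)
      (mem_EJ.2 ⟨v, mem_onJ.1 hv, e.symm⟩)

variable [IsProbabilityMeasure P]

lemma mom_empty : mom P x i ∅ = 1 := by simp [mom]

lemma mom_eq_prod (hx : IsWigner P x) (hi : Setoid.ker i = p) (S : Finset (Pt m))
    (A : Finset (Sym2 (Set (Pt m)))) (hA : ∀ u ∈ S, en p u ∈ A) :
    mom P x i S = ∏ a ∈ A, mom P x i {u ∈ S | en p u = a} := by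
  have key : ∀ A : Finset (Sym2 (Set (Pt m))), mom P x i {u ∈ S | en p u ∈ A}
      = ∏ a ∈ A, mom P x i {u ∈ S | en p u = a} := by
    intro A
    induction A using Finset.induction_on with
    | empty => simp [mom_empty]
    | insert a A ha ih =>
      rw [prod_insert ha, ← ih, ← mom_union hx hi]
      · congr 1
        ext u
        simp only [mem_filter, mem_insert, mem_union, and_or_left]
      · intro u hu v hv e
        rw [mem_filter] at hu hv
        exact ha (by rw [← hu.2, e]; exact hv.2)
  rw [← key A, filter_true_of_mem hA]

lemma momJ_eq_prod (hx : IsWigner P x) (hi : Setoid.ker i = p) (J : Set (Fin 3)) :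
    momJ P x i J = ∏ a ∈ EJ p Set.univ, mom P x i (cell p J a) :=
  mom_eq_prod hx hi _ _ fun u _ => mem_EJ.2 ⟨u, trivial, rfl⟩

lemma momJ_eq_zero (hx : IsWigner P x) (hi : Setoid.ker i = p) {J : Set (Fin 3)}
    {a : Sym2 (Set (Pt m))} (h : mom P x i (cell p J a) = 0) : momJ P x i J = 0 := by
  rw [momJ_eq_prod hx hi]
  refine prod_eq_zero (i := a) ?_ h
  by_contra ha
  have : cell p J a = ∅ := by
    rw [← not_nonempty_iff_eq_empty, cell_nonempty]
    exact fun ha' => ha (mem_EJ_univ ha')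
  rw [this, mom_empty] at h
  exact one_ne_zero h

end Moments

/-! ### The third cumulant in terms of the moments -/

/-- The third cumulant in terms of the joint moments. -/
def kappa (M : Set (Fin 3) → ℂ) : ℂ := M Set.univ - ∑ l, M {l} * M {l}ᶜ + 2 * ∏ l, M {l}

lemma kappa_eq {i j k : Fin 3} (hij : i ≠ j) (hik : i ≠ k) (hjk : j ≠ k) (M : Set (Fin 3) → ℂ) :
    kappa M = M Set.univ - (M {i} * M {i}ᶜ + M {j} * M {j}ᶜ + M {k} * M {k}ᶜ)
      + 2 * (M {i} * M {j} * M {k}) := by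
  have hu : (univ : Finset (Fin 3)) = {i, j, k} := by
    ext l
    simpa using fin_three_cases hij hik hjk l
  rw [kappa, hu, sum_insert (by simp [hij, hik]), sum_pair hjk, prod_insert (by simp [hij, hik]),
    prod_pair hjk]
  ring

lemma kappa_eq_zero {j : Fin 3} {M : Set (Fin 3) → ℂ} (h : ∀ J, j ∈ J → M J = 0) :
    kappa M = 0 := by
  obtain ⟨k, l, hjk, hjl, hkl⟩ := exists_others j
  rw [kappa_eq hjk hjl hkl, h Set.univ trivial, h {j} rfl, h {k}ᶜ (by simpa using hjk),
    h {l}ᶜ (by simpa using hjl)]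
  ring

/-- A third cumulant vanishes when one argument factors out of all the joint moments. -/
lemma kappa_eq_zero_of_mul {j : Fin 3} {M : Set (Fin 3) → ℂ}
    (h : ∀ J ⊆ {j}ᶜ, M ({j} ∪ J) = M {j} * M J) : kappa M = 0 := by
  obtain ⟨k, l, hjk, hjl, hkl⟩ := exists_others j
  have h1 := h {j}ᶜ subset_rfl
  have h2 := h {k} (by simpa using hjk)
  have h3 := h {l} (by simpa using hjl)
  rw [Set.union_compl_self] at h1
  rw [kappa_eq hjk hjl hkl, h1, compl_singleton_eq hjk.symm hkl hjl, h3,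
    compl_singleton_eq hjl.symm hkl.symm hjk, h2]
  ring

section Cumulant

variable {Ω : Type*} {N : ℕ} {x : Fin N → Fin N → Ω → ℂ} {i : Pt m → Fin N}

lemma circleProd_eq (x : Fin N → Fin N → Ω → ℂ) (i : Pt m → Fin N) (j : Fin 3) (ω : Ω) :
    circleProd x i j ω = ∏ u ∈ onJ m {j}, entry x i u ω := by
  refine prod_nbij (fun a => (⟨j, a⟩ : Pt m)) (fun a _ => mem_onJ.2 rfl) ?_ ?_ (fun a _ => rfl)
  · intro a _ b _ h
    simpa using h
  · rintro ⟨k, a⟩ h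
    obtain rfl : k = j := mem_onJ.1 h
    exact ⟨a, by simp, rfl⟩

lemma prod_onJ_union {J J' : Set (Fin 3)} (h : Disjoint J J') (f : Pt m → ℂ) :
    ∏ u ∈ onJ m (J ∪ J'), f u = (∏ u ∈ onJ m J, f u) * ∏ u ∈ onJ m J', f u := by
  rw [← prod_union]
  · congr 1
    ext u; simp only [mem_onJ, mem_union, Set.mem_union]
  · rw [Finset.disjoint_left]
    intro u hu hu'
    exact Set.disjoint_left.1 h (mem_onJ.1 hu) (mem_onJ.1 hu')

variable [MeasurableSpace Ω] {P : Measure Ω}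

lemma k₃_eq_kappa : k₃ P (circleProd x i 0) (circleProd x i 1) (circleProd x i 2)
    = kappa (momJ P x i) := by
  have h2 : ∀ j k : Fin 3, j ≠ k → ∀ l, l ≠ j → l ≠ k →
      ∫ ω, circleProd x i j ω * circleProd x i k ω ∂P = momJ P x i {l}ᶜ := by
    intro j k hjk l hlj hlk
    rw [momJ, mom, compl_singleton_eq hlj hlk hjk]
    simp only [prod_onJ_union (disjoint_singleton_of_ne hjk), circleProd_eq]
  have h1 : ∀ j, ∫ ω, circleProd x i j ω ∂P = momJ P x i {j} := by
    intro j
    simp only [momJ, mom, circleProd_eq]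
  have h3 : ∫ ω, circleProd x i 0 ω * circleProd x i 1 ω * circleProd x i 2 ω ∂P
      = momJ P x i Set.univ := by
    have hd : Disjoint ({2} : Set (Fin 3)) ({0} ∪ {1}) := by
      rw [← compl_singleton_eq (i := 2) (by decide) (by decide) (by decide)]
      exact disjoint_compl_right
    rw [momJ, mom, ← singleton_union_union (i := 0) (j := 1) (k := 2) (by decide) (by decide)
      (by decide)]
    simp only [prod_onJ_union hd, prod_onJ_union (disjoint_singleton_of_ne (zero_ne_one)),
      circleProd_eq, mul_comm]
  rw [k₃, h3, h1, h1, h1, h2 0 1 (by decide) 2 (by decide) (by decide),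
    h2 0 2 (by decide) 1 (by decide) (by decide), h2 1 2 (by decide) 0 (by decide) (by decide),
    kappa_eq (i := 0) (j := 1) (k := 2) (by decide) (by decide) (by decide)]
  ring

lemma share_of_kappa_ne_zero (hx : IsWigner P x) (hi : Setoid.ker i = p)
    (h : kappa (momJ P x i) ≠ 0) : Share p := by
  intro j hj
  refine h (kappa_eq_zero_of_mul (j := j) fun J hJ => momJ_union hx hi ?_)
  exact disjoint_of_subset_right (EJ_mono hJ) hj

variable [IsProbabilityMeasure P]

/-- A single edge would contribute the factor `E x = 0` to every moment involving its circle. -/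
lemma two_le_cell_of_kappa_ne_zero (hx : IsWigner P x) (hi : Setoid.ker i = p)
    (h : kappa (momJ P x i) ≠ 0) {a : Sym2 (Set (Pt m))} (ha : a ∈ EJ p Set.univ) :
    2 ≤ #(cell p Set.univ a) := by
  have h1 := card_pos.2 (cell_nonempty.2 ha)
  by_contra h2
  obtain ⟨u, hu⟩ := card_eq_one.1 (by omega : #(cell p Set.univ a) = 1)
  have hua : en p u = a := (mem_cell.1 (hu.symm.subset (mem_singleton_self u))).2
  refine h (kappa_eq_zero (j := u.1) fun J hJ => momJ_eq_zero hx hi (a := a) ?_)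
  have : cell p J a = {u} := by
    ext v
    constructor
    · intro hv
      rw [← hu]
      exact mem_cell.2 ⟨trivial, (mem_cell.1 hv).2⟩
    · intro hv
      rw [mem_singleton.1 hv]
      exact mem_cell.2 ⟨hJ, hua⟩
  rw [this, mom_singleton hx]

/-- If the two edges were parallel, every moment with the circle of `u` would contain `E x²` or `E
x`, both zero off the diagonal. -/
lemma sc_eq_zero_of_kappa_ne_zero (hx : IsWigner P x) (hi : Setoid.ker i = p)
    (h : kappa (momJ P x i) ≠ 0) {a : Sym2 (Set (Pt m))} (hd : ¬ a.IsDiag)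
    (ha : #(cell p Set.univ a) = 2) : sc p ℚ Set.univ a = 0 := by
  obtain ⟨u, v, huv, hc⟩ := card_eq_two.1 ha
  have hua : en p u = a := (mem_cell.1 (hc.symm.subset (mem_insert_self u {v}))).2
  have hva : en p v = a :=
    (mem_cell.1 (hc.symm.subset (mem_insert_of_mem (mem_singleton_self v)))).2
  rcases par_or_opp (hua.trans hva.symm) with hpar | hopp
  · exfalso
    refine h (kappa_eq_zero (j := u.1) fun J hJ => momJ_eq_zero hx hi (a := a) ?_)
    by_cases hv : v.1 ∈ J
    · have : cell p J a = {u, v} := by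
        ext w
        rw [← hc, mem_cell, mem_cell]
        refine ⟨fun hw => ⟨trivial, hw.2⟩, fun hw => ⟨?_, hw.2⟩⟩
        have hw' : w ∈ cell p Set.univ a := mem_cell.2 hw
        rw [hc, mem_insert, mem_singleton] at hw'
        rcases hw' with rfl | rfl <;> assumption
      rw [this, mom_pair_of_par hx hi huv hpar (hua ▸ hd)]
    · have : cell p J a = {u} := by
        ext w
        rw [mem_cell, mem_singleton]
        constructor
        · rintro ⟨hw, hwa⟩
          have hw' : w ∈ cell p Set.univ a := mem_cell.2 ⟨trivial, hwa⟩
          rw [hc, mem_insert, mem_singleton] at hw'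
          rcases hw' with rfl | rfl
          · rfl
          · exact absurd hw hv
        · rintro rfl; exact ⟨hJ, hua⟩
      rw [this, mom_singleton hx]
  · rw [sc, hc, sum_pair huv]
    exact hopp.sg_add (hua ▸ hd)

end Cumulant

/-! ### Balance forced by the number of vertices -/

lemma sum_cell_le (h2 : ∀ a ∈ EJ p Set.univ, 2 ≤ #(cell p Set.univ a))
    (hE : 2 * #(EJ p Set.univ) + 2 = #(onJ m Set.univ)) {A : Finset (Sym2 (Set (Pt m)))}
    (hA : A ⊆ EJ p Set.univ) : ∑ a ∈ A, #(cell p Set.univ a) ≤ 2 * #A + 2 := by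
  have h3 := card_onJ_eq_sum p Set.univ
  rw [← sum_sdiff hA] at h3
  have h4 : #(EJ p Set.univ \ A) * 2 ≤ ∑ a ∈ EJ p Set.univ \ A, #(cell p Set.univ a) := by
    rw [← smul_eq_mul, ← sum_const]
    exact sum_le_sum fun a ha => h2 a (mem_sdiff.1 ha).1
  have h5 := card_sdiff_add_card_eq_card hA
  omega

/-- If every class has at least two edges, and classes of two edges which are not loops are
balanced, then the number of vertices forces all classes to be balanced. -/
lemma balanced_of_two_le (hb : Base p) (h2 : ∀ a ∈ EJ p Set.univ, 2 ≤ #(cell p Set.univ a))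
    (hs : ∀ a, ¬ a.IsDiag → #(cell p Set.univ a) = 2 → sc p ℚ Set.univ a = 0) : Balanced p := by
  have hV := hb.card
  have hconn := hb.share.conn
  have hle := two_mul_card_EJ_le h2
  have hVE := hconn.card_le
  have hempty : ∀ a, a ∉ EJ p Set.univ → #(cell p Set.univ a) = 0 := fun a ha => by
    rw [card_eq_zero, ← not_nonempty_iff_eq_empty, cell_nonempty]; exact ha
  have hannF : Ann p Set.univ (sc p (ZMod 2) Set.univ) := ann_sc p subset_rfl
  have hannQ : Ann p Set.univ (sc p ℚ Set.univ) := ann_sc p subset_rfl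
  -- Classes of size at least two give 2E ≤ m, and V ≤ E + 1 gives 2E ≥ m - 4; since m = 2V + 2 is
  -- even, three values remain.
  have hcases : 2 * #(EJ p Set.univ) = #(onJ m Set.univ) ∨
      2 * #(EJ p Set.univ) + 2 = #(onJ m Set.univ) ∨
      2 * #(EJ p Set.univ) + 4 = #(onJ m Set.univ) := by omega
  rcases hcases with hE | hE | hE
  · have hc := cell_eq_two h2 hE.ge
    refine ⟨fun a => ?_, fun a hd => ?_⟩
    · by_cases ha : a ∈ EJ p Set.univ
      · rw [hc a ha]; exact even_two
      · rw [hempty a ha]; exact Even.zero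
    · by_cases ha : a ∈ EJ p Set.univ
      · exact hs a hd (hc a ha)
      · exact sc_eq_zero_of_notMem p ha
  · have hodd : ∀ a, ¬ Even #(cell p Set.univ a) →
        a ∈ EJ p Set.univ ∧ 3 ≤ #(cell p Set.univ a) := by
      intro a ha
      have hm : a ∈ EJ p Set.univ := by
        by_contra h
        exact ha (by rw [hempty a h]; exact Even.zero)
      refine ⟨hm, ?_⟩
      have := h2 a hm
      by_contra h
      exact ha (by rw [show #(cell p Set.univ a) = 2 by omega]; exact even_two)
    -- The sizes exceed two by a total of 2, so at most two classes are odd.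
    have hthree : ∀ a b c, a ≠ b → a ≠ c → b ≠ c → ¬ Even #(cell p Set.univ a) →
        ¬ Even #(cell p Set.univ b) → Even #(cell p Set.univ c) := by
      intro a b c hab hac hbc ha hb'
      by_contra hc
      have h3 := sum_cell_le h2 hE (A := {a, b, c}) (by
        intro d hd
        simp only [mem_insert, mem_singleton] at hd
        rcases hd with rfl | rfl | rfl
        exacts [(hodd _ ha).1, (hodd _ hb').1, (hodd _ hc).1])
      rw [sum_insert (by simp [hab, hac]), sum_pair hbc, card_eq_three.2 ⟨a, b, c, hab, hac, hbc, rfl⟩]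
        at h3
      have := (hodd _ ha).2
      have := (hodd _ hb').2
      have := (hodd _ hc).2
      omega
    have hloop : ∀ a, ¬ Even #(cell p Set.univ a) → a.IsDiag := by
      intro a ha
      by_contra hd
      have key : ∀ B ∈ a, (∀ b, b ≠ a → B ∈ b → ¬ b.IsDiag → Even #(cell p Set.univ b)) → False := by
        intro B hB h
        exact ha (even_of_sc_eq_zero (hannF.eq_zero (hodd a ha).1 hd hB fun b _ hba hBb hbd =>
          sc_eq_zero_of_even (h b hba hBb hbd)))
      -- An edge `a` that is not a loop has an end outside any other odd class `b`; at that end `a`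
      -- alone would carry the parity functional.
      by_cases hex : ∃ b, b ≠ a ∧ ¬ Even #(cell p Set.univ b)
      · obtain ⟨b, hba, hbo⟩ := hex
        obtain ⟨B, hB, hBb⟩ : ∃ B ∈ a, B ∉ b := by
          by_contra! hall
          have hne : (Quot.out a).1 ≠ (Quot.out a).2 := by
            rwa [← sym2_out_eq a, Sym2.mk_isDiag_iff] at hd
          have := (Sym2.mem_and_mem_iff hne).1
            ⟨hall _ (Sym2.out_fst_mem a), hall _ (Sym2.out_snd_mem a)⟩
          rw [sym2_out_eq] at this
          exact hba this
        refine key B hB fun c hca hBc _ => ?_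
        refine hthree a b c hba.symm hca.symm ?_ ha hbo
        rintro rfl
        exact hBb hBc
      · push Not at hex
        exact key _ (Sym2.out_fst_mem a) fun b hba _ _ => hex b hba
    have heven : ∀ a, Even #(cell p Set.univ a) := by
      intro a
      by_contra ha
      -- Two odd loops would be independent functionals, against V = E; a single odd class
      -- contradicts that m is even.
      by_cases hex : ∃ b, b ≠ a ∧ ¬ Even #(cell p Set.univ b)
      · obtain ⟨b, hba, hbo⟩ := hex
        have := hconn.card_lt_of_ann (ann_single_of_isDiag (K := ℚ) (hloop a ha))
          (ann_single_of_isDiag (K := ℚ) (hloop b hbo)) (hodd a ha).1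
          (by rw [Pi.single_eq_same]; exact one_ne_zero)
          (fun r => ⟨b, (hodd b hbo).1, by
            rw [Pi.single_eq_same, Pi.single_eq_of_ne hba, mul_zero]; exact zero_ne_one⟩)
        omega
      · push Not at hex
        have h3 := card_onJ_eq_sum p Set.univ
        rw [← add_sum_erase _ _ (hodd a ha).1] at h3
        have h4 : Even (∑ b ∈ (EJ p Set.univ).erase a, #(cell p Set.univ b)) :=
          even_sum _ fun b hb => hex b (mem_erase.1 hb).1
        have h5 : Even #(onJ m Set.univ) := ⟨#(VJ p Set.univ) + 1, by omega⟩
        rw [h3] at h5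
        exact ha ((Nat.even_add.1 h5).2 h4)
    refine ⟨heven, fun a hd => ?_⟩
    by_cases ha : a ∈ EJ p Set.univ
    · by_cases ha2 : #(cell p Set.univ a) = 2
      · exact hs a hd ha2
      -- An even class with more than two edges absorbs the whole excess, so all other classes have
      -- exactly two.
      · refine hannQ.eq_zero ha hd (Sym2.out_fst_mem a) fun b hb hba _ hbd => hs b hbd ?_
        have h3 := sum_cell_le h2 hE (A := {a, b}) (by
          intro d hd
          simp only [mem_insert, mem_singleton] at hd
          rcases hd with rfl | rfl <;> assumption)
        rw [sum_pair hba.symm, card_pair hba.symm] at h3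
        have := h2 a ha
        have := h2 b hb
        obtain ⟨r, hr⟩ := heven a
        omega
    · exact sc_eq_zero_of_notMem p ha
  · refine ⟨fun a => even_of_sc_eq_zero ?_, fun a _ => ?_⟩
    · by_contra h
      have := hconn.card_le_of_ann hannF (not_imp_comm.1 (sc_eq_zero_of_notMem p) h) h
      omega
    · by_contra h
      have := hconn.card_le_of_ann hannQ (not_imp_comm.1 (sc_eq_zero_of_notMem p) h) h
      omega

/-! ### The values of the third cumulant -/

lemma cell_eq_empty {J : Set (Fin 3)} {a : Sym2 (Set (Pt m))} (h : a ∉ EJ p J) :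
    cell p J a = ∅ := by
  rwa [← not_nonempty_iff_eq_empty, cell_nonempty]

lemma card_cell_of_allDouble {J : Set (Fin 3)} (h : (TOn p J).AllDouble)
    (a : Sym2 (Set (Pt m))) : #(cell p J a) = if a ∈ EJ p J then 2 else 0 := by
  split_ifs with ha
  · exact cell_of_allDouble h ha
  · rw [cell_eq_empty ha, card_empty]

section Values

variable {Ω : Type*} {N : ℕ} {x : Fin N → Fin N → Ω → ℂ} {i : Pt m → Fin N}

/-- In each class the entries of the edges of `TOn p J` multiply to a power of the absolute
value. -/
def Paired (x : Fin N → Fin N → Ω → ℂ) (i : Pt m → Fin N) (p : Setoid (Pt m))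
    (J : Set (Fin 3)) : Prop :=
  ∀ u ω, ∏ v ∈ cell p J (en p u), entry x i v ω = ((‖entry x i u ω‖ ^ #(cell p J (en p u)) : ℝ) : ℂ)

lemma Paired.union {J J' : Set (Fin 3)} (h : Paired x i p J) (h' : Paired x i p J')
    (hd : Disjoint J J') : Paired x i p (J ∪ J') := by
  intro u ω
  have hcell : cell p (J ∪ J') (en p u) = cell p J (en p u) ∪ cell p J' (en p u) := by
    ext v; simp only [mem_cell, mem_union, Set.mem_union, or_and_right]
  have hdc : Disjoint (cell p J (en p u)) (cell p J' (en p u)) := by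
    rw [Finset.disjoint_left]
    intro v hv hv'
    exact Set.disjoint_left.1 hd (mem_cell.1 hv).1 (mem_cell.1 hv').1
  rw [cell_union hd, hcell, prod_union hdc, h u ω, h' u ω, pow_add]
  push_cast
  rfl

variable [MeasurableSpace Ω] {P : Measure Ω}

lemma paired_of_allDouble (hx : IsWigner P x) (hi : Setoid.ker i = p) {J : Set (Fin 3)}
    (h : (TOn p J).AllDouble) : Paired x i p J := by
  intro u ω
  by_cases hu : en p u ∈ EJ p J
  · obtain ⟨y, z, hyz, hc, ho⟩ := allDouble_iff.1 h _ hu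
    have hy : y ∈ cell p J (en p u) := by rw [hc]; simp
    rw [hc, prod_pair hyz, card_pair hyz, entry_eq_conj_of_opp hx hi ho, Complex.mul_conj,
      norm_entry_eq hx hi (mem_cell.1 hy).2.symm, Complex.normSq_eq_norm_sq]
  · rw [cell_eq_empty hu]; simp

/-- The absolute moments of the entry which belongs to `e_u`. -/
def absMom (P : Measure Ω) (x : Fin N → Fin N → Ω → ℂ) (i : Pt m → Fin N) (u : Pt m) (n : ℕ) : ℝ :=
  ∫ ω, ‖entry x i u ω‖ ^ n ∂P

lemma Paired.mom_eq {J : Set (Fin 3)} (h : Paired x i p J) (u : Pt m) :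
    mom P x i (cell p J (en p u)) = (absMom P x i u #(cell p J (en p u)) : ℂ) := by
  rw [mom, absMom, ← integral_complex_ofReal]
  exact integral_congr_ae (Filter.Eventually.of_forall fun ω => h u ω)

lemma absMom_two (hx : IsWigner P x) (u : Pt m) : absMom P x i u 2 = 1 := hx.variance _ _

/-- Whether the entry is diagonal depends on `p` only, and absolute moments are the same for all
entries of one kind, also across the diagonal by self-adjointness. -/
lemma absMom_eq (hx : IsWigner P x) {i' : Pt m → Fin N} (hi : Setoid.ker i = p)
    (hi' : Setoid.ker i' = p) (u : Pt m) (n : ℕ) : absMom P x i u n = absMom P x i' u n := by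
  have hid : ∀ {a b c d : Fin N}, IdentDistrib (x a b) (x c d) P P →
      ∫ ω, ‖x a b ω‖ ^ n ∂P = ∫ ω, ‖x c d ω‖ ^ n ∂P := fun h =>
    (h.comp (u := fun z : ℂ => ‖z‖ ^ n) (by fun_prop)).integral_eq
  have hsymm : ∀ a b, ∫ ω, ‖x a b ω‖ ^ n ∂P = ∫ ω, ‖x b a ω‖ ^ n ∂P := by
    intro a b
    congr 1
    funext ω
    rw [hx.selfAdjoint a b, Complex.norm_conj]
  have hker : ∀ {i : Pt m → Fin N}, Setoid.ker i = p → (i u = i (gam m u) ↔ p u (gam m u)) := by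
    rintro i rfl
    exact Iff.rfl
  change ∫ ω, ‖x (i u) (i (gam m u)) ω‖ ^ n ∂P = ∫ ω, ‖x (i' u) (i' (gam m u)) ω‖ ^ n ∂P
  by_cases h : p u (gam m u)
  · rw [← (hker hi).2 h, ← (hker hi').2 h]
    exact hid (hx.identDistrib_diag _ _)
  · have h1 := fun e => h ((hker hi).1 e)
    have h2 := fun e => h ((hker hi').1 e)
    rcases lt_or_gt_of_ne h1 with k1 | k1 <;> rcases lt_or_gt_of_ne h2 with k2 | k2
    · exact hid (hx.identDistrib_offDiag _ _ _ _ k1 k2)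
    · rw [hsymm (i' u)]; exact hid (hx.identDistrib_offDiag _ _ _ _ k1 k2)
    · rw [hsymm (i u)]; exact hid (hx.identDistrib_offDiag _ _ _ _ k1 k2)
    · rw [hsymm (i u), hsymm (i' u)]; exact hid (hx.identDistrib_offDiag _ _ _ _ k1 k2)

lemma IsTrees.card_cell_union (h : IsTrees p) {j k : Fin 3} (hjk : j ≠ k)
    (a : Sym2 (Set (Pt m))) : #(cell p ({j} ∪ {k}) a)
      = (if a ∈ EJ p {j} then 2 else 0) + if a ∈ EJ p {k} then 2 else 0 := by
  rw [cell_union (disjoint_singleton_of_ne hjk), card_cell_of_allDouble (h.dbl j),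
    card_cell_of_allDouble (h.dbl k)]

lemma IsTrees.card_cell_univ (h : IsTrees p) {j k l : Fin 3} (hjk : j ≠ k) (hjl : j ≠ l)
    (hkl : k ≠ l) (a : Sym2 (Set (Pt m))) : #(cell p Set.univ a)
      = (if a ∈ EJ p {j} then 2 else 0) + ((if a ∈ EJ p {k} then 2 else 0)
        + if a ∈ EJ p {l} then 2 else 0) := by
  rw [← h.card_cell_union hkl, ← card_cell_of_allDouble (h.dbl j), ← compl_singleton_eq hjk hjl hkl,
    ← cell_union disjoint_compl_right, Set.union_compl_self]

lemma IsTrees.paired_union (hx : IsWigner P x) (hi : Setoid.ker i = p) (h : IsTrees p)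
    {j k : Fin 3} (hjk : j ≠ k) : Paired x i p ({j} ∪ {k}) :=
  (paired_of_allDouble hx hi (h.dbl j)).union (paired_of_allDouble hx hi (h.dbl k))
    (disjoint_singleton_of_ne hjk)

lemma IsTrees.paired_univ (hx : IsWigner P x) (hi : Setoid.ker i = p) (h : IsTrees p) :
    Paired x i p Set.univ := by
  rw [← Set.union_compl_self {(0 : Fin 3)}]
  refine (paired_of_allDouble hx hi (h.dbl 0)).union ?_ disjoint_compl_right
  rw [compl_singleton_eq (i := 0) (j := 1) (k := 2) (by decide) (by decide) (by decide)]
  exact h.paired_union hx hi (by decide)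

variable [IsProbabilityMeasure P]

/-- Classes of multiplicity two contribute `E|x|² = 1`, so only the exceptional classes in `A`
matter. -/
lemma momJ_eq_prod_of_paired (hx : IsWigner P x) (hi : Setoid.ker i = p) {J : Set (Fin 3)}
    (h : Paired x i p J) {A : Finset (Sym2 (Set (Pt m)))} (hA : A ⊆ EJ p Set.univ)
    (hc : ∀ a ∉ A, #(cell p J a) = 0 ∨ #(cell p J a) = 2) :
    momJ P x i J = ∏ a ∈ A, mom P x i (cell p J a) := by
  rw [momJ_eq_prod hx hi]
  symm
  refine prod_subset hA fun a ha haA => ?_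
  rcases hc a haA with h0 | h0
  · rw [card_eq_zero.1 h0, mom_empty]
  · obtain ⟨u, -, rfl⟩ := mem_EJ.1 ha
    rw [h.mom_eq, h0, absMom_two hx, Complex.ofReal_one]

lemma momJ_of_allDouble (hx : IsWigner P x) (hi : Setoid.ker i = p) {J : Set (Fin 3)}
    (h : (TOn p J).AllDouble) : momJ P x i J = 1 := by
  rw [momJ_eq_prod_of_paired hx hi (paired_of_allDouble hx hi h) (empty_subset _), prod_empty]
  intro a _
  rw [card_cell_of_allDouble h]
  split_ifs
  exacts [Or.inr rfl, Or.inl rfl]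

lemma momJ_singleton_eq_zero (hx : IsWigner P x) (hi : Setoid.ker i = p) {J J' : Set (Fin 3)}
    (hd : Disjoint J J') (hc : ∀ a ∈ EJ p (J ∪ J'), #(cell p (J ∪ J') a) = 2)
    (h : ¬ Disjoint (EJ p J) (EJ p J')) : momJ P x i J = 0 := by
  obtain ⟨a, ha, ha'⟩ := Finset.not_disjoint_iff.1 h
  have h1 := hc a (EJ_mono Set.subset_union_left ha)
  rw [cell_union hd] at h1
  have h2 := card_pos.2 (cell_nonempty.2 ha)
  have h3 := card_pos.2 (cell_nonempty.2 ha')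
  obtain ⟨u, hu⟩ := card_eq_one.1 (by omega : #(cell p J a) = 1)
  exact momJ_eq_zero hx hi (a := a) (by rw [hu, mom_singleton hx])

lemma IsBi.kappa_eq (hx : IsWigner P x) (hi : Setoid.ker i = p) (h : IsBi p) :
    kappa (momJ P x i) = 1 := by
  have h0 : ∀ j, momJ P x i {j} = 0 := by
    intro j
    refine momJ_singleton_eq_zero hx hi (disjoint_compl_right (a := ({j} : Set (Fin 3)))) ?_
      (h.share j)
    rw [Set.union_compl_self]
    exact fun a ha => cell_of_allDouble h.dbl ha
  rw [kappa, momJ_of_allDouble hx hi h.dbl]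
  simp [h0]

/-- Circles `j` and `k` alone have a simple edge and mean zero, so only the joint moment and the
product of the two doubled parts survive. -/
lemma IsUni.kappa_eq (hx : IsWigner P x) (hi : Setoid.ker i = p) {l : Fin 3} (h : IsUni p l)
    {u : Pt m} (hu : en p u ∈ EJ p {l}) (hu' : en p u ∈ EJ p {l}ᶜ) :
    kappa (momJ P x i) = (absMom P x i u 4 : ℂ) - 1 := by
  obtain ⟨j, k, hlj, hlk, hjk⟩ := exists_others l
  have hj : ∀ {j k}, l ≠ j → l ≠ k → j ≠ k → momJ P x i {j} = 0 := fun {j k} hlj hlk hjk => by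
    refine momJ_singleton_eq_zero hx hi (disjoint_singleton_of_ne hjk) ?_ (h.meet j k hlj hlk hjk)
    rw [← compl_singleton_eq hlj hlk hjk]
    exact fun a ha => cell_of_allDouble h.dblc ha
  have hp : Paired x i p Set.univ := by
    rw [← Set.union_compl_self {l}]
    exact (paired_of_allDouble hx hi h.dbl).union (paired_of_allDouble hx hi h.dblc)
      disjoint_compl_right
  have hcell : ∀ a, #(cell p Set.univ a)
      = (if a ∈ EJ p {l} then 2 else 0) + if a ∈ EJ p {l}ᶜ then 2 else 0 := by
    intro a
    rw [← card_cell_of_allDouble h.dbl, ← card_cell_of_allDouble h.dblc,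
      ← cell_union disjoint_compl_right, Set.union_compl_self]
  have hU : momJ P x i Set.univ = (absMom P x i u 4 : ℂ) := by
    rw [momJ_eq_prod_of_paired hx hi hp (A := {en p u}) (singleton_subset_iff.2 (mem_EJ_univ hu)),
      prod_singleton, hp.mom_eq, hcell, if_pos hu, if_pos hu']
    intro a ha
    rw [hcell]
    have := h.inter_eq hu hu'
    by_cases h1 : a ∈ EJ p {l} <;> by_cases h2 : a ∈ EJ p {l}ᶜ
    · exact absurd (this.subset (mem_inter.2 ⟨h1, h2⟩)) ha
    · simp [h1, h2]
    · simp [h1, h2]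
    · simp [h1, h2]
  rw [WignerThird.kappa_eq hlj hlk hjk, hU, momJ_of_allDouble hx hi h.dbl,
    momJ_of_allDouble hx hi h.dblc, hj hlj hlk hjk, hj hlk hlj hjk.symm]
  ring

lemma IsTrees.momJ_pair (hx : IsWigner P x) (hi : Setoid.ker i = p) (h : IsTrees p)
    {j k : Fin 3} (hjk : j ≠ k) {u : Pt m} (hu : EJ p {j} ∩ EJ p {k} = {en p u}) :
    momJ P x i ({j} ∪ {k}) = (absMom P x i u 4 : ℂ) := by
  have hm := mem_inter.1 (hu.symm.subset (mem_singleton_self _))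
  have hp := h.paired_union hx hi hjk
  rw [momJ_eq_prod_of_paired hx hi hp (A := {en p u}) (singleton_subset_iff.2 (mem_EJ_univ hm.1)),
    prod_singleton, hp.mom_eq, h.card_cell_union hjk, if_pos hm.1, if_pos hm.2]
  intro a ha
  rw [h.card_cell_union hjk]
  by_cases h1 : a ∈ EJ p {j} <;> by_cases h2 : a ∈ EJ p {k}
  · exact absurd (hu.subset (mem_inter.2 ⟨h1, h2⟩)) ha
  · simp [h1, h2]
  · simp [h1, h2]
  · simp [h1, h2]

lemma IsTrees.kappa_of_common (hx : IsWigner P x) (hi : Setoid.ker i = p) (h : IsTrees p)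
    {u : Pt m} (hu : ∀ l, en p u ∈ EJ p {l}) : kappa (momJ P x i)
      = (absMom P x i u 6 : ℂ) - 3 * (absMom P x i u 4 : ℂ) + 2 := by
  have h01 : (0 : Fin 3) ≠ 1 := by decide
  have h02 : (0 : Fin 3) ≠ 2 := by decide
  have h12 : (1 : Fin 3) ≠ 2 := by decide
  have hpair : ∀ {j k : Fin 3}, j ≠ k → momJ P x i ({j} ∪ {k}) = (absMom P x i u 4 : ℂ) :=
    fun {j k} hjk => h.momJ_pair hx hi hjk (eq_singleton_iff_unique_mem.2
      ⟨mem_inter.2 ⟨hu j, hu k⟩, fun c hc =>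
        h.common_unique hu hjk (mem_inter.1 hc).1 (mem_inter.1 hc).2⟩)
  have hp := h.paired_univ hx hi
  have hU : momJ P x i Set.univ = (absMom P x i u 6 : ℂ) := by
    rw [momJ_eq_prod_of_paired hx hi hp (A := {en p u})
      (singleton_subset_iff.2 (mem_EJ_univ (hu 0))), prod_singleton, hp.mom_eq,
      h.card_cell_univ h01 h02 h12, if_pos (hu 0), if_pos (hu 1), if_pos (hu 2)]
    intro a ha
    have k : ∀ {j k : Fin 3}, j ≠ k → a ∈ EJ p {j} → a ∉ EJ p {k} := fun hjk h1 h2 =>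
      ha (mem_singleton.2 (h.common_unique hu hjk h1 h2))
    rw [h.card_cell_univ h01 h02 h12]
    by_cases h0 : a ∈ EJ p {0}
    · simp [h0, k h01 h0, k h02 h0]
    by_cases h1 : a ∈ EJ p {1}
    · simp [h0, h1, k h12 h1]
    by_cases h2 : a ∈ EJ p {2} <;> simp [h0, h1, h2]
  rw [WignerThird.kappa_eq h01 h02 h12, hU, compl_singleton_eq h01 h02 h12,
    compl_singleton_eq h01.symm h12 h02, compl_singleton_eq h02.symm h12.symm h01, hpair h01,
    hpair h02, hpair h12, momJ_of_allDouble hx hi (h.dbl 0), momJ_of_allDouble hx hi (h.dbl 1),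
    momJ_of_allDouble hx hi (h.dbl 2)]
  ring

/-- With α and β the fourth moments at the two gluing edges, the cumulant is αβ - (α + β + 1) + 2.
-/
lemma IsTrees.kappa_of_path (hx : IsWigner P x) (hi : Setoid.ker i = p) (h : IsTrees p)
    {j k l : Fin 3} (hjk : j ≠ k) (hjl : j ≠ l) (hkl : k ≠ l) {u v : Pt m}
    (huv : en p u ≠ en p v) (hu : EJ p {j} ∩ EJ p {k} = {en p u})
    (hv : EJ p {k} ∩ EJ p {l} = {en p v}) (he : EJ p {j} ∩ EJ p {l} = ∅) :
    kappa (momJ P x i) = ((absMom P x i u 4 : ℂ) - 1) * ((absMom P x i v 4 : ℂ) - 1) := by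
  have hp := h.paired_univ hx hi
  have mu := mem_inter.1 (hu.symm.subset (mem_singleton_self _))
  have mv := mem_inter.1 (hv.symm.subset (mem_singleton_self _))
  have k1 : ∀ a, a ∈ EJ p {j} → a ∉ EJ p {l} := fun a h1 h2 =>
    notMem_empty a (he.subset (mem_inter.2 ⟨h1, h2⟩))
  have hU : momJ P x i Set.univ = (absMom P x i u 4 : ℂ) * (absMom P x i v 4 : ℂ) := by
    rw [momJ_eq_prod_of_paired hx hi hp (A := {en p u, en p v}) (by
        intro a ha
        rw [mem_insert, mem_singleton] at ha
        rcases ha with rfl | rfl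
        exacts [mem_EJ_univ mu.1, mem_EJ_univ mv.1]), prod_pair huv, hp.mom_eq, hp.mom_eq,
      h.card_cell_univ hjk hjl hkl, h.card_cell_univ hjk hjl hkl, if_pos mu.1, if_pos mu.2,
      if_neg (k1 _ mu.1), if_neg (fun e => k1 _ e mv.2), if_pos mv.1, if_pos mv.2]
    intro a ha
    rw [mem_insert, mem_singleton, not_or] at ha
    have k2 : a ∈ EJ p {j} → a ∉ EJ p {k} := fun h1 h2 =>
      ha.1 (mem_singleton.1 (hu.subset (mem_inter.2 ⟨h1, h2⟩)))
    have k3 : a ∈ EJ p {k} → a ∉ EJ p {l} := fun h1 h2 =>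
      ha.2 (mem_singleton.1 (hv.subset (mem_inter.2 ⟨h1, h2⟩)))
    rw [h.card_cell_univ hjk hjl hkl]
    by_cases h0 : a ∈ EJ p {j}
    · simp [h0, k2 h0, k1 a h0]
    by_cases h1 : a ∈ EJ p {k}
    · simp [h0, h1, k3 h1]
    by_cases h2 : a ∈ EJ p {l} <;> simp [h0, h1, h2]
  have hJL : momJ P x i ({j} ∪ {l}) = 1 := by
    rw [momJ_union hx hi (disjoint_iff_inter_eq_empty.2 he), momJ_of_allDouble hx hi (h.dbl j),
      momJ_of_allDouble hx hi (h.dbl l), one_mul]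
  rw [WignerThird.kappa_eq hjk hjl hkl, hU, compl_singleton_eq hjk hjl hkl,
    compl_singleton_eq hjk.symm hkl hjl, compl_singleton_eq hjl.symm hkl.symm hjk, hJL,
    h.momJ_pair hx hi hjk hu, h.momJ_pair hx hi hkl hv, momJ_of_allDouble hx hi (h.dbl j),
    momJ_of_allDouble hx hi (h.dbl k), momJ_of_allDouble hx hi (h.dbl l)]
  ring

end Values

/-! ### Limit graphs -/

lemma natCard_pt : Nat.card (Pt m) = m 0 + m 1 + m 2 := by
  rw [Nat.card_eq_fintype_card, Fintype.card_sigma, Fin.sum_univ_three]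
  simp

lemma numBlocks_edgePartition (p : Setoid (Pt m)) :
    numBlocks (edgePartition p) = #(EJ p Set.univ) := by
  have h : EJ p Set.univ = univ.image (en p) := by simp [EJ, onJ]
  have : Nat.card (Set.range (en p)) = #(univ.image (en p)) := by
    rw [Nat.card_eq_fintype_card, ← Set.toFinset_card, Set.toFinset_range]
  rw [h, ← this]
  exact Nat.card_congr (Setoid.quotientKerEquivRange (en p))

lemma q_eq_iff : q p = -1 ↔ 2 * #(VJ p Set.univ) + 2 = #(onJ m Set.univ) := by
  rw [q, q₁, q₂, numBlocks_eq, numBlocks_edgePartition, card_onJ_univ, natCard_pt,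
    ← Nat.cast_inj (R := ℚ)]
  push_cast
  constructor <;> intro h <;> linarith

lemma q₁_q₂_eq_iff : (q₁ p, q₂ p) = (-1, 0) ↔ 2 * #(VJ p Set.univ) + 2 = #(onJ m Set.univ) ∧
    2 * #(EJ p Set.univ) = #(onJ m Set.univ) := by
  rw [Prod.mk.injEq, q₁, q₂, numBlocks_eq, numBlocks_edgePartition, card_onJ_univ, natCard_pt,
    ← Nat.cast_inj (R := ℚ), ← Nat.cast_inj (R := ℚ)]
  push_cast
  constructor <;> rintro ⟨h, h'⟩ <;> constructor <;> linarith

lemma T_injective : Function.Injective (T (m := m)) := by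
  intro p p' h
  have h1 : ∀ x, block p x = block p' x := fun x => congrFun (congrArg OGraph.tgt h) x
  refine Setoid.ext fun x y => ?_
  rw [← block_eq_iff, ← block_eq_iff, h1, h1]

lemma exists_ker_eq {N : ℕ} (h : numBlocks p ≤ N) : ∃ i : Pt m → Fin N, Setoid.ker i = p := by
  obtain ⟨e⟩ : Nonempty (Quotient p ↪ Fin N) :=
    Function.Embedding.nonempty_of_card_le (by
      rw [Fintype.card_fin, ← Nat.card_eq_fintype_card]; exact h)
  refine ⟨fun u => e (Quotient.mk p u), Setoid.ext fun u v => ?_⟩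
  rw [Setoid.ker_def, e.injective.eq_iff]
  exact Quotient.eq

/-- A partition of one of the three kinds of structures that contribute to the limit. -/
def IsStructured (p : Setoid (Pt m)) : Prop := IsTrees p ∨ (∃ i, IsUni p i) ∨ IsBi p

lemma IsStructured.base (h : IsStructured p) : Base p := by
  rcases h with h | ⟨i, h⟩ | h
  exacts [h.toBase, h.toBase, h.toBase]

section Limit

variable {Ω : Type*} [MeasurableSpace Ω] {P : Measure Ω} [IsProbabilityMeasure P]
  {N : ℕ} {x : Fin N → Fin N → Ω → ℂ}

lemma IsStructured.exists_kappa (hx : IsWigner P x)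
    (h_off4 : ∀ a b, a ≠ b → (∫ ω, ‖x a b ω‖ ^ 4 ∂P) ≠ 1)
    (h_diag4 : ∀ a, (∫ ω, ‖x a a ω‖ ^ 4 ∂P) ≠ 1)
    (h_off6 : ∀ a b, a ≠ b →
      (∫ ω, ‖x a b ω‖ ^ 6 ∂P) - 3 * (∫ ω, ‖x a b ω‖ ^ 4 ∂P) + 2 ≠ 0)
    (h : IsStructured p) {i₀ : Pt m → Fin N} (hi₀ : Setoid.ker i₀ = p) :
    ∃ κ : ℂ, κ ≠ 0 ∧ ∀ i : Pt m → Fin N, Setoid.ker i = p → kappa (momJ P x i) = κ := by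
  have hne : ∀ u, ¬ (en p u).IsDiag → i₀ u ≠ i₀ (gam m u) := by
    intro u hd e
    refine hd (en_isDiag_iff.2 ?_)
    rw [block_eq_iff, ← hi₀]
    exact e.symm
  have h4 : ∀ u, absMom P x i₀ u 4 ≠ 1 := by
    intro u
    unfold absMom entry
    by_cases e : i₀ u = i₀ (gam m u)
    · rw [← e]; exact h_diag4 _
    · exact h_off4 _ _ e
  rcases h with h | ⟨l, h⟩ | h
  · by_cases hc : ∃ a, ∀ l, a ∈ EJ p {l}
    · obtain ⟨a, ha⟩ := hc
      obtain ⟨u, -, rfl⟩ := mem_EJ.1 (ha 0)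
      refine ⟨((absMom P x i₀ u 6 - 3 * absMom P x i₀ u 4 + 2 : ℝ) : ℂ), ?_, fun i hi => ?_⟩
      · exact Complex.ofReal_ne_zero.2
          (h_off6 _ _ (hne u (h.not_isDiag (mem_EJ_univ (ha 0)))))
      · rw [h.kappa_of_common hx hi ha, absMom_eq hx hi hi₀, absMom_eq hx hi hi₀]
        push_cast; rfl
    · obtain ⟨j, k, l, a, b, hjk, hjl, hkl, hab, ha, hb, he⟩ := h.exists_path hc
      obtain ⟨u, -, rfl⟩ := mem_EJ.1 (mem_inter.1 (ha.symm.subset (mem_singleton_self a))).1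
      obtain ⟨v, -, rfl⟩ := mem_EJ.1 (mem_inter.1 (hb.symm.subset (mem_singleton_self b))).1
      refine ⟨(((absMom P x i₀ u 4 - 1) * (absMom P x i₀ v 4 - 1) : ℝ) : ℂ), ?_, fun i hi => ?_⟩
      · exact Complex.ofReal_ne_zero.2
          (mul_ne_zero (sub_ne_zero.2 (h4 u)) (sub_ne_zero.2 (h4 v)))
      · rw [h.kappa_of_path hx hi hjk hjl hkl hab ha hb he, absMom_eq hx hi hi₀,
          absMom_eq hx hi hi₀]
        push_cast; rfl
  · obtain ⟨a, ha⟩ := Finset.not_disjoint_iff.1 (h.share l)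
    obtain ⟨u, -, rfl⟩ := mem_EJ.1 ha.1
    refine ⟨((absMom P x i₀ u 4 - 1 : ℝ) : ℂ), ?_, fun i hi => ?_⟩
    · exact Complex.ofReal_ne_zero.2 (sub_ne_zero.2 (h4 u))
    · rw [h.kappa_eq hx hi ha.1 ha.2, absMom_eq hx hi hi₀]
      push_cast; rfl
  · exact ⟨1, one_ne_zero, fun i hi => h.kappa_eq hx hi⟩

lemma isLimitPartition_iff (hm : ∀ j, 0 < m j) (hN : m 0 + m 1 + m 2 ≤ 2 * N + 2)
    (hx : IsWigner P x)
    (h_off4 : ∀ a b, a ≠ b → (∫ ω, ‖x a b ω‖ ^ 4 ∂P) ≠ 1)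
    (h_diag4 : ∀ a, (∫ ω, ‖x a a ω‖ ^ 4 ∂P) ≠ 1)
    (h_off6 : ∀ a b, a ≠ b →
      (∫ ω, ‖x a b ω‖ ^ 6 ∂P) - 3 * (∫ ω, ‖x a b ω‖ ^ 4 ∂P) + 2 ≠ 0) :
    IsLimitPartition P x p ↔ IsStructured p := by
  unfold IsLimitPartition contribution
  simp only [k₃_eq_kappa]
  constructor
  · rintro ⟨hq, hc⟩
    obtain ⟨i, hi, hne⟩ := exists_ne_zero_of_sum_ne_zero hc
    have hi : Setoid.ker i = p := (mem_filter.1 hi).2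
    have hk := right_ne_zero_of_mul hne
    have hb : Base p := ⟨q_eq_iff.1 hq, share_of_kappa_ne_zero hx hi hk⟩
    exact classification hb (balanced_of_two_le hb
      (fun a ha => two_le_cell_of_kappa_ne_zero hx hi hk ha)
      (fun a hd ha => sc_eq_zero_of_kappa_ne_zero hx hi hk hd ha))
  · intro h
    have hb := h.base
    refine ⟨q_eq_iff.2 hb.card, ?_⟩
    have hcard := hb.card
    rw [card_onJ_univ, natCard_pt] at hcard
    -- The bound on `N` is what m/2 - 1 distinct indices require; it makes the sum nonempty.
    obtain ⟨i₀, hi₀⟩ := exists_ker_eq (p := p) (N := N) (by rw [numBlocks_eq]; omega)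
    obtain ⟨κ, hκ, hval⟩ := h.exists_kappa hx h_off4 h_diag4 h_off6 hi₀
    rw [sum_congr rfl fun i hi => by rw [hval i (mem_filter.1 hi).2], sum_const, nsmul_eq_mul]
    have hNpos : 0 < N := by
      have h0 := hm 0
      have h1 := hm 1
      have h2 := hm 2
      omega
    refine mul_ne_zero (Nat.cast_ne_zero.2 (card_pos.2 ⟨i₀, by simpa using hi₀⟩).ne')
      (mul_ne_zero (Complex.ofReal_ne_zero.2 (Real.rpow_pos_of_pos ?_ _).ne') hκ)
    exact_mod_cast hNpos

end Limit

/-! ### The counts -/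

instance finite_setoid : Finite (Setoid (Pt m)) :=
  Finite.of_injective (fun p : Setoid (Pt m) => p.r) fun _ _ h => Setoid.ext fun x y => by
    exact iff_of_eq (congrFun (congrFun h x) y)

/-- The class of multiplicity four does not depend on the choice of the distinguished circle, and it
is either a loop or not. -/
lemma not_isUnicircuit24_of_isUniloop24 (hm : ∀ j, 0 < m j) (h : IsUniloop24 p) :
    ¬ IsUnicircuit24 p := by
  rw [isUnicircuit24_iff hm]
  rintro ⟨j, hj, b, hb, hb', hbd⟩
  obtain ⟨i, hi, a, ha, ha', had⟩ := (isUniloop24_iff hm).1 h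
  have hcell : ∀ {i}, IsUni p i → ∀ b, #(cell p Set.univ b)
      = (if b ∈ EJ p {i} then 2 else 0) + if b ∈ EJ p {i}ᶜ then 2 else 0 := by
    intro i hi b
    rw [← card_cell_of_allDouble hi.dbl, ← card_cell_of_allDouble hi.dblc,
      ← cell_union disjoint_compl_right, Set.union_compl_self]
  have h1 := hcell hj b
  rw [if_pos hb, if_pos hb', hcell hi b] at h1
  have h2 : b ∈ EJ p {i} ∧ b ∈ EJ p {i}ᶜ := by
    by_cases k1 : b ∈ EJ p {i} <;> by_cases k2 : b ∈ EJ p {i}ᶜ <;> simp [k1, k2] at h1 ⊢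
  have h3 := mem_singleton.1 ((hi.inter_eq ha ha').subset (mem_inter.2 h2))
  exact hbd (h3 ▸ had)

lemma isStructured_iff (hm : ∀ j, 0 < m j) : IsStructured p ↔
    IsTree26 p ∨ IsTree244 p ∨ IsUniloop24 p ∨ IsUnicircuit24 p ∨ IsBi p := by
  rw [isTree26_iff hm, isTree244_iff hm, isUniloop24_iff hm, isUnicircuit24_iff hm]
  constructor
  · rintro (h | ⟨i, h⟩ | h)
    · by_cases hc : ∃ a, ∀ l, a ∈ EJ p {l}
      · exact Or.inl ⟨h, hc⟩
      · exact Or.inr (Or.inl ⟨h, hc⟩)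
    · obtain ⟨a, ha, ha'⟩ := Finset.not_disjoint_iff.1 (h.share i)
      by_cases hd : a.IsDiag
      · exact Or.inr (Or.inr (Or.inl ⟨i, h, a, ha, ha', hd⟩))
      · exact Or.inr (Or.inr (Or.inr (Or.inl ⟨i, h, a, ha, ha', hd⟩)))
    · exact Or.inr (Or.inr (Or.inr (Or.inr h)))
  · rintro (⟨h, -⟩ | ⟨h, -⟩ | ⟨i, h, -⟩ | ⟨i, h, -⟩ | h)
    exacts [Or.inl h, Or.inl h, Or.inr (Or.inl ⟨i, h⟩), Or.inr (Or.inl ⟨i, h⟩), Or.inr (Or.inr h)]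

lemma ncard_Fib_eq_two (hm : ∀ j, 0 < m j) (h : IsTree26 p ∨ IsUniloop24 p) :
    (Fib p).ncard = 2 := by
  rw [isTree26_iff hm, isUniloop24_iff hm] at h
  rcases h with ⟨h, a, ha⟩ | ⟨i, h, a, ha, ha', hd⟩
  · exact h.ncard_of_common ha
  · obtain ⟨f, x, y, d⟩ := h.exists_data
    have := mem_singleton.1 (d.inter.subset (mem_inter.2 ⟨ha, ha'⟩))
    exact d.ncard_of_isDiag (this ▸ hd)

lemma ncard_Fib_eq_one (hm : ∀ j, 0 < m j) (h : IsStructured p)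
    (h26 : ¬ IsTree26 p) (hul : ¬ IsUniloop24 p) : (Fib p).ncard = 1 := by
  rw [isTree26_iff hm] at h26
  rw [isUniloop24_iff hm] at hul
  rcases h with h | ⟨i, h⟩ | h
  · exact h.ncard_of_path fun hc => h26 ⟨h, hc⟩
  · obtain ⟨f, x, y, d⟩ := h.exists_data
    refine d.ncard_of_not_isDiag fun hd => hul ⟨i, h, en p x, ?_, ?_, hd⟩
    · exact mem_EJ.2 ⟨x, d.hx, rfl⟩
    · exact mem_EJ.2 ⟨y, d.hy, d.par.en_eq.symm⟩
  · exact h.ncard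

lemma IsTrees.not_isUni {i : Fin 3} (h : IsTrees p) : ¬ IsUni p i := fun h' => by
  have := h.cardE
  have := h'.cardE
  omega

lemma ncard_isStructured (hm : ∀ j, 0 < m j) : {p : Setoid (Pt m) | IsStructured p}.ncard
    = {p : Setoid (Pt m) | IsTree26 p}.ncard + {p : Setoid (Pt m) | IsTree244 p}.ncard
      + {p : Setoid (Pt m) | IsUniloop24 p}.ncard + {p : Setoid (Pt m) | IsUnicircuit24 p}.ncard
      + {p : Setoid (Pt m) | IsBi p}.ncard := by
  -- The number of classes separates tree, unicircuit and bicircuit types from each other.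
  have hE : ∀ p : Setoid (Pt m), (IsTree26 p ∨ IsTree244 p →
        2 * #(EJ p Set.univ) + 4 = #(onJ m Set.univ)) ∧
      (IsUniloop24 p ∨ IsUnicircuit24 p → 2 * #(EJ p Set.univ) + 2 = #(onJ m Set.univ)) ∧
      (IsBi p → 2 * #(EJ p Set.univ) = #(onJ m Set.univ)) := by
    intro p
    rw [isTree26_iff hm, isTree244_iff hm, isUniloop24_iff hm, isUnicircuit24_iff hm]
    refine ⟨?_, ?_, fun h => h.cardE⟩
    · rintro (⟨h, -⟩ | ⟨h, -⟩) <;> exact h.cardE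
    · rintro (⟨i, h, -⟩ | ⟨i, h, -⟩) <;> exact h.cardE
  have hset : {p : Setoid (Pt m) | IsStructured p} = {p | IsTree26 p} ∪ {p | IsTree244 p}
      ∪ {p | IsUniloop24 p} ∪ {p | IsUnicircuit24 p} ∪ {p | IsBi p} := by
    ext p
    simp only [Set.mem_ofPred_eq, Set.mem_union, isStructured_iff hm, or_assoc]
  rw [hset, Set.ncard_union_eq, Set.ncard_union_eq, Set.ncard_union_eq, Set.ncard_union_eq]
  · rw [Set.disjoint_left]
    intro p h h'
    exact ((isTree244_iff hm).1 h').2 ((isTree26_iff hm).1 h).2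
  · rw [Set.disjoint_left]
    intro p h h'
    have := (hE p).1 h
    have := (hE p).2.1 (Or.inl h')
    omega
  · rw [Set.disjoint_left]
    rintro p (h | h) h'
    · have := (hE p).1 h
      have := (hE p).2.1 (Or.inr h')
      omega
    · exact not_isUnicircuit24_of_isUniloop24 hm h h'
  · rw [Set.disjoint_left]
    rintro p ((h | h) | h) h'
    · have := (hE p).1 h
      have := (hE p).2.2 h'
      omega
    · have := (hE p).2.1 (Or.inl h)
      have := (hE p).2.2 h'
      omega
    · have := (hE p).2.1 (Or.inr h)
      have := (hE p).2.2 h'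
      omega

lemma not_isTree26_and_isUniloop24 (hm : ∀ j, 0 < m j) (h : IsTree26 p) : ¬ IsUniloop24 p := by
  intro h'
  obtain ⟨i, hi, -⟩ := (isUniloop24_iff hm).1 h'
  exact ((isTree26_iff hm).1 h).1.not_isUni hi

lemma isStructured_of_mem_NC2 (hm : ∀ j, 0 < m j) {f : Equiv.Perm (Pt m)} (hf : f ∈ NC2 m) :
    IsStructured (cyclePartition (gam m * f)) :=
  let h := base_balanced_of_mem_NC2 hm hf
  classification h.1 h.2

lemma ncard_NC2 (hm : ∀ j, 0 < m j) : (NC2 m).ncard = {p : Setoid (Pt m) | IsStructured p}.ncard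
    + {p : Setoid (Pt m) | IsUniloop24 p}.ncard + {p : Setoid (Pt m) | IsTree26 p}.ncard := by
  have := Fintype.ofFinite (Setoid (Pt m))
  have hn : ∀ Q : Setoid (Pt m) → Prop, {p | Q p}.ncard = #{p : Setoid (Pt m) | Q p} := by
    intro Q
    rw [← Set.ncard_coe_finset]
    congr 1
    ext p; simp
  have h1 : (NC2 m).ncard = #({f | f ∈ NC2 m} : Finset (Equiv.Perm (Pt m))) := by
    rw [← Set.ncard_coe_finset]
    congr 1
    ext p; simp
  rw [h1, hn, hn, hn, card_eq_sum_card_fiberwise (f := fun f => cyclePartition (gam m * f))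
    (t := {p : Setoid (Pt m) | IsStructured p})
    (fun f hf => by
      rw [mem_coe, mem_filter] at hf ⊢
      exact ⟨mem_univ _, isStructured_of_mem_NC2 hm hf.2⟩)]
  -- Fibre sizes are written as one plus indicators, so that summing them yields the three
  -- cardinalities.
  have hfib : ∀ p ∈ ({p : Setoid (Pt m) | IsStructured p} : Finset (Setoid (Pt m))),
      #{f ∈ ({f | f ∈ NC2 m} : Finset (Equiv.Perm (Pt m))) | cyclePartition (gam m * f) = p}
        = 1 + (if IsUniloop24 p then 1 else 0) + if IsTree26 p then 1 else 0 := by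
    intro p hp
    have hp := (mem_filter.1 hp).2
    have : #{f ∈ ({f | f ∈ NC2 m} : Finset (Equiv.Perm (Pt m))) | cyclePartition (gam m * f) = p}
        = (Fib p).ncard := by
      rw [← hp.base.preimage_eq hm, ← Set.ncard_coe_finset]
      congr 1
      ext f; simp
    rw [this]
    by_cases h26 : IsTree26 p
    · rw [ncard_Fib_eq_two hm (Or.inl h26), if_pos h26,
        if_neg (not_isTree26_and_isUniloop24 hm h26)]
    · by_cases hul : IsUniloop24 p
      · rw [ncard_Fib_eq_two hm (Or.inr hul), if_neg h26, if_pos hul]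
      · rw [ncard_Fib_eq_one hm hp h26 hul, if_neg h26, if_neg hul]
  rw [sum_congr rfl hfib, sum_add_distrib, sum_add_distrib, ← card_eq_sum_ones, ← card_filter,
    ← card_filter, filter_filter, filter_filter]
  congr 3
  · ext p
    simp only [mem_filter, mem_univ, true_and, isStructured_iff hm]
    tauto
  · ext p
    simp only [isStructured_iff hm]
    tauto

lemma ncard_Fib_ne_zero (hm : ∀ j, 0 < m j) (h : IsStructured p) : (Fib p).ncard ≠ 0 := by
  by_cases h' : IsTree26 p ∨ IsUniloop24 p
  · rw [ncard_Fib_eq_two hm h']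
    decide
  · rw [not_or] at h'
    rw [ncard_Fib_eq_one hm h h'.1 h'.2]
    decide

lemma isStructured_iff_exists_mem_NC2 (hm : ∀ j, 0 < m j) :
    IsStructured p ↔ ∃ s ∈ NC2 m, p = cyclePartition (gam m * s) := by
  constructor
  · intro h
    obtain ⟨s, hs⟩ := Set.nonempty_of_ncard_ne_zero (ncard_Fib_ne_zero hm h)
    rw [← h.base.preimage_eq hm] at hs
    exact ⟨s, hs.1, hs.2.symm⟩
  · rintro ⟨s, hs, rfl⟩
    exact isStructured_of_mem_NC2 hm hs

lemma isBi_iff : IsBi p ↔ IsStructured p ∧ (q₁ p, q₂ p) = (-1, 0) := by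
  constructor
  · exact fun h => ⟨Or.inr (Or.inr h), q₁_q₂_eq_iff.2 ⟨h.card, h.cardE⟩⟩
  · rintro ⟨h | ⟨i, h⟩ | h, hq⟩
    · have h1 := h.cardE
      have h2 := (q₁_q₂_eq_iff.1 hq).2
      omega
    · have h1 := h.cardE
      have h2 := (q₁_q₂_eq_iff.1 hq).2
      omega
    · exact h

end WignerThird

end

theorem mainTheorem6 {Ω : Type*} [MeasurableSpace Ω] (P : MeasureTheory.Measure Ω)
    [MeasureTheory.IsProbabilityMeasure P] (m : Fin 3 → ℕ) (hm : ∀ j, 0 < m j)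
    (N : ℕ) (hN : m 0 + m 1 + m 2 ≤ 2 * N + 2)
    (x : Fin N → Fin N → Ω → ℂ) (hx : WignerThird.IsWigner P x)
    (h_off4 : ∀ a b, a ≠ b → (∫ ω, ‖x a b ω‖ ^ 4 ∂P) ≠ 1)
    (h_diag4 : ∀ a, (∫ ω, ‖x a a ω‖ ^ 4 ∂P) ≠ 1)
    (h_off6 : ∀ a b, a ≠ b →
      (∫ ω, ‖x a b ω‖ ^ 6 ∂P) - 3 * (∫ ω, ‖x a b ω‖ ^ 4 ∂P) + 2 ≠ 0) :
    (∀ p : Setoid (WignerThird.Pt m), WignerThird.T p ∈ WignerThird.LG m P x ↔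
      ∃ s ∈ WignerThird.NC2 m,
        p = WignerThird.cyclePartition (WignerThird.gam m * s)) ∧
    Set.MapsTo (WignerThird.pairingGraph m) (WignerThird.NC2 m) (WignerThird.LG m P x) ∧
    Set.SurjOn (WignerThird.pairingGraph m) (WignerThird.NC2 m) (WignerThird.LG m P x) ∧
    (∀ G ∈ WignerThird.T26 m ∪ WignerThird.UL24 m, G ∈ WignerThird.LG m P x ∧
      {s | s ∈ WignerThird.NC2 m ∧ WignerThird.pairingGraph m s = G}.ncard = 2) ∧
    (∀ G ∈ WignerThird.LG m P x, G ∉ WignerThird.T26 m ∪ WignerThird.UL24 m →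
      {s | s ∈ WignerThird.NC2 m ∧ WignerThird.pairingGraph m s = G}.ncard = 1) ∧
    (WignerThird.NC2 m).ncard =
      (WignerThird.LG m P x).ncard + (WignerThird.UL24 m).ncard + (WignerThird.T26 m).ncard ∧
    ((WignerThird.DB m P x).ncard : ℤ) =
      ((WignerThird.NC2 m).ncard : ℤ) - (WignerThird.UC24 m).ncard - (WignerThird.T244 m).ncard
        - 2 * (WignerThird.UL24 m).ncard - 2 * (WignerThird.T26 m).ncard := by
  have hS : ∀ p : Setoid (WignerThird.Pt m),
      WignerThird.IsLimitPartition P x p ↔ WignerThird.IsStructured p :=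
    fun p => WignerThird.isLimitPartition_iff hm hN hx h_off4 h_diag4 h_off6
  have hinj := WignerThird.T_injective (m := m)
  have hLG : WignerThird.LG m P x = WignerThird.T '' {p | WignerThird.IsStructured p} := by
    simp only [WignerThird.LG, hS]
  have hmem : ∀ p : Setoid (WignerThird.Pt m),
      WignerThird.T p ∈ WignerThird.LG m P x ↔ WignerThird.IsStructured p := fun p => by
    rw [hLG, hinj.mem_set_image]
    rfl
  have hmem' : ∀ p : Setoid (WignerThird.Pt m),
      WignerThird.T p ∈ WignerThird.T26 m ∪ WignerThird.UL24 m ↔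
        WignerThird.IsTree26 p ∨ WignerThird.IsUniloop24 p := fun p => by
    rw [Set.mem_union, WignerThird.T26, WignerThird.UL24, hinj.mem_set_image, hinj.mem_set_image]
    rfl
  have hpre : ∀ p : Setoid (WignerThird.Pt m), WignerThird.IsStructured p →
      {s | s ∈ WignerThird.NC2 m ∧ WignerThird.pairingGraph m s = WignerThird.T p}
        = WignerThird.Fib p := fun p hp => by
    simp only [WignerThird.pairingGraph, hinj.eq_iff]
    exact hp.base.preimage_eq hm
  have hDB : WignerThird.DB m P x = WignerThird.T '' {p | WignerThird.IsBi p} := by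
    refine congrArg _ (Set.ext fun p => ?_)
    rw [Set.mem_ofPred_eq, Set.mem_ofPred_eq, WignerThird.isBi_iff, ← hS p, and_comm]
    refine ⟨fun h => ⟨⟨?_, h.1⟩, h.2⟩, fun h => ⟨h.1.2, h.2⟩⟩
    obtain ⟨h1, h2⟩ := Prod.mk.inj h.2
    rw [WignerThird.q, h1, h2, add_zero]
  have hNC := WignerThird.ncard_NC2 hm
  refine ⟨fun p => ?_, fun s hs => ?_, ?_, ?_, ?_, ?_, ?_⟩
  · rw [hmem, WignerThird.isStructured_iff_exists_mem_NC2 hm]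
  · exact (hmem _).2 (WignerThird.isStructured_of_mem_NC2 hm hs)
  · rw [hLG]
    rintro _ ⟨p, hp, rfl⟩
    obtain ⟨s, hs, rfl⟩ := (WignerThird.isStructured_iff_exists_mem_NC2 hm).1 hp
    exact ⟨s, hs, rfl⟩
  · intro G hG
    obtain ⟨p, rfl⟩ : ∃ p, WignerThird.T p = G := by
      rcases hG with ⟨p, -, h⟩ | ⟨p, -, h⟩ <;> exact ⟨p, h⟩
    have hp := (hmem' p).1 hG
    have hst : WignerThird.IsStructured p := (WignerThird.isStructured_iff hm).2 (by tauto)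
    rw [hpre p hst]
    exact ⟨(hmem p).2 hst, WignerThird.ncard_Fib_eq_two hm hp⟩
  · intro G hG hG'
    obtain ⟨p, -, rfl⟩ := id hG
    have hp := mt (hmem' p).2 hG'
    rw [not_or] at hp
    rw [hpre p ((hmem p).1 hG)]
    exact WignerThird.ncard_Fib_eq_one hm ((hmem p).1 hG) hp.1 hp.2
  · rw [hLG, WignerThird.UL24, WignerThird.T26, Set.ncard_image_of_injective _ hinj,
      Set.ncard_image_of_injective _ hinj, Set.ncard_image_of_injective _ hinj, hNC]
  · have hst := WignerThird.ncard_isStructured hm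
    rw [hDB, WignerThird.UL24, WignerThird.T26, WignerThird.UC24, WignerThird.T244]
    simp only [Set.ncard_image_of_injective _ hinj]
    -- The bicircuit graphs are the structured ones minus the other four types; `hNC` replaces the
    -- number of structured ones by that of the pairings, which doubles the terms of both types with
    -- two preimages.
    omega
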